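/- Let $\gamma:\mathbb R\to\mathbb R$ be a curve which near the origin is smooth, without critical points and of the following variation type: there is $\delta>0$ with $\gamma\in C^4((-\delta,\delta)\setminus\{0\})$ and $|\gamma'|>0$ on $(-\delta,\delta)\setminus\{0\}$, and $$\sup_{\alpha>0}\#\{j\in\mathbb Z,\ j\ge 0:\ |2^{-j}\gamma'(2^{-j})|\in[\alpha,2\alpha]\}<\infty .$$ (If $\gamma$ is not differentiable at $2^{-j}$, which can happen only for the finitely many $j$ with $2^{-j}\ge\delta$, we put $\gamma'(2^{-j}):=0$.) Let $\phi:\mathbb R\to\mathbb C$ be smooth and compactly supported with $\operatorname{supp}\phi\subset\{x:\frac1{10}<|x|<10\}$. For integers $j\ge0$ and $p_0\ge 1$ put $$\phi_{j,p_0}(\eta):=\phi\Big(\frac{\gamma'(2^{-j})\,\eta}{2^{j}}-p_0\Big),\qquad \check\phi_{j,p_0}(x):=\frac1{2\pi}\int_{\mathbb R}\phi_{j,p_0}(\eta)\,e^{ix\eta}\,d\eta .$$ Let $1<p<\infty$ and $\frac1p+\frac1{p'}=1$. Then there is a constant $C$ depending only on $p$, $\gamma$ and $\phi$ such that for every integer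 $m\ge0$ for which no piece sees the zero frequency, i.e. $\phi(-p_0)=0$ for all integers $2^m\le p_0\le 2^{m+1}$ (this holds automatically for every $m\ge4$), and for all $g\in L^\infty(\mathbb R)$ and $h\in L^{p'}(\mathbb R)$, $$\Big\|\Big(\sum_{j\ge0}\ \sum_{p_0=2^m}^{2^{m+1}}\big|(g*\check\phi_{j,p_0})(x)\,(h*\check\phi_{j,p_0})(x)\big|^{2}\Big)^{1/2}\Big\|_{L^{p'}(dx)}\le C\,\|g\|_{L^\infty}\,\|h\|_{L^{p'}} .$$ -/

import Mathlib

open MeasureTheory Set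
open scoped ENNReal NNReal Convolution ContDiff

noncomputable section

namespace CurvedBHT

/-- Smoothness, absence of critical points and variation of the curve `γ` near the origin:
`γ` is of class `C^4` with non-vanishing derivative on `(-δ, δ) \ {0}` for some `δ > 0`, and
`sup_{α > 0} #{j ≥ 0 : |2^{-j} γ'(2^{-j})| ∈ [α, 2α]} < ∞`. -/
structure AdmissibleNearOrigin (γ : ℝ → ℝ) : Prop where
  smooth_noCritical : ∃ δ : ℝ, 0 < δ ∧ ContDiffOn ℝ 4 γ (Ioo (-δ) δ \ {0}) ∧
    ∀ t ∈ Ioo (-δ) δ \ {0}, 0 < |deriv γ t|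
  variation : ∃ K : ℕ, ∀ α : ℝ, 0 < α →
    {j : ℕ | |(2 : ℝ) ^ (-(j : ℤ)) * deriv γ ((2 : ℝ) ^ (-(j : ℤ)))| ∈ Icc α (2 * α)}.encard ≤ K

/-- The inverse Fourier transform `φ̌(x) = (2π)⁻¹ ∫ φ(ξ) e^{i x ξ} dξ`. -/
def invFourier (φ : ℝ → ℂ) (x : ℝ) : ℂ :=
  (2 * (Real.pi : ℂ))⁻¹ * ∫ ξ : ℝ, φ ξ * Complex.exp (Complex.I * (x : ℂ) * (ξ : ℂ))

/-- The frequency localisation `φ_{j,p₀}(η) = φ(γ'(2^{-j}) η / 2^j - p₀)`. -/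
def phiPiece (γ : ℝ → ℝ) (φ : ℝ → ℂ) (j p₀ : ℕ) (η : ℝ) : ℂ :=
  φ (deriv γ ((2 : ℝ) ^ (-(j : ℤ))) * η / 2 ^ j - p₀)

/-- The convolution `f * φ̌_{j,p₀}`. -/
def localize (γ : ℝ → ℝ) (φ : ℝ → ℂ) (j p₀ : ℕ) (f : ℝ → ℂ) : ℝ → ℂ :=
  f ⋆[ContinuousLinearMap.mul ℂ ℂ, volume] invFourier (phiPiece γ φ j p₀)

/-- The square function
`(∑_{j ∈ ℕ} ∑_{p₀ = 2^m}^{2^{m+1}} |(g * φ̌_{j,p₀})(x) (h * φ̌_{j,p₀})(x)|²)^{1/2}`,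
with values in `[0, ∞]`. -/
def squareFunction (γ : ℝ → ℝ) (φ : ℝ → ℂ) (m : ℕ) (g h : ℝ → ℂ) (x : ℝ) : ℝ≥0∞ :=
  (∑' j : ℕ, ∑ p₀ ∈ Finset.Icc (2 ^ m) (2 ^ (m + 1)),
    ‖localize γ φ j p₀ g x * localize γ φ j p₀ h x‖ₑ ^ 2) ^ (1 / 2 : ℝ)

end CurvedBHT

end

/-! Write `a_j = 2^{-j} γ'(2^{-j})`, which is `scale γ j`. When `a_j ≠ 0`, the kernel of the piece
`(j, p)` is `|a_j|⁻¹ φ̌(x / a_j)` modulated by `e^{i p x / a_j}`: all pieces of one scale share an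
envelope and differ by an integer frequency. This decouples the two factors: at each point the sum
over `p` is taken on `g` and the supremum over `p` on `h`.

For `g`, rescaling by `a_j` turns `(g * φ̌_{j,p})(x)` into the Fourier coefficient at frequency `p`
of a function bounded by a multiple of `‖g‖_∞ (1 + u²)⁻¹`. A Bessel inequality on the line
(`exists_sum_norm_sq_integral_exp_le`) bounds the square sum over `p` by `C ‖g‖_∞²`, uniformly in
`x`, `j` and `m`.

It remains to bound the `L^{p'}` norm of `(∑_j sup_p |h * φ̌_{j,p}|²)^{1/2}`. For `m ≥ 4` every
piece of the block lives where `a_j η / 2^m` is in `[3/8, 21/8]`, so `h` may first be replaced by a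
Littlewood–Paley piece `h * ψ_j`, with `ψ_j` independent of `p`. The shared envelope is dominated by
a Poisson bump at scale `|a_j|`, so the supremum is at most `D P_{a_j} * |h * ψ_j|`. The
vector-valued inequality `convLpBound_poissonKernel` removes the Poisson averages, and the
Littlewood–Paley inequality `exists_convLpBound_dilateKernel` controls the rest. The variation
hypothesis makes the `a_j` lacunary up to bounded multiplicity; dividing them by `2^m` does not
change this, so the constant does not depend on `m`. For `m < 4` there are boundedly many `p`, and
`φ(-p) = 0` makes each `φ(· - p)` itself a Littlewood–Paley bump.

Both vector-valued inequalities come from Calderón–Zygmund theory for operator-valued convolution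
kernels: an `L²` bound from Plancherel or Young, weak type `(1, 1)`, interpolation below `2`,
duality above `2`. -/

noncomputable section

namespace CurvedBHT

open scoped FourierTransform SchwartzMap

/-! ### Dyadic stopping intervals. -/

section DyadicIntervals

/-- The index of the dyadic interval of length `L / 2 ^ n` that contains `x`. -/
def dyadicIndex (L : ℝ) (n : ℕ) (x : ℝ) : ℤ := ⌊x * 2 ^ n / L⌋

/-- The dyadic interval `[k L / 2 ^ n, (k + 1) L / 2 ^ n)`. -/
def dyadicIco (L : ℝ) (n : ℕ) (k : ℤ) : Set ℝ := Ico (k * (L / 2 ^ n)) ((k + 1) * (L / 2 ^ n))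

variable {L : ℝ}

lemma mem_dyadicIco_iff (hL : 0 < L) {n : ℕ} {k : ℤ} {x : ℝ} :
    x ∈ dyadicIco L n k ↔ dyadicIndex L n x = k := by
  have h2 : (0 : ℝ) < 2 ^ n := by positivity
  have hx : x * 2 ^ n / L = x / (L / 2 ^ n) := by field_simp
  rw [dyadicIco, dyadicIndex, Int.floor_eq_iff, mem_Ico, hx, le_div_iff₀ (by positivity),
    div_lt_iff₀ (by positivity)]

lemma dyadicIndex_succ (n : ℕ) (x : ℝ) : dyadicIndex L n x = dyadicIndex L (n + 1) x / 2 := by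
  rw [dyadicIndex, dyadicIndex, ← Nat.cast_two (R := ℤ), ← Int.floor_div_natCast]
  congr 1
  push_cast
  rw [pow_succ]
  ring

lemma dyadicIndex_eq_of_le {m n : ℕ} (hmn : m ≤ n) {x y : ℝ}
    (h : dyadicIndex L n x = dyadicIndex L n y) : dyadicIndex L m x = dyadicIndex L m y := by
  induction n, hmn using Nat.le_induction with
  | base => exact h
  | succ n _ ih => exact ih (by rw [dyadicIndex_succ n x, dyadicIndex_succ n y, h])

lemma dyadicIco_eq_Ico_center (n : ℕ) (k : ℤ) :
    dyadicIco L n k = Ico ((k + 1 / 2) * (L / 2 ^ n) - L / 2 ^ n / 2)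
      ((k + 1 / 2) * (L / 2 ^ n) + L / 2 ^ n / 2) := by
  rw [dyadicIco]
  congr 1 <;> ring

/-- Lebesgue differentiation along the dyadic intervals containing `x`. Up to an endpoint each is a
closed ball about its midpoint, so the differentiation theorem is needed for balls that contain `x`
without being centred there. -/
lemma ae_le_of_dyadic_integral_le (hL : 0 < L) {w : ℝ → ℝ} (hw : Integrable w) (l : ℝ) :
    ∀ᵐ x, (∀ n, ∫ y in dyadicIco L n (dyadicIndex L n x), w y ≤ l * (L / 2 ^ n)) → w x ≤ l := by
  filter_upwards [IsUnifLocDoublingMeasure.ae_tendsto_average (μ := volume)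
    hw.locallyIntegrable 1] with x hx hn
  have hpos : ∀ n : ℕ, 0 < L / 2 ^ n / 2 := fun n => by positivity
  have hlim : Filter.Tendsto (fun n : ℕ => L / 2 ^ n / 2) Filter.atTop (nhdsWithin 0 (Ioi 0)) := by
    refine tendsto_nhdsWithin_iff.2 ⟨?_, Filter.Eventually.of_forall hpos⟩
    have := (tendsto_pow_atTop_nhds_zero_of_lt_one (r := (1 / 2 : ℝ)) (by norm_num)
      (by norm_num)).const_mul (L / 2)
    rw [mul_zero] at this
    refine this.congr fun n => ?_
    rw [one_div, inv_pow]
    field_simp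
  have key := hx (l := Filter.atTop)
    (fun n : ℕ => ((dyadicIndex L n x : ℝ) + 1 / 2) * (L / 2 ^ n)) (fun n => L / 2 ^ n / 2) hlim
    (Filter.Eventually.of_forall fun n => by
      have h := (mem_dyadicIco_iff hL (n := n) (x := x)).2 rfl
      rw [dyadicIco_eq_Ico_center] at h
      rw [one_mul, Real.closedBall_eq_Icc]
      exact Ico_subset_Icc_self h)
  refine le_of_tendsto key (Filter.Eventually.of_forall fun n => ?_)
  have h := hn n
  rw [dyadicIco_eq_Ico_center] at h
  rw [Real.closedBall_eq_Icc, setAverage_eq, integral_Icc_eq_integral_Ico, smul_eq_mul,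
    Measure.real, Real.volume_Icc, ENNReal.toReal_ofReal (by linarith [hpos n]),
    inv_mul_le_iff₀ (by linarith [hpos n])]
  refine h.trans (le_of_eq ?_)
  ring

/-- Calderón–Zygmund stopping intervals of an integrable function at height `l`. -/
theorem exists_stopping_intervals {w : ℝ → ℝ} (hw : Integrable w) (hw0 : ∀ x, 0 ≤ w x) {l : ℝ}
    (hl : 0 < l) :
    ∃ (ι : Type) (_ : Countable ι) (c r : ι → ℝ), (∀ i, 0 < r i) ∧
      Pairwise (Function.onFun Disjoint fun i => Ico (c i - r i) (c i + r i)) ∧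
      (∀ i, l * (2 * r i) ≤ ∫ y in Ico (c i - r i) (c i + r i), w y) ∧
      (∀ i, ∫ y in Ico (c i - r i) (c i + r i), w y ≤ 2 * l * (2 * r i)) ∧
      ∀ᵐ x, x ∉ (⋃ i, Ico (c i - r i) (c i + r i)) → w x ≤ l := by
  classical
  have hI : 0 ≤ ∫ y, w y := integral_nonneg hw0
  -- With this length the average of `w` over any interval of generation 0 is at most `l`, so every
  -- bad interval has a parent. The `+ 1` keeps `L` positive when `w` has integral zero.
  set L : ℝ := (∫ y, w y) / l + 1 with hLdef
  have hL : 0 < L := by positivity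
  have hLI : ∫ y, w y ≤ l * L := by
    rw [hLdef, mul_add, mul_div_cancel₀ _ hl.ne']
    linarith
  let bad : ℕ → ℤ → Prop := fun n k => l * (L / 2 ^ n) < ∫ y in dyadicIco L n k, w y
  -- The maximal bad intervals. Maximality makes them disjoint, and the parent, which is twice as
  -- long and not bad, gives the upper bound `2 * l` for the average.
  let S : Set (ℕ × ℤ) := {s | bad s.1 s.2 ∧
    ∀ m < s.1, ∀ x ∈ dyadicIco L s.1 s.2, ¬ bad m (dyadicIndex L m x)}
  have hbad0 : ∀ k, ¬ bad 0 k := fun k hk => by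
    have h1 : ∫ y in dyadicIco L 0 k, w y ≤ ∫ y, w y :=
      setIntegral_le_integral hw (Filter.Eventually.of_forall hw0)
    simp only [bad, pow_zero, div_one] at hk
    linarith
  have hIco : ∀ s : S, Ico ((s.1.2 + 1 / 2) * (L / 2 ^ s.1.1) - L / 2 ^ s.1.1 / 2)
      ((s.1.2 + 1 / 2) * (L / 2 ^ s.1.1) + L / 2 ^ s.1.1 / 2) = dyadicIco L s.1.1 s.1.2 :=
    fun s => (dyadicIco_eq_Ico_center s.1.1 s.1.2).symm
  refine ⟨S, inferInstance, fun s => (s.1.2 + 1 / 2) * (L / 2 ^ s.1.1),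
    fun s => L / 2 ^ s.1.1 / 2, fun s => by positivity, ?_, ?_, ?_, ?_⟩
  · intro s t hst
    simp only [Function.onFun, hIco]
    rw [Set.disjoint_left]
    intro x hxs hxt
    have es := (mem_dyadicIco_iff hL).1 hxs
    have et := (mem_dyadicIco_iff hL).1 hxt
    rcases lt_trichotomy s.1.1 t.1.1 with h | h | h
    · exact t.2.2 _ h x hxt (by rw [es]; exact s.2.1)
    · exact hst (Subtype.ext (Prod.ext h (by rw [← es, ← et, h])))
    · exact s.2.2 _ h x hxs (by rw [et]; exact t.2.1)
  · intro s
    simp only [hIco]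
    refine le_trans (le_of_eq ?_) s.2.1.le
    ring
  · intro s
    simp only [hIco]
    obtain ⟨⟨n, k⟩, hb, hs⟩ := s
    simp only at hb hs ⊢
    rcases n with _ | n
    · exact absurd hb (hbad0 k)
    set x : ℝ := k * (L / 2 ^ (n + 1)) with hx
    have hxm : x ∈ dyadicIco L (n + 1) k := by
      refine ⟨le_rfl, ?_⟩
      have : 0 < L / 2 ^ (n + 1) := by positivity
      nlinarith
    have h1 := hs n (Nat.lt_succ_self n) x hxm
    simp only [bad, not_lt] at h1
    have hsub : dyadicIco L (n + 1) k ⊆ dyadicIco L n (dyadicIndex L n x) := fun y hy => by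
      rw [mem_dyadicIco_iff hL] at hy hxm ⊢
      exact dyadicIndex_eq_of_le n.le_succ (hy.trans hxm.symm)
    have h2 : ∫ y in dyadicIco L (n + 1) k, w y ≤
        ∫ y in dyadicIco L n (dyadicIndex L n x), w y :=
      setIntegral_mono_set hw.integrableOn (Filter.Eventually.of_forall hw0)
        (Filter.Eventually.of_forall hsub)
    refine (h2.trans h1).trans (le_of_eq ?_)
    rw [pow_succ]
    ring
  · filter_upwards [ae_le_of_dyadic_integral_le hL hw l] with x hx hxS
    refine hx fun n => ?_
    by_contra! hcon
    have hex : ∃ n, bad n (dyadicIndex L n x) := ⟨n, hcon⟩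
    refine hxS (mem_iUnion.2 ⟨⟨(Nat.find hex, dyadicIndex L (Nat.find hex) x),
      Nat.find_spec hex, fun m hm y hy => ?_⟩, ?_⟩)
    · have := dyadicIndex_eq_of_le (le_of_lt hm) ((mem_dyadicIco_iff hL).1 hy)
      rw [this]
      exact Nat.find_min hex hm
    · rw [hIco]
      exact (mem_dyadicIco_iff hL).2 rfl

end DyadicIntervals

/-! ### Calderón–Zygmund convolution kernels and the decomposition at a height. -/

section ConvolutionOperators

variable {E F : Type*} [NormedAddCommGroup E] [NormedSpace ℂ E]
  [NormedAddCommGroup F] [NormedSpace ℂ F]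

/-- Convolution with an operator-valued kernel. -/
def convOp (K : ℝ → E →L[ℂ] F) (f : ℝ → E) (x : ℝ) : F := ∫ y, K (x - y) (f y)

/-- Integrable and essentially bounded functions. -/
structure IntegrableBounded (f : ℝ → E) : Prop where
  integrable : Integrable f
  bounded : ∃ M : ℝ, ∀ᵐ x, ‖f x‖ ≤ M

/-- Calderón–Zygmund convolution kernels with smoothness constant `B`. -/
structure IsCZKernel (K : ℝ → E →L[ℂ] F) (B : ℝ≥0) : Prop where
  continuous : Continuous K
  decay : ∃ c : ℝ, ∀ x, ‖K x‖ ≤ c * (1 + x ^ 2)⁻¹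
  smooth : ∀ x y : ℝ, 2 * |y| ≤ |x| → x ≠ 0 → ‖K (x - y) - K x‖ ≤ B * |y| / x ^ 2

namespace IsCZKernel

variable {K : ℝ → E →L[ℂ] F} {B : ℝ≥0} {f g : ℝ → E}

lemma exists_bound (hK : IsCZKernel K B) : ∃ M : ℝ, 0 ≤ M ∧ ∀ x, ‖K x‖ ≤ M := by
  obtain ⟨c, hc⟩ := hK.decay
  have h0 : 0 ≤ c := by simpa using (norm_nonneg (K 0)).trans (hc 0)
  refine ⟨c, h0, fun x => (hc x).trans ?_⟩
  have : (1 + x ^ 2)⁻¹ ≤ 1 := inv_le_one_of_one_le₀ (by nlinarith [sq_nonneg x])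
  nlinarith

lemma integrable (hK : IsCZKernel K B) : Integrable K := by
  obtain ⟨c, hc⟩ := hK.decay
  exact (integrable_inv_one_add_sq.const_mul c).mono' hK.continuous.aestronglyMeasurable
    (Filter.Eventually.of_forall hc)

lemma aestronglyMeasurable_apply (hK : Continuous K) (hf : AEStronglyMeasurable f volume) (x : ℝ) :
    AEStronglyMeasurable (fun y => K (x - y) (f y)) volume :=
  isBoundedBilinearMap_apply.continuous.comp_aestronglyMeasurable₂
    (hK.comp (continuous_const.sub continuous_id)).aestronglyMeasurable hf

lemma integrable_apply (hK : IsCZKernel K B) (hf : Integrable f) (x : ℝ) :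
    Integrable (fun y => K (x - y) (f y)) := by
  obtain ⟨M, hM0, hM⟩ := hK.exists_bound
  refine (hf.norm.const_mul M).mono' (aestronglyMeasurable_apply hK.continuous hf.1 x)
    (Filter.Eventually.of_forall fun y => ?_)
  exact ((K (x - y)).le_opNorm _).trans (mul_le_mul_of_nonneg_right (hM _) (norm_nonneg _))

lemma convOp_sub (hK : IsCZKernel K B) (hf : Integrable f) (hg : Integrable g) (x : ℝ) :
    convOp K (fun y => f y - g y) x = convOp K f x - convOp K g x := by
  simp only [convOp, map_sub]
  exact integral_sub (hK.integrable_apply hf x) (hK.integrable_apply hg x)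

lemma convOp_add (hK : IsCZKernel K B) (hf : Integrable f) (hg : Integrable g) (x : ℝ) :
    convOp K (fun y => f y + g y) x = convOp K f x + convOp K g x := by
  simp only [convOp, map_add]
  exact integral_add (hK.integrable_apply hf x) (hK.integrable_apply hg x)

lemma convOp_eq_convolution : convOp K f = f ⋆[ContinuousLinearMap.apply ℂ F, volume] K := rfl

lemma continuous_convOp (hK : IsCZKernel K B) (hf : Integrable f) : Continuous (convOp K f) := by
  obtain ⟨M, -, hM⟩ := hK.exists_bound
  rw [convOp_eq_convolution]
  exact BddAbove.continuous_convolution_right_of_integrable _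
    ⟨M, by rintro _ ⟨x, rfl⟩; exact hM x⟩ hf hK.continuous

lemma integrableBounded_convOp (hK : IsCZKernel K B) (hf : Integrable f) :
    IntegrableBounded (convOp K f) := by
  obtain ⟨M, hM0, hM⟩ := hK.exists_bound
  have hint : Integrable (convOp K f) := by
    have h : Integrable (fun q : ℝ × ℝ => K (q.1 - q.2) (f q.2)) (volume.prod volume) :=
      Integrable.convolution_integrand (𝕜 := ℂ) (ContinuousLinearMap.apply ℂ F) hf hK.integrable
    exact h.integral_prod_left
  refine ⟨hint, M * ∫ y, ‖f y‖, Filter.Eventually.of_forall fun x => ?_⟩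
  refine (norm_integral_le_integral_norm _).trans ?_
  rw [← integral_const_mul]
  refine integral_mono (hK.integrable_apply hf x).norm (hf.norm.const_mul M) fun y => ?_
  exact ((K (x - y)).le_opNorm _).trans (mul_le_mul_of_nonneg_right (hM _) (norm_nonneg _))

/-- The two half-lines at distance `2 * r` from `c` contribute `1 / 2` each, whatever `r` is. -/
lemma lintegral_compl_Ioo_inv_sq_le {c r : ℝ} (hr : 0 < r) :
    ∫⁻ x in (Ioo (c - 2 * r) (c + 2 * r))ᶜ, ENNReal.ofReal (r / (x - c) ^ 2) ≤ 1 := by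
  have hI : ∫⁻ x in Ioi (2 * r), ENNReal.ofReal (r / x ^ 2) = 2⁻¹ := by
    have h1 : IntegrableOn (fun x : ℝ => r * x ^ (-2 : ℝ)) (Ioi (2 * r)) :=
      (integrableOn_Ioi_rpow_of_lt (by norm_num) (by positivity)).const_mul r
    have h2 : ∀ x ∈ Ioi (2 * r), r / x ^ 2 = r * x ^ (-2 : ℝ) := fun x hx => by
      have hx0 : 0 < x := lt_trans (by positivity) hx
      rw [Real.rpow_neg hx0.le, div_eq_mul_inv]
      norm_cast
    rw [setLIntegral_congr_fun measurableSet_Ioi (fun x hx => by rw [h2 x hx]),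
      ← ofReal_integral_eq_lintegral_ofReal h1, integral_const_mul,
      integral_Ioi_rpow_of_lt (by norm_num) (by positivity)]
    · rw [show (-2 + 1 : ℝ) = -1 by norm_num, Real.rpow_neg_one]
      rw [show r * (-(2 * r)⁻¹ / -1) = 2⁻¹ by field_simp]
      rw [ENNReal.ofReal_inv_of_pos (by norm_num)]
      norm_num
    · filter_upwards [ae_restrict_mem measurableSet_Ioi] with x hx
      have hx0 : 0 < x := lt_trans (by positivity) hx
      positivity
  have hsub : (Ioo (c - 2 * r) (c + 2 * r))ᶜ =
      (fun x => c - x) ⁻¹' Ici (2 * r) ∪ (fun x => x - c) ⁻¹' Ici (2 * r) := by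
    ext x
    simp only [mem_compl_iff, mem_Ioo, not_and_or, not_lt, mem_union, mem_preimage, mem_Ici]
    constructor <;> rintro (h | h) <;> [left; right; left; right] <;> linarith
  rw [hsub]
  refine (lintegral_union_le _ _ _).trans ?_
  have hm : Measurable fun x : ℝ => ENNReal.ofReal (r / x ^ 2) := by fun_prop
  have e1 : ∫⁻ x in (fun x => c - x) ⁻¹' Ici (2 * r), ENNReal.ofReal (r / (x - c) ^ 2) = 2⁻¹ := by
    rw [← hI, ← setLIntegral_congr Ioi_ae_eq_Ici.symm,
      ← (Measure.measurePreserving_sub_left (volume : Measure ℝ) c).setLIntegral_comp_preimage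
        measurableSet_Ici hm]
    refine lintegral_congr fun x => ?_
    rw [← neg_sub, neg_sq]
  have e2 : ∫⁻ x in (fun x => x - c) ⁻¹' Ici (2 * r), ENNReal.ofReal (r / (x - c) ^ 2) = 2⁻¹ := by
    rw [← hI, ← setLIntegral_congr Ioi_ae_eq_Ici.symm,
      ← (measurePreserving_sub_right (volume : Measure ℝ) c).setLIntegral_comp_preimage
        measurableSet_Ici hm]
  rw [e1, e2, ENNReal.inv_two_add_inv_two]

/-- Hörmander's condition: outside the doubled interval `2 * |y - c| ≤ |x - c|`, so the pointwise
smoothness of the kernel applies and is integrated. -/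
lemma lintegral_enorm_sub_le (hK : IsCZKernel K B) {c r y : ℝ} (hr : 0 < r)
    (hy : y ∈ Ico (c - r) (c + r)) :
    ∫⁻ x in (Ioo (c - 2 * r) (c + 2 * r))ᶜ, ‖K (x - y) - K (x - c)‖ₑ ≤ B := by
  calc ∫⁻ x in (Ioo (c - 2 * r) (c + 2 * r))ᶜ, ‖K (x - y) - K (x - c)‖ₑ
      ≤ ∫⁻ x in (Ioo (c - 2 * r) (c + 2 * r))ᶜ, B * ENNReal.ofReal (r / (x - c) ^ 2) := by
        refine setLIntegral_mono' measurableSet_Ioo.compl fun x hx => ?_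
        have hyc : |y - c| ≤ r := abs_le.2 ⟨by linarith [hy.1], by linarith [hy.2]⟩
        have hxc : 2 * r ≤ |x - c| := by
          by_contra! h
          rw [abs_lt] at h
          exact hx ⟨by linarith [h.1], by linarith [h.2]⟩
        have hne : x - c ≠ 0 := fun h => by rw [h, abs_zero] at hxc; linarith
        have h := hK.smooth (x - c) (y - c) (by linarith) hne
        rw [show x - c - (y - c) = x - y by ring] at h
        rw [← ofReal_norm, ← ENNReal.ofReal_coe_nnreal (p := B),
          ← ENNReal.ofReal_mul B.coe_nonneg]
        refine ENNReal.ofReal_le_ofReal (h.trans ?_)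
        rw [mul_div_assoc]
        gcongr
    _ ≤ B := by
        rw [lintegral_const_mul' _ _ ENNReal.coe_ne_top]
        exact (mul_le_mul_right (lintegral_compl_Ioo_inv_sq_le hr) _).trans (by simp)

end IsCZKernel

/-- The Calderón–Zygmund decomposition of an integrable function at height `l`. -/
theorem exists_czDecomposition [CompleteSpace E] {f : ℝ → E} (hf : Integrable f) {l : ℝ}
    (hl : 0 < l) :
    ∃ (g b : ℝ → E) (ι : Type) (_ : Countable ι) (c r : ι → ℝ), (∀ x, f x = g x + b x) ∧
      Integrable g ∧ Integrable b ∧ (∀ᵐ x, ‖g x‖ ≤ 2 * l) ∧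
      ∫⁻ x, ‖g x‖ₑ ≤ ∫⁻ x, ‖f x‖ₑ ∧ ∫⁻ x, ‖b x‖ₑ ≤ 2 * ∫⁻ x, ‖f x‖ₑ ∧
      (∀ i, 0 < r i) ∧
      Pairwise (Function.onFun Disjoint fun i => Ico (c i - r i) (c i + r i)) ∧
      (∀ x, x ∉ (⋃ i, Ico (c i - r i) (c i + r i)) → b x = 0) ∧
      (∀ i, ∫ y in Ico (c i - r i) (c i + r i), b y = 0) ∧
      ∑' i, ENNReal.ofReal (l * (2 * r i)) ≤ ∫⁻ x, ‖f x‖ₑ := by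
  classical
  obtain ⟨ι, hι, c, r, hr, hdisj, hlow, hup, hae⟩ :=
    exists_stopping_intervals hf.norm (fun x => norm_nonneg _) hl
  set D : ι → Set ℝ := fun i => Ico (c i - r i) (c i + r i) with hD
  have hDm : ∀ i, MeasurableSet (D i) := fun i => measurableSet_Ico
  have hUm : MeasurableSet (⋃ i, D i) := MeasurableSet.iUnion hDm
  have hvol : ∀ i, volume (D i) = ENNReal.ofReal (2 * r i) := fun i => by
    rw [hD, Real.volume_Ico]
    congr 1
    ring
  -- The good part averages `f` over each stopping interval; by disjointness the chosen index is the
  -- only possible one.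
  let g : ℝ → E := fun x => if h : ∃ i, x ∈ D i then ⨍ y in D h.choose, f y else f x
  have hgD : ∀ i, ∀ x ∈ D i, g x = ⨍ y in D i, f y := fun i x hx => by
    have h : ∃ i, x ∈ D i := ⟨i, hx⟩
    have : h.choose = i := by
      by_contra hne
      exact Set.disjoint_left.1 (hdisj hne) h.choose_spec hx
    simp only [g, dif_pos h, this]
  have hgU : ∀ x, x ∉ (⋃ i, D i) → g x = f x := fun x hx => by
    have h : ¬ ∃ i, x ∈ D i := fun h => hx (mem_iUnion.2 h)
    simp only [g, dif_neg h]
  have hfD : ∀ i, ∫⁻ x in D i, ‖f x‖ₑ = ENNReal.ofReal (∫ y in D i, ‖f y‖) := fun i => by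
    rw [ofReal_integral_norm_eq_lintegral_enorm hf.integrableOn]
  have havg : ∀ i, ‖⨍ y in D i, f y‖ * (2 * r i) ≤ ∫ y in D i, ‖f y‖ := fun i => by
    have h2 : (0 : ℝ) < 2 * r i := by linarith [hr i]
    rw [setAverage_eq, norm_smul, Measure.real, hvol, ENNReal.toReal_ofReal h2.le, norm_inv,
      Real.norm_of_nonneg h2.le, mul_comm, mul_inv_cancel_left₀ h2.ne']
    exact norm_integral_le_integral_norm _
  have hgDe : ∀ i, ∫⁻ x in D i, ‖g x‖ₑ ≤ ∫⁻ x in D i, ‖f x‖ₑ := fun i => by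
    rw [setLIntegral_congr_fun (hDm i) (fun x hx => by rw [hgD i x hx]), setLIntegral_const, hvol,
      hfD, ← ofReal_norm, ← ENNReal.ofReal_mul (norm_nonneg _)]
    exact ENNReal.ofReal_le_ofReal (havg i)
  have hgm : AEStronglyMeasurable g volume := by
    rw [← Measure.restrict_univ (μ := (volume : Measure ℝ)), ← union_compl_self (⋃ i, D i),
      aestronglyMeasurable_union_iff, aestronglyMeasurable_iUnion_iff]
    refine ⟨fun i => ?_, ?_⟩
    · refine (aestronglyMeasurable_const (b := ⨍ y in D i, f y)).congr ?_
      filter_upwards [ae_restrict_mem (hDm i)] with x hx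
      exact (hgD i x hx).symm
    · refine hf.1.restrict.congr ?_
      filter_upwards [ae_restrict_mem hUm.compl] with x hx
      exact (hgU x hx).symm
  have hgl : ∫⁻ x, ‖g x‖ₑ ≤ ∫⁻ x, ‖f x‖ₑ := by
    rw [← lintegral_add_compl _ hUm, ← lintegral_add_compl (fun x => ‖f x‖ₑ) hUm,
      lintegral_iUnion hDm hdisj, lintegral_iUnion hDm hdisj]
    refine add_le_add (ENNReal.tsum_le_tsum hgDe) (le_of_eq ?_)
    exact setLIntegral_congr_fun hUm.compl (fun x hx => by rw [hgU x hx])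
  have hgi : Integrable g := ⟨hgm, hgl.trans_lt hf.2⟩
  refine ⟨g, fun x => f x - g x, ι, hι, c, r, fun x => (add_sub_cancel _ _).symm, hgi, hf.sub hgi, ?_, hgl, ?_, hr,
    hdisj, fun x hx => by simp only [hgU x hx, sub_self], fun i => ?_, ?_⟩
  · filter_upwards [hae] with x hx
    by_cases h : x ∈ ⋃ i, D i
    · obtain ⟨i, hi⟩ := mem_iUnion.1 h
      rw [hgD i x hi]
      have h2 : (0 : ℝ) < 2 * r i := by linarith [hr i]
      exact le_of_mul_le_mul_right ((havg i).trans (hup i)) h2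
    · rw [hgU x h]
      linarith [hx h]
  · calc ∫⁻ x, ‖f x - g x‖ₑ ≤ ∫⁻ x, ‖f x‖ₑ + ‖g x‖ₑ := lintegral_mono fun x => enorm_sub_le
      _ = (∫⁻ x, ‖f x‖ₑ) + ∫⁻ x, ‖g x‖ₑ := lintegral_add_left' hf.1.enorm _
      _ ≤ 2 * ∫⁻ x, ‖f x‖ₑ := by rw [two_mul]; exact add_le_add le_rfl hgl
  · rw [integral_sub hf.integrableOn hgi.integrableOn,
      setIntegral_congr_fun (hDm i) (fun x hx => hgD i x hx), setIntegral_const]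
    rw [setAverage_eq, smul_inv_smul₀, sub_self]
    rw [Measure.real, hvol, ENNReal.toReal_ofReal] <;> linarith [hr i]
  · calc ∑' i, ENNReal.ofReal (l * (2 * r i)) ≤ ∑' i, ∫⁻ x in D i, ‖f x‖ₑ :=
          ENNReal.tsum_le_tsum fun i => by
            rw [hfD]
            exact ENNReal.ofReal_le_ofReal (hlow i)
      _ = ∫⁻ x in ⋃ i, D i, ‖f x‖ₑ := (lintegral_iUnion hDm hdisj _).symm
      _ ≤ ∫⁻ x, ‖f x‖ₑ := setLIntegral_le_lintegral _ _

/-! ### The bad part away from the doubled intervals. -/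

namespace IsCZKernel

variable {K : ℝ → E →L[ℂ] F} {A B : ℝ≥0} {f : ℝ → E}

/-- The mean of `b` over each interval vanishes, so `K (x - y)` may be replaced there by `K (x - y)
- K (x - c i)`. After Tonelli, each interval needs only Hörmander's condition off its own double. -/
lemma lintegral_convOp_bad_le [CompleteSpace E] [CompleteSpace F] (hK : IsCZKernel K B)
    {ι : Type} [Countable ι] {b : ℝ → E} {c r : ι → ℝ} (hb : Integrable b) (hr : ∀ i, 0 < r i)
    (hd : Pairwise (Function.onFun Disjoint fun i => Ico (c i - r i) (c i + r i)))
    (hb0 : ∀ x, x ∉ (⋃ i, Ico (c i - r i) (c i + r i)) → b x = 0)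
    (hbm : ∀ i, ∫ y in Ico (c i - r i) (c i + r i), b y = 0) :
    ∫⁻ x in (⋃ i, Ioo (c i - 2 * r i) (c i + 2 * r i))ᶜ, ‖convOp K b x‖ₑ
      ≤ B * ∫⁻ x, ‖b x‖ₑ := by
  set D : ι → Set ℝ := fun i => Ico (c i - r i) (c i + r i) with hD
  have hDm : ∀ i, MeasurableSet (D i) := fun i => measurableSet_Ico
  have hpt : ∀ x, ‖convOp K b x‖ₑ
      ≤ ∑' i, ∫⁻ y in D i, ‖K (x - y) - K (x - c i)‖ₑ * ‖b y‖ₑ := fun x => by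
    have hi := hK.integrable_apply hb x
    have h1 : convOp K b x = ∑' i, ∫ y in D i, K (x - y) (b y) := by
      rw [convOp, ← setIntegral_eq_integral_of_forall_compl_eq_zero (s := ⋃ i, D i)]
      · exact (hasSum_integral_iUnion hDm hd hi.integrableOn).tsum_eq.symm
      · intro y hy
        rw [hb0 y hy, map_zero]
    rw [h1]
    refine enorm_tsum_le_tsum_enorm.trans (ENNReal.tsum_le_tsum fun i => ?_)
    have h2 : ∫ y in D i, K (x - c i) (b y) = 0 := by
      rw [ContinuousLinearMap.integral_comp_comm _ hb.integrableOn, hbm i, map_zero]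
    have h3 : ∫ y in D i, K (x - y) (b y) = ∫ y in D i, (K (x - y) - K (x - c i)) (b y) := by
      rw [← sub_zero (∫ y in D i, K (x - y) (b y)), ← h2, ← integral_sub hi.integrableOn
        ((K (x - c i)).integrable_comp hb).integrableOn]
      rfl
    rw [h3]
    refine (enorm_integral_le_lintegral_enorm _).trans (lintegral_mono fun y => ?_)
    exact (K (x - y) - K (x - c i)).le_opENorm _
  set G : Set ℝ := (⋃ i, Ioo (c i - 2 * r i) (c i + 2 * r i))ᶜ
  have hmeas : ∀ i (s : Set ℝ), AEMeasurable (Function.uncurry fun x y =>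
      ‖K (x - y) - K (x - c i)‖ₑ * ‖b y‖ₑ) ((volume.restrict s).prod (volume.restrict (D i))) :=
    fun i s => by
      refine AEMeasurable.mul (f := fun q : ℝ × ℝ => ‖K (q.1 - q.2) - K (q.1 - c i)‖ₑ)
        (g := fun q : ℝ × ℝ => ‖b q.2‖ₑ) ?_ ?_
      · have hc : Continuous fun q : ℝ × ℝ => K (q.1 - q.2) - K (q.1 - c i) := by
          have := hK.continuous
          fun_prop
        exact hc.enorm.measurable.aemeasurable
      · exact hb.1.restrict.enorm.comp_snd
  calc ∫⁻ x in G, ‖convOp K b x‖ₑ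
      ≤ ∫⁻ x in G, ∑' i, ∫⁻ y in D i, ‖K (x - y) - K (x - c i)‖ₑ * ‖b y‖ₑ :=
        lintegral_mono hpt
    _ = ∑' i, ∫⁻ x in G, ∫⁻ y in D i, ‖K (x - y) - K (x - c i)‖ₑ * ‖b y‖ₑ :=
        lintegral_tsum fun i => (hmeas i G).lintegral_prod_right'
    _ ≤ ∑' i, ∫⁻ y in D i, B * ‖b y‖ₑ := ENNReal.tsum_le_tsum fun i => by
        refine (lintegral_mono_set (compl_subset_compl.2 (subset_iUnion (fun i =>
          Ioo (c i - 2 * r i) (c i + 2 * r i)) i))).trans ?_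
        rw [lintegral_lintegral_swap (hmeas i _)]
        refine setLIntegral_mono' (hDm i) fun y hy => ?_
        have hc : Continuous fun x => K (x - y) - K (x - c i) := by
          have := hK.continuous
          fun_prop
        rw [lintegral_mul_const _ hc.enorm.measurable]
        gcongr
        exact hK.lintegral_enorm_sub_le (hr i) hy
    _ = B * ∫⁻ y in ⋃ i, D i, ‖b y‖ₑ := by
        rw [lintegral_iUnion hDm hd, ← ENNReal.tsum_mul_left]
        exact tsum_congr fun i => lintegral_const_mul' _ _ ENNReal.coe_ne_top
    _ ≤ B * ∫⁻ x, ‖b x‖ₑ := mul_le_mul_right (setLIntegral_le_lintegral _ _) _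

end IsCZKernel

/-- `‖K * f‖_q ^ q ≤ C ‖f‖_q ^ q` for all integrable bounded `f`. -/
def ConvLpBound (K : ℝ → E →L[ℂ] F) (q : ℝ) (C : ℝ≥0) : Prop :=
  ∀ f : ℝ → E, IntegrableBounded f → ∫⁻ x, ‖convOp K f x‖ₑ ^ q ≤ C * ∫⁻ x, ‖f x‖ₑ ^ q

lemma enorm_rpow_eq_ofReal {G : Type*} [NormedAddCommGroup G] (z : G) {q : ℝ} (hq : 0 ≤ q) :
    ‖z‖ₑ ^ q = ENNReal.ofReal (‖z‖ ^ q) := by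
  rw [← ofReal_norm, ENNReal.ofReal_rpow_of_nonneg (norm_nonneg _) hq]

/-! ### Layer-cake integrals of truncations. -/

section TruncatedIntegrals

variable {α : Type*} [MeasurableSpace α] {μ : Measure α} [SFinite μ]

/-- The integral of `t ^ (q - 2)` over `(0, w)` converges at `0` because `1 < q`. This is the share
of the interpolation argument carried by the weak type bound. -/
lemma lintegral_rpow_mul_lt_le {q w : ℝ} (hq : 1 < q) (hw : 0 ≤ w) :
    ∫⁻ t in Ioi (0 : ℝ), ENNReal.ofReal (t ^ (q - 2)) * (if t < w then ENNReal.ofReal w else 0)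
      ≤ ENNReal.ofReal (1 / (q - 1)) * ENNReal.ofReal (w ^ q) := by
  have hq1 : 0 < q - 1 := by linarith
  rcases hw.eq_or_lt with rfl | hw
  · simp
  have hint : IntegrableOn (fun t : ℝ => t ^ (q - 2)) (Ioc 0 w) :=
    (intervalIntegrable_iff_integrableOn_Ioc_of_le hw.le).1
      (intervalIntegral.intervalIntegrable_rpow' (by linarith))
  calc ∫⁻ t in Ioi (0 : ℝ), ENNReal.ofReal (t ^ (q - 2)) * (if t < w then ENNReal.ofReal w else 0)
      ≤ ∫⁻ t, (Ioc 0 w).indicator (fun t => ENNReal.ofReal (t ^ (q - 2))) t * ENNReal.ofReal w := by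
        rw [← lintegral_indicator measurableSet_Ioi]
        refine lintegral_mono fun t => ?_
        by_cases h0 : 0 < t
        · by_cases h1 : t < w
          · simp [indicator, h0, h1, h1.le]
          · rw [indicator_of_mem (mem_Ioi.2 h0), if_neg h1, mul_zero]
            exact zero_le
        · simp [h0]
    _ = ENNReal.ofReal (w ^ (q - 1) / (q - 1)) * ENNReal.ofReal w := by
        rw [lintegral_mul_const' _ _ ENNReal.ofReal_ne_top, lintegral_indicator measurableSet_Ioc,
          ← ofReal_integral_eq_lintegral_ofReal hint, ← intervalIntegral.integral_of_le hw.le,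
          integral_rpow (Or.inl (by linarith)), show q - 2 + 1 = q - 1 by ring,
          Real.zero_rpow hq1.ne', sub_zero]
        filter_upwards [ae_restrict_mem measurableSet_Ioc] with t ht
        exact Real.rpow_nonneg ht.1.le _
    _ = ENNReal.ofReal (1 / (q - 1)) * ENNReal.ofReal (w ^ q) := by
        rw [← ENNReal.ofReal_mul (by positivity), ← ENNReal.ofReal_mul (by positivity)]
        congr 1
        rw [Real.rpow_sub_one hw.ne']
        field_simp

/-- The integral of `t ^ (q - 3)` over `(w, ∞)` converges at infinity because `q < 2`. This is the
share carried by the `L²` bound. -/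
lemma lintegral_rpow_mul_ge_le {q w : ℝ} (hq : q < 2) (hw : 0 ≤ w) :
    ∫⁻ t in Ioi (0 : ℝ), ENNReal.ofReal (t ^ (q - 3)) *
        (if w ≤ t then ENNReal.ofReal (w ^ (2 : ℝ)) else 0)
      ≤ ENNReal.ofReal (1 / (2 - q)) * ENNReal.ofReal (w ^ q) := by
  have hq1 : 0 < 2 - q := by linarith
  rcases hw.eq_or_lt with rfl | hw
  · simp
  have hint : IntegrableOn (fun t : ℝ => t ^ (q - 3)) (Ioi w) :=
    integrableOn_Ioi_rpow_of_lt (by linarith) hw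
  calc ∫⁻ t in Ioi (0 : ℝ), ENNReal.ofReal (t ^ (q - 3)) *
        (if w ≤ t then ENNReal.ofReal (w ^ (2 : ℝ)) else 0)
      ≤ ∫⁻ t, (Ici w).indicator (fun t => ENNReal.ofReal (t ^ (q - 3))) t *
          ENNReal.ofReal (w ^ (2 : ℝ)) := by
        rw [← lintegral_indicator measurableSet_Ioi]
        refine lintegral_mono fun t => ?_
        by_cases h0 : 0 < t
        · by_cases h1 : w ≤ t
          · simp [indicator, h0, h1]
          · simp [h1]
        · simp [h0]
    _ = ENNReal.ofReal (w ^ (q - 2) / (2 - q)) * ENNReal.ofReal (w ^ (2 : ℝ)) := by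
        rw [lintegral_mul_const' _ _ ENNReal.ofReal_ne_top, lintegral_indicator measurableSet_Ici,
          setLIntegral_congr Ioi_ae_eq_Ici.symm, ← ofReal_integral_eq_lintegral_ofReal hint,
          integral_Ioi_rpow_of_lt (by linarith) hw, show q - 3 + 1 = q - 2 by ring,
          show q - 2 = -(2 - q) by ring, neg_div_neg_eq]
        filter_upwards [ae_restrict_mem measurableSet_Ioi] with t ht
        exact Real.rpow_nonneg (hw.trans ht).le _
    _ = ENNReal.ofReal (1 / (2 - q)) * ENNReal.ofReal (w ^ q) := by
        rw [← ENNReal.ofReal_mul (by positivity), ← ENNReal.ofReal_mul (by positivity)]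
        congr 1
        rw [div_mul_eq_mul_div, ← Real.rpow_add hw]
        ring_nf

lemma lintegral_rpow_mul_lintegral_lt_le {q : ℝ} (hq : 1 < q) {w : α → ℝ} (hw : AEMeasurable w μ)
    (hw0 : ∀ x, 0 ≤ w x) :
    ∫⁻ t in Ioi (0 : ℝ), ENNReal.ofReal (t ^ (q - 2)) *
        ∫⁻ x, (if t < w x then ENNReal.ofReal (w x) else 0) ∂μ
      ≤ ENNReal.ofReal (1 / (q - 1)) * ∫⁻ x, ENNReal.ofReal (w x ^ q) ∂μ := by
  have hm : AEMeasurable (Function.uncurry fun (t : ℝ) (x : α) =>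
      ENNReal.ofReal (t ^ (q - 2)) * (if t < w x then ENNReal.ofReal (w x) else 0))
      ((volume.restrict (Ioi 0)).prod μ) := by
    obtain ⟨v, hv, hwv⟩ := hw
    have h1 : Measurable (Function.uncurry fun (t : ℝ) (x : α) =>
        ENNReal.ofReal (t ^ (q - 2)) * (if t < v x then ENNReal.ofReal (v x) else 0)) := by
      refine Measurable.mul (f := fun z : ℝ × α => ENNReal.ofReal (z.1 ^ (q - 2)))
        (g := fun z : ℝ × α => if z.1 < v z.2 then ENNReal.ofReal (v z.2) else 0)
        (by fun_prop) (Measurable.ite ?_ (by fun_prop) (by fun_prop))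
      exact measurableSet_lt (by fun_prop) (by fun_prop)
    refine h1.aemeasurable.congr ?_
    have h2 := (Measure.quasiMeasurePreserving_snd (μ := volume.restrict (Ioi (0 : ℝ)))
      (ν := μ)).ae hwv
    filter_upwards [h2] with z hz
    simp only [Function.uncurry, hz]
  calc ∫⁻ t in Ioi (0 : ℝ), ENNReal.ofReal (t ^ (q - 2)) *
        ∫⁻ x, (if t < w x then ENNReal.ofReal (w x) else 0) ∂μ
      = ∫⁻ t in Ioi (0 : ℝ), (∫⁻ x, ENNReal.ofReal (t ^ (q - 2)) *
          (if t < w x then ENNReal.ofReal (w x) else 0) ∂μ) :=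
        lintegral_congr fun t => (lintegral_const_mul' _ _ ENNReal.ofReal_ne_top).symm
    _ = ∫⁻ x, (∫⁻ t in Ioi (0 : ℝ), ENNReal.ofReal (t ^ (q - 2)) *
          (if t < w x then ENNReal.ofReal (w x) else 0)) ∂μ := lintegral_lintegral_swap hm
    _ ≤ ∫⁻ x, ENNReal.ofReal (1 / (q - 1)) * ENNReal.ofReal (w x ^ q) ∂μ :=
        lintegral_mono fun x => lintegral_rpow_mul_lt_le hq (hw0 x)
    _ = _ := lintegral_const_mul' _ _ ENNReal.ofReal_ne_top

lemma lintegral_rpow_mul_lintegral_ge_le {q : ℝ} (hq : q < 2) {w : α → ℝ} (hw : AEMeasurable w μ)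
    (hw0 : ∀ x, 0 ≤ w x) :
    ∫⁻ t in Ioi (0 : ℝ), ENNReal.ofReal (t ^ (q - 3)) *
        ∫⁻ x, (if w x ≤ t then ENNReal.ofReal (w x ^ (2 : ℝ)) else 0) ∂μ
      ≤ ENNReal.ofReal (1 / (2 - q)) * ∫⁻ x, ENNReal.ofReal (w x ^ q) ∂μ := by
  have hm : AEMeasurable (Function.uncurry fun (t : ℝ) (x : α) =>
      ENNReal.ofReal (t ^ (q - 3)) * (if w x ≤ t then ENNReal.ofReal (w x ^ (2 : ℝ)) else 0))
      ((volume.restrict (Ioi 0)).prod μ) := by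
    obtain ⟨v, hv, hwv⟩ := hw
    have h1 : Measurable (Function.uncurry fun (t : ℝ) (x : α) =>
        ENNReal.ofReal (t ^ (q - 3)) *
          (if v x ≤ t then ENNReal.ofReal (v x ^ (2 : ℝ)) else 0)) := by
      refine Measurable.mul (f := fun z : ℝ × α => ENNReal.ofReal (z.1 ^ (q - 3)))
        (g := fun z : ℝ × α => if v z.2 ≤ z.1 then ENNReal.ofReal (v z.2 ^ (2 : ℝ)) else 0)
        (by fun_prop) (Measurable.ite ?_ (by fun_prop) (by fun_prop))
      exact measurableSet_le (by fun_prop) (by fun_prop)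
    refine h1.aemeasurable.congr ?_
    have h2 := (Measure.quasiMeasurePreserving_snd (μ := volume.restrict (Ioi (0 : ℝ)))
      (ν := μ)).ae hwv
    filter_upwards [h2] with z hz
    simp only [Function.uncurry, hz]
  calc ∫⁻ t in Ioi (0 : ℝ), ENNReal.ofReal (t ^ (q - 3)) *
        ∫⁻ x, (if w x ≤ t then ENNReal.ofReal (w x ^ (2 : ℝ)) else 0) ∂μ
      = ∫⁻ t in Ioi (0 : ℝ), (∫⁻ x, ENNReal.ofReal (t ^ (q - 3)) *
          (if w x ≤ t then ENNReal.ofReal (w x ^ (2 : ℝ)) else 0) ∂μ) :=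
        lintegral_congr fun t => (lintegral_const_mul' _ _ ENNReal.ofReal_ne_top).symm
    _ = ∫⁻ x, (∫⁻ t in Ioi (0 : ℝ), ENNReal.ofReal (t ^ (q - 3)) *
          (if w x ≤ t then ENNReal.ofReal (w x ^ (2 : ℝ)) else 0)) ∂μ := lintegral_lintegral_swap hm
    _ ≤ ∫⁻ x, ENNReal.ofReal (1 / (2 - q)) * ENNReal.ofReal (w x ^ q) ∂μ :=
        lintegral_mono fun x => lintegral_rpow_mul_ge_le hq (hw0 x)
    _ = _ := lintegral_const_mul' _ _ ENNReal.ofReal_ne_top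

end TruncatedIntegrals

/-! ### Weak type `(1, 1)`. -/

namespace IsCZKernel

variable {K : ℝ → E →L[ℂ] F} {A B : ℝ≥0} {f : ℝ → E}

lemma rpow_mul_measure_lt_le {G : Type*} [NormedAddCommGroup G] {u : ℝ → G}
    (hu : AEStronglyMeasurable u volume) {q t : ℝ} (hq : 0 < q) :
    ENNReal.ofReal t ^ q * volume {x | t < ‖u x‖} ≤ ∫⁻ x, ‖u x‖ₑ ^ q := by
  refine le_trans ?_ (mul_meas_ge_le_lintegral₀ (hu.enorm.pow_const q) (ENNReal.ofReal t ^ q))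
  gcongr
  intro hx
  gcongr
  rw [← ofReal_norm]
  exact ENNReal.ofReal_le_ofReal hx.le

/-- The weak type `(1, 1)` bound. -/
theorem weak_type [CompleteSpace E] [CompleteSpace F] (hK : IsCZKernel K B)
    (hA : ConvLpBound K 2 A) (hf : Integrable f) {l : ℝ} (hl : 0 < l) :
    ENNReal.ofReal l * volume {x | l < ‖convOp K f x‖} ≤ (8 * A + 4 * B + 2) * ∫⁻ x, ‖f x‖ₑ := by
  obtain ⟨g, b, ι, hι, c, r, hfgb, hg, hb, hgl, hg1, hb1, hr, hd, hb0, hbm, hsum⟩ :=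
    exists_czDecomposition hf hl
  set I := ∫⁻ x, ‖f x‖ₑ
  set U := ⋃ i, Ioo (c i - 2 * r i) (c i + 2 * r i) with hU
  have hsub : {x | l < ‖convOp K f x‖} ⊆
      {x | l / 2 < ‖convOp K g x‖} ∪ (({x | l / 2 < ‖convOp K b x‖} ∩ Uᶜ) ∪ U) := by
    intro x hx
    by_contra hcon
    simp only [mem_union, mem_inter_iff, mem_compl_iff, not_or, not_and, not_not,
      mem_ofPred_eq, not_lt] at hcon
    obtain ⟨h1, h2, h3⟩ := hcon
    have h4 : ‖convOp K b x‖ ≤ l / 2 := by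
      by_contra! h
      exact h3 (h2 h)
    have h5 : convOp K f x = convOp K g x + convOp K b x := by
      rw [← hK.convOp_add hg hb]
      congr 1
      funext y
      exact hfgb y
    have := norm_add_le (convOp K g x) (convOp K b x)
    rw [← h5] at this
    simp only [mem_ofPred_eq] at hx
    linarith
  have hl0 : ENNReal.ofReal l ≠ 0 := by simpa using hl
  have hlt : ENNReal.ofReal l ≠ ⊤ := ENNReal.ofReal_ne_top
  have hhalf : ENNReal.ofReal l = 2 * ENNReal.ofReal (l / 2) := by
    rw [← ENNReal.ofReal_ofNat, ← ENNReal.ofReal_mul (by norm_num)]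
    congr 1
    ring
  -- Chebyshev in `L²` for the good part. The factor `8` is `4` from the height `l / 2` squared
  -- times `2` from `‖g‖ ≤ 2 * l`.
  have B1 : ENNReal.ofReal l * volume {x | l / 2 < ‖convOp K g x‖} ≤ 8 * A * I := by
    have h1 := rpow_mul_measure_lt_le (hK.continuous_convOp hg).aestronglyMeasurable
      (q := 2) (t := l / 2) (by norm_num)
    have h2 : ∫⁻ x, ‖g x‖ₑ ^ (2 : ℝ) ≤ 2 * ENNReal.ofReal l * I := by
      calc ∫⁻ x, ‖g x‖ₑ ^ (2 : ℝ) ≤ ∫⁻ x, 2 * ENNReal.ofReal l * ‖g x‖ₑ := by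
            refine lintegral_mono_ae ?_
            filter_upwards [hgl] with x hx
            rw [ENNReal.rpow_two, sq]
            gcongr
            rw [← ofReal_norm, ← ENNReal.ofReal_ofNat, ← ENNReal.ofReal_mul (by norm_num)]
            exact ENNReal.ofReal_le_ofReal hx
        _ = 2 * ENNReal.ofReal l * ∫⁻ x, ‖g x‖ₑ :=
            lintegral_const_mul' _ _ (ENNReal.mul_ne_top (by norm_num) hlt)
        _ ≤ 2 * ENNReal.ofReal l * I := by gcongr
    have h3 := h1.trans ((hA g ⟨hg, _, hgl⟩).trans (mul_le_mul_right h2 _))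
    rw [ENNReal.rpow_two] at h3
    have h4 : ENNReal.ofReal l * (ENNReal.ofReal l * volume {x | l / 2 < ‖convOp K g x‖})
        ≤ ENNReal.ofReal l * (8 * A * I) := by
      calc ENNReal.ofReal l * (ENNReal.ofReal l * volume {x | l / 2 < ‖convOp K g x‖})
          = 4 * (ENNReal.ofReal (l / 2) ^ 2 * volume {x | l / 2 < ‖convOp K g x‖}) := by
            rw [hhalf]
            ring
        _ ≤ 4 * (A * (2 * ENNReal.ofReal l * I)) := by gcongr
        _ = ENNReal.ofReal l * (8 * A * I) := by ring
    exact (ENNReal.mul_le_mul_iff_right hl0 hlt).1 h4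
  have B2 : ENNReal.ofReal l * volume ({x | l / 2 < ‖convOp K b x‖} ∩ Uᶜ) ≤ 4 * B * I := by
    have hm : MeasurableSet Uᶜ := (MeasurableSet.iUnion fun i => measurableSet_Ioo).compl
    have h1 : ENNReal.ofReal (l / 2) * volume ({x | l / 2 < ‖convOp K b x‖} ∩ Uᶜ)
        ≤ ∫⁻ x in Uᶜ, ‖convOp K b x‖ₑ := by
      rw [← Measure.restrict_apply' hm]
      refine le_trans ?_ (mul_meas_ge_le_lintegral₀
        (hK.continuous_convOp hb).enorm.measurable.aemeasurable (ENNReal.ofReal (l / 2)))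
      gcongr
      intro hx
      rw [← ofReal_norm]
      exact ENNReal.ofReal_le_ofReal hx.le
    have h2 := hK.lintegral_convOp_bad_le hb hr hd hb0 hbm
    calc _ = 2 * (ENNReal.ofReal (l / 2) * volume ({x | l / 2 < ‖convOp K b x‖} ∩ Uᶜ)) := by
          rw [hhalf]
          ring
      _ ≤ 2 * (B * (2 * I)) := by
          refine mul_le_mul_right ?_ _
          exact h1.trans (h2.trans (mul_le_mul_right hb1 _))
      _ = 4 * B * I := by ring
  -- On the doubled intervals nothing is known about the operator; only their total length is used.
  have B3 : ENNReal.ofReal l * volume U ≤ 2 * I := by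
    calc ENNReal.ofReal l * volume U
        ≤ ENNReal.ofReal l * ∑' i, volume (Ioo (c i - 2 * r i) (c i + 2 * r i)) := by
          gcongr
          exact measure_iUnion_le _
      _ = ∑' i, 2 * ENNReal.ofReal (l * (2 * r i)) := by
          rw [← ENNReal.tsum_mul_left]
          refine tsum_congr fun i => ?_
          have := (hr i).le
          rw [Real.volume_Ioo, ← ENNReal.ofReal_mul hl.le, ← ENNReal.ofReal_ofNat,
            ← ENNReal.ofReal_mul (by norm_num)]
          congr 1
          ring
      _ ≤ 2 * I := by
          rw [ENNReal.tsum_mul_left]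
          gcongr
  calc ENNReal.ofReal l * volume {x | l < ‖convOp K f x‖}
      ≤ ENNReal.ofReal l * (volume {x | l / 2 < ‖convOp K g x‖} +
          (volume ({x | l / 2 < ‖convOp K b x‖} ∩ Uᶜ) + volume U)) := by
        gcongr
        refine (measure_mono hsub).trans ((measure_union_le _ _).trans ?_)
        gcongr
        exact measure_union_le _ _
    _ ≤ 8 * A * I + (4 * B * I + 2 * I) := by
        rw [mul_add, mul_add]
        gcongr
    _ = _ := by ring

end IsCZKernel

lemma convOp_congr_ae {K : ℝ → E →L[ℂ] F} {f g : ℝ → E} (h : f =ᵐ[volume] g) (x : ℝ) :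
    convOp K f x = convOp K g x := by
  refine integral_congr_ae ?_
  filter_upwards [h] with y hy
  simp only [hy]

lemma IntegrableBounded.indicator {G : Type*} [NormedAddCommGroup G] {f : ℝ → G} (hf : IntegrableBounded f) {s : Set ℝ}
    (hs : MeasurableSet s) : IntegrableBounded (s.indicator f) := by
  obtain ⟨M, hM⟩ := hf.bounded
  refine ⟨hf.integrable.indicator hs, M, ?_⟩
  filter_upwards [hM] with x hx
  exact (norm_indicator_le_norm_self f x).trans hx

lemma IntegrableBounded.congr {G : Type*} [NormedAddCommGroup G] {f g : ℝ → G} (hf : IntegrableBounded f) (h : f =ᵐ[volume] g) :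
    IntegrableBounded g := by
  obtain ⟨M, hM⟩ := hf.bounded
  refine ⟨hf.integrable.congr h, M, ?_⟩
  filter_upwards [hM, h] with x hx hxe
  rwa [← hxe]

/-- The constant of the interpolated bound for exponents `1 < q < 2`. -/
def interpolationConst (A B : ℝ≥0) (q : ℝ) : ℝ≥0 :=
  q.toNNReal * (2 * (8 * A + 4 * B + 2) * (1 / (q - 1)).toNNReal + 4 * A * (1 / (2 - q)).toNNReal)

/-! ### Marcinkiewicz interpolation between weak `L¹` and `L²`. -/

namespace IsCZKernel

variable [CompleteSpace E] [CompleteSpace F] {K : ℝ → E →L[ℂ] F} {A B : ℝ≥0} {f : ℝ → E}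

/-- The function is cut at the same height `t`: its large values go through the weak type bound, its
small values through `L²` and Chebyshev, each at height `t / 2`. -/
lemma measure_lt_convOp_le (hK : IsCZKernel K B) (hA : ConvLpBound K 2 A)
    (hf : IntegrableBounded f) (hfm : StronglyMeasurable f) {t : ℝ} (ht : 0 < t) :
    volume {x | t < ‖convOp K f x‖} ≤
      2 * (8 * A + 4 * B + 2) * (ENNReal.ofReal (t ^ (-1 : ℝ)) *
        ∫⁻ x, (if t < ‖f x‖ then ENNReal.ofReal ‖f x‖ else 0)) +
      4 * A * (ENNReal.ofReal (t ^ (-2 : ℝ)) *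
        ∫⁻ x, (if ‖f x‖ ≤ t then ENNReal.ofReal (‖f x‖ ^ (2 : ℝ)) else 0)) := by
  set s : Set ℝ := {x | t < ‖f x‖} with hs
  have hsm : MeasurableSet s := measurableSet_lt measurable_const hfm.norm.measurable
  have h1 := hf.indicator hsm
  have h2 := hf.indicator hsm.compl
  have hsub : {x | t < ‖convOp K f x‖} ⊆ {x | t / 2 < ‖convOp K (s.indicator f) x‖} ∪
      {x | t / 2 < ‖convOp K (sᶜ.indicator f) x‖} := by
    intro x hx
    by_contra hcon
    simp only [mem_union, mem_ofPred_eq, not_or, not_lt] at hcon hx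
    have h5 : convOp K f x = convOp K (s.indicator f) x + convOp K (sᶜ.indicator f) x := by
      rw [← hK.convOp_add h1.integrable h2.integrable]
      congr 1
      funext y
      exact (indicator_self_add_compl_apply s f y).symm
    have := norm_add_le (convOp K (s.indicator f) x) (convOp K (sᶜ.indicator f) x)
    rw [← h5] at this
    linarith [hcon.1, hcon.2]
  have e1 : ∫⁻ x, ‖s.indicator f x‖ₑ = ∫⁻ x, (if t < ‖f x‖ then ENNReal.ofReal ‖f x‖ else 0) := by
    refine lintegral_congr fun x => ?_
    by_cases hx : t < ‖f x‖
    · rw [indicator_of_mem (show x ∈ s from hx), if_pos hx, ofReal_norm]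
    · rw [indicator_of_notMem (show x ∉ s from hx), if_neg hx, enorm_zero]
  have e2 : ∫⁻ x, ‖sᶜ.indicator f x‖ₑ ^ (2 : ℝ) =
      ∫⁻ x, (if ‖f x‖ ≤ t then ENNReal.ofReal (‖f x‖ ^ (2 : ℝ)) else 0) := by
    refine lintegral_congr fun x => ?_
    by_cases hx : t < ‖f x‖
    · rw [indicator_of_notMem (show x ∉ sᶜ from fun h => h hx), if_neg (not_le.2 hx), enorm_zero,
        ENNReal.zero_rpow_of_pos (by norm_num)]
    · rw [indicator_of_mem (show x ∈ sᶜ from hx), if_pos (not_lt.1 hx),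
        enorm_rpow_eq_ofReal _ (by norm_num)]
  have w1 := hK.weak_type hA h1.integrable (l := t / 2) (by positivity)
  rw [e1] at w1
  have w2 := (rpow_mul_measure_lt_le (hK.continuous_convOp h2.integrable).aestronglyMeasurable
      (q := 2) (t := t / 2) (by norm_num)).trans (hA _ h2)
  rw [e2] at w2
  have ht0 : ENNReal.ofReal (t / 2) ≠ 0 := by simpa using ht
  have htt : ENNReal.ofReal (t / 2) ≠ ⊤ := ENNReal.ofReal_ne_top
  have hinv : (ENNReal.ofReal (t / 2))⁻¹ = 2 * ENNReal.ofReal (t ^ (-1 : ℝ)) := by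
    rw [← ENNReal.ofReal_inv_of_pos (by positivity), ← ENNReal.ofReal_ofNat,
      ← ENNReal.ofReal_mul (by norm_num), Real.rpow_neg_one]
    congr 1
    field_simp
  have hsq : ENNReal.ofReal (t ^ (-2 : ℝ)) = ENNReal.ofReal (t ^ (-1 : ℝ)) ^ 2 := by
    rw [← ENNReal.ofReal_pow (by positivity), ← Real.rpow_natCast, ← Real.rpow_mul ht.le]
    norm_num
  refine (measure_mono hsub).trans ((measure_union_le _ _).trans (add_le_add ?_ ?_))
  · calc _ = (ENNReal.ofReal (t / 2))⁻¹ * (ENNReal.ofReal (t / 2) *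
            volume {x | t / 2 < ‖convOp K (s.indicator f) x‖}) := by
          rw [← mul_assoc, ENNReal.inv_mul_cancel ht0 htt, one_mul]
      _ ≤ _ := by
          refine (mul_le_mul_right w1 _).trans (le_of_eq ?_)
          rw [hinv]
          ring
  · calc _ = ((ENNReal.ofReal (t / 2))⁻¹) ^ 2 * (ENNReal.ofReal (t / 2) ^ (2 : ℝ) *
            volume {x | t / 2 < ‖convOp K (sᶜ.indicator f) x‖}) := by
          rw [← mul_assoc, ENNReal.rpow_two, ← mul_pow, ENNReal.inv_mul_cancel ht0 htt, one_pow,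
            one_mul]
      _ ≤ _ := by
          refine (mul_le_mul_right w2 _).trans (le_of_eq ?_)
          rw [hinv, hsq]
          ring

/-- The strong type bound below `L²`. -/
theorem convLpBound_of_lt_two (hK : IsCZKernel K B) (hA : ConvLpBound K 2 A) {q : ℝ} (hq1 : 1 < q)
    (hq2 : q < 2) : ConvLpBound K q (interpolationConst A B q) := by
  intro f₀ hf₀
  obtain ⟨f, hfm, hff⟩ := hf₀.integrable.1
  have hf := hf₀.congr hff
  have e1 : ∫⁻ x, ‖f₀ x‖ₑ ^ q = ∫⁻ x, ENNReal.ofReal (‖f x‖ ^ q) := by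
    refine lintegral_congr_ae ?_
    filter_upwards [hff] with x hx
    rw [hx, enorm_rpow_eq_ofReal _ (by linarith)]
  have e2 : ∫⁻ x, ‖convOp K f₀ x‖ₑ ^ q = ∫⁻ x, ENNReal.ofReal (‖convOp K f x‖ ^ q) := by
    refine lintegral_congr fun x => ?_
    rw [convOp_congr_ae hff, enorm_rpow_eq_ofReal _ (by linarith)]
  set W := ∫⁻ x, ENNReal.ofReal (‖f x‖ ^ q) with hW
  set P : ℝ → ℝ≥0∞ := fun t => ∫⁻ x, (if t < ‖f x‖ then ENNReal.ofReal ‖f x‖ else 0) with hP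
  set Q : ℝ → ℝ≥0∞ := fun t => ∫⁻ x, (if ‖f x‖ ≤ t then ENNReal.ofReal (‖f x‖ ^ (2 : ℝ)) else 0)
    with hQ
  have hm1 : Measurable fun t => ENNReal.ofReal (t ^ (q - 2)) * P t := by
    refine Measurable.mul (by fun_prop) ?_
    refine Measurable.lintegral_prod_right' (f := fun z : ℝ × ℝ =>
      if z.1 < ‖f z.2‖ then ENNReal.ofReal ‖f z.2‖ else 0) (Measurable.ite
        (measurableSet_lt measurable_fst (hfm.norm.measurable.comp measurable_snd)) ?_
        measurable_const)
    exact (hfm.norm.measurable.comp measurable_snd).ennreal_ofReal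
  have hc : (interpolationConst A B q : ℝ≥0∞) = ENNReal.ofReal q *
      (2 * (8 * A + 4 * B + 2) * ENNReal.ofReal (1 / (q - 1)) +
        4 * A * ENNReal.ofReal (1 / (2 - q))) := by
    simp only [interpolationConst, ENNReal.ofReal]
    push_cast
    rfl
  rw [e1, e2, lintegral_rpow_eq_lintegral_meas_lt_mul volume
    (Filter.Eventually.of_forall fun x => norm_nonneg _)
    (hK.continuous_convOp hf.integrable).norm.measurable.aemeasurable (by linarith), hc, mul_assoc]
  gcongr
  calc ∫⁻ t in Ioi (0 : ℝ), volume {x | t < ‖convOp K f x‖} * ENNReal.ofReal (t ^ (q - 1))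
      ≤ ∫⁻ t in Ioi (0 : ℝ), 2 * (8 * A + 4 * B + 2) * (ENNReal.ofReal (t ^ (q - 2)) * P t) +
          4 * A * (ENNReal.ofReal (t ^ (q - 3)) * Q t) := by
        refine setLIntegral_mono' measurableSet_Ioi fun t ht => ?_
        rw [mem_Ioi] at ht
        refine (mul_le_mul_left (hK.measure_lt_convOp_le hA hf hfm ht) _).trans (le_of_eq ?_)
        rw [show q - 2 = -1 + (q - 1) by ring, show q - 3 = -2 + (q - 1) by ring,
          Real.rpow_add ht, Real.rpow_add ht (-2), ENNReal.ofReal_mul (by positivity),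
          ENNReal.ofReal_mul (by positivity)]
        ring
    _ = 2 * (8 * A + 4 * B + 2) * (∫⁻ t in Ioi (0 : ℝ), ENNReal.ofReal (t ^ (q - 2)) * P t) +
          4 * A * (∫⁻ t in Ioi (0 : ℝ), ENNReal.ofReal (t ^ (q - 3)) * Q t) := by
        rw [lintegral_add_left (hm1.const_mul _), lintegral_const_mul' _ _ (by finiteness),
          lintegral_const_mul' _ _ (by finiteness)]
    _ ≤ 2 * (8 * A + 4 * B + 2) * (ENNReal.ofReal (1 / (q - 1)) * W) +
          4 * A * (ENNReal.ofReal (1 / (2 - q)) * W) := by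
        gcongr
        · exact lintegral_rpow_mul_lintegral_lt_le hq1 hfm.norm.measurable.aemeasurable
            fun x => norm_nonneg _
        · exact lintegral_rpow_mul_lintegral_ge_le hq2 hfm.norm.measurable.aemeasurable
            fun x => norm_nonneg _
    _ = _ := by ring

end IsCZKernel

end ConvolutionOperators

/-! ### Adjoint kernels and exponents above `2`. -/

section Duality

variable {E F : Type*} [NormedAddCommGroup E] [InnerProductSpace ℂ E] [CompleteSpace E]
  [NormedAddCommGroup F] [InnerProductSpace ℂ F] [CompleteSpace F]

/-- The kernel of the adjoint convolution operator. -/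
def adjKernel (K : ℝ → E →L[ℂ] F) (x : ℝ) : F →L[ℂ] E := ContinuousLinearMap.adjoint (K (-x))

lemma adjKernel_adjKernel (K : ℝ → E →L[ℂ] F) : adjKernel (adjKernel K) = K := by
  funext x
  simp [adjKernel]

lemma IsCZKernel.adjKernel {K : ℝ → E →L[ℂ] F} {B : ℝ≥0} (hK : IsCZKernel K B) :
    IsCZKernel (adjKernel K) B where
  continuous := ContinuousLinearMap.adjoint.continuous.comp (hK.continuous.comp continuous_neg)
  decay := by
    obtain ⟨c, hc⟩ := hK.decay
    refine ⟨c, fun x => ?_⟩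
    have := hc (-x)
    rwa [neg_sq, ← LinearIsometryEquiv.norm_map ContinuousLinearMap.adjoint] at this
  smooth x y h hx := by
    have := hK.smooth (-x) (-y) (by rwa [abs_neg, abs_neg]) (neg_ne_zero.2 hx)
    rw [← LinearIsometryEquiv.norm_map ContinuousLinearMap.adjoint, map_sub, neg_sq, abs_neg] at this
    simp only [CurvedBHT.adjKernel]
    rwa [neg_sub, show y - x = -x - -y by ring]

/-- The convolution operators with kernels `K` and `adjKernel K` are adjoint to each other. -/
lemma integral_inner_convOp {K : ℝ → E →L[ℂ] F} {B : ℝ≥0} (hK : IsCZKernel K B) {f : ℝ → E}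
    {g : ℝ → F} (hf : Integrable f) (hg : Integrable g) :
    ∫ x, inner ℂ (convOp K f x) (g x) = ∫ y, inner ℂ (f y) (convOp (adjKernel K) g y) := by
  obtain ⟨M, hM0, hM⟩ := hK.exists_bound
  have hint : Integrable (fun z : ℝ × ℝ => inner ℂ (K (z.1 - z.2) (f z.2)) (g z.1))
      (volume.prod volume) := by
    have h1 : Integrable (fun z : ℝ × ℝ => M * (‖g z.1‖ * ‖f z.2‖)) (volume.prod volume) :=
      (hg.norm.mul_prod hf.norm).const_mul M
    refine h1.mono' ?_ (Filter.Eventually.of_forall fun z => ?_)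
    · refine AEStronglyMeasurable.inner ?_ hg.1.comp_fst
      exact isBoundedBilinearMap_apply.continuous.comp_aestronglyMeasurable₂
        (hK.continuous.comp (continuous_fst.sub continuous_snd)).aestronglyMeasurable hf.1.comp_snd
    · calc ‖inner ℂ (K (z.1 - z.2) (f z.2)) (g z.1)‖ ≤ ‖K (z.1 - z.2) (f z.2)‖ * ‖g z.1‖ :=
            norm_inner_le_norm _ _
        _ ≤ M * ‖f z.2‖ * ‖g z.1‖ := by
            gcongr
            exact (K _).le_of_opNorm_le (hM _) _
        _ = M * (‖g z.1‖ * ‖f z.2‖) := by ring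
  calc ∫ x, inner ℂ (convOp K f x) (g x)
      = ∫ x, ∫ y, inner ℂ (K (x - y) (f y)) (g x) := by
        refine integral_congr_ae (Filter.Eventually.of_forall fun x => ?_)
        simp only
        rw [← inner_conj_symm, convOp, ← integral_inner (hK.integrable_apply hf x), ← integral_conj]
        simp only [inner_conj_symm]
    _ = ∫ y, ∫ x, inner ℂ (K (x - y) (f y)) (g x) := integral_integral_swap hint
    _ = ∫ y, inner ℂ (f y) (convOp (adjKernel K) g y) := by
        refine integral_congr_ae (Filter.Eventually.of_forall fun y => ?_)
        simp only
        rw [convOp, ← integral_inner (hK.adjKernel.integrable_apply hg y)]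
        simp only [adjKernel, neg_sub, ContinuousLinearMap.adjoint_inner_right]

lemma IntegrableBounded.lintegral_rpow_ne_top {G : Type*} [NormedAddCommGroup G] {f : ℝ → G} (hf : IntegrableBounded f) {q : ℝ}
    (hq : 1 ≤ q) : ∫⁻ x, ‖f x‖ₑ ^ q ≠ ⊤ := by
  obtain ⟨M, hM⟩ := hf.bounded
  have h : ∫⁻ x, ‖f x‖ₑ ^ q ≤ ENNReal.ofReal M ^ (q - 1) * ∫⁻ x, ‖f x‖ₑ := by
    rw [← lintegral_const_mul' _ _ (ENNReal.rpow_ne_top_of_nonneg (by linarith)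
      ENNReal.ofReal_ne_top)]
    refine lintegral_mono_ae ?_
    filter_upwards [hM] with x hx
    calc ‖f x‖ₑ ^ q = ‖f x‖ₑ ^ (q - 1) * ‖f x‖ₑ ^ (1 : ℝ) := by
          rw [← ENNReal.rpow_add_of_nonneg _ _ (by linarith) (by linarith), sub_add_cancel]
      _ ≤ _ := by
          rw [ENNReal.rpow_one]
          refine mul_le_mul_left (ENNReal.rpow_le_rpow ?_ (by linarith)) _
          rw [← ofReal_norm]
          exact ENNReal.ofReal_le_ofReal hx
  exact ne_top_of_le_ne_top (ENNReal.mul_ne_top (ENNReal.rpow_ne_top_of_nonneg (by linarith)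
      ENNReal.ofReal_ne_top) hf.integrable.2.ne) h

/-- With `u = K * f`, the test function `v = ‖u‖ ^ (q - 2) u` is extremal in Hölder's inequality:
`‖v‖ ^ q' = ‖u‖ ^ q = ⟨u, v⟩`. Moving the operator onto `v` and applying the adjoint bound leaves an
inequality for `N` alone. -/
theorem ConvLpBound.of_adjKernel {K : ℝ → E →L[ℂ] F} {B C : ℝ≥0} (hK : IsCZKernel K B) {q q' : ℝ}
    (hq : 2 ≤ q) (hqq : q.HolderConjugate q') (hC : ConvLpBound (adjKernel K) q' C) :
    ConvLpBound K q (C ^ (q - 1)) := by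
  intro f hf
  have hu := hK.integrableBounded_convOp hf.integrable
  have huc := hK.continuous_convOp hf.integrable
  set u := convOp K f with hu_def
  set N := ∫⁻ x, ‖u x‖ₑ ^ q with hN
  have hNt : N ≠ ⊤ := hu.lintegral_rpow_ne_top (by linarith)
  rcases eq_or_ne N 0 with h0 | h0
  · rw [h0]
    exact zero_le
  set v : ℝ → F := fun x => ((‖u x‖ ^ (q - 2) : ℝ) : ℂ) • u x with hv
  have hvn : ∀ x, ‖v x‖ = ‖u x‖ ^ (q - 1) := fun x => by
    rw [hv]
    simp only
    rw [norm_smul, Complex.norm_real, Real.norm_of_nonneg (by positivity)]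
    nth_rewrite 2 [← Real.rpow_one ‖u x‖]
    rw [← Real.rpow_add_of_nonneg (norm_nonneg _) (by linarith) (by linarith)]
    ring_nf
  have hvm : AEStronglyMeasurable v volume := by
    refine Continuous.aestronglyMeasurable ?_
    refine (Complex.continuous_ofReal.comp (huc.norm.rpow_const fun x => ?_)).smul huc
    right
    linarith
  have hvi : Integrable v := by
    refine ⟨hvm, ?_⟩
    rcases hq.eq_or_lt with h | h
    · have : ∀ x, ‖v x‖ = ‖u x‖ := fun x => by rw [hvn, ← h]; norm_num
      exact (hu.integrable.congr' hvm (Filter.Eventually.of_forall fun x => (this x).symm)).2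
    · have h1 := hu.lintegral_rpow_ne_top (q := q - 1) (by linarith)
      have h2 : ∀ x, ‖v x‖ₑ = ‖u x‖ₑ ^ (q - 1) := fun x => by
        rw [enorm_rpow_eq_ofReal _ (by linarith), ← hvn, ofReal_norm]
      rw [HasFiniteIntegral, lintegral_congr h2]
      exact h1.lt_top
  have hvb : IntegrableBounded v := by
    obtain ⟨M, hM⟩ := hu.bounded
    refine ⟨hvi, M ^ (q - 1), ?_⟩
    filter_upwards [hM] with x hx
    rw [hvn]
    exact Real.rpow_le_rpow (norm_nonneg _) hx (by linarith)
  have hvq : ∫⁻ x, ‖v x‖ₑ ^ q' = N := by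
    refine lintegral_congr fun x => ?_
    rw [enorm_rpow_eq_ofReal _ hqq.symm.nonneg, enorm_rpow_eq_ofReal _ hqq.nonneg, hvn,
      ← Real.rpow_mul (norm_nonneg _), hqq.sub_one_mul_conj]
  have hpair : N = ‖∫ x, inner ℂ (u x) (v x)‖ₑ := by
    have h1 : ∀ x, inner ℂ (u x) (v x) = ((‖u x‖ ^ q : ℝ) : ℂ) := fun x => by
      rw [hv]
      simp only
      rw [inner_smul_right, inner_self_eq_norm_sq_to_K]
      simp only [Complex.coe_algebraMap]
      rw [← Complex.ofReal_pow, ← Complex.ofReal_mul, ← Real.rpow_natCast ‖u x‖ 2,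
        ← Real.rpow_add_of_nonneg (norm_nonneg _) (by linarith) (by norm_num)]
      norm_num
    have h2 : ∫ x, inner ℂ (u x) (v x) = ((∫ x, ‖u x‖ ^ q : ℝ) : ℂ) := by
      exact (integral_congr_ae (Filter.Eventually.of_forall h1)).trans integral_ofReal
    have h3 : Integrable fun x => ‖u x‖ ^ q := by
      refine ⟨(huc.norm.rpow_const fun x => Or.inr hqq.nonneg).aestronglyMeasurable, ?_⟩
      refine lt_of_eq_of_lt (lintegral_congr fun x => ?_) hNt.lt_top
      rw [Real.enorm_of_nonneg (by positivity), enorm_rpow_eq_ofReal _ hqq.nonneg]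
    rw [h2, ← ofReal_norm, Complex.norm_real, Real.norm_of_nonneg (by positivity),
      ofReal_integral_eq_lintegral_ofReal h3 (Filter.Eventually.of_forall fun x => by positivity)]
    exact lintegral_congr fun x => enorm_rpow_eq_ofReal _ hqq.nonneg
  set I := ∫⁻ x, ‖f x‖ₑ ^ q with hI
  have hmain : N ≤ I ^ (1 / q) * (C * N) ^ (1 / q') := by
    calc N = ‖∫ x, inner ℂ (f x) (convOp (adjKernel K) v x)‖ₑ := by
          rw [hpair, integral_inner_convOp hK hf.integrable hvi]
      _ ≤ ∫⁻ x, ‖f x‖ₑ * ‖convOp (adjKernel K) v x‖ₑ := by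
          refine (enorm_integral_le_lintegral_enorm _).trans (lintegral_mono fun x => ?_)
          rw [← ofReal_norm, ← ofReal_norm, ← ofReal_norm, ← ENNReal.ofReal_mul (norm_nonneg _)]
          exact ENNReal.ofReal_le_ofReal (norm_inner_le_norm _ _)
      _ ≤ I ^ (1 / q) * (∫⁻ x, ‖convOp (adjKernel K) v x‖ₑ ^ q') ^ (1 / q') :=
          ENNReal.lintegral_mul_le_Lp_mul_Lq volume hqq hf.integrable.1.enorm
            (hK.adjKernel.continuous_convOp hvi).enorm.measurable.aemeasurable
      _ ≤ I ^ (1 / q) * (C * N) ^ (1 / q') := by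
          refine mul_le_mul_right (ENNReal.rpow_le_rpow ?_ (by simpa using hqq.symm.nonneg)) _
          rw [← hvq]
          exact hC v hvb
  have hqpos := hqq.pos
  have hdiv : 1 / q' * q = q - 1 := by
    have h1 : q' = q / (q - 1) := hqq.conjugate_eq
    have h2 : q - 1 ≠ 0 := by linarith
    rw [h1]
    field_simp
  -- The power `N ^ (q - 1)` can be cancelled only because `0 < N < ∞`; finiteness comes from `u`
  -- being integrable and bounded.
  have hpow : N * N ^ (q - 1) ≤ ((C ^ (q - 1) : ℝ≥0) * I) * N ^ (q - 1) := by
    calc N * N ^ (q - 1) = N ^ q := by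
          nth_rewrite 1 [← ENNReal.rpow_one N]
          rw [← ENNReal.rpow_add_of_nonneg _ _ (by linarith) (by linarith), add_sub_cancel]
      _ ≤ (I ^ (1 / q) * (C * N) ^ (1 / q')) ^ q := ENNReal.rpow_le_rpow hmain hqpos.le
      _ = _ := by
          rw [ENNReal.mul_rpow_of_nonneg _ _ hqpos.le, ← ENNReal.rpow_mul, ← ENNReal.rpow_mul,
            one_div_mul_cancel hqpos.ne', ENNReal.rpow_one, hdiv,
            ENNReal.mul_rpow_of_nonneg _ _ (by linarith),
            ENNReal.coe_rpow_of_nonneg _ (by linarith)]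
          ring
  have hN1 : N ^ (q - 1) ≠ 0 := by
    rw [Ne, ENNReal.rpow_eq_zero_iff]
    rintro (h | h)
    · exact h0 h.1
    · exact hNt h.1
  exact (ENNReal.mul_le_mul_iff_left hN1
    (ENNReal.rpow_ne_top_of_nonneg (by linarith) hNt)).1 hpow

/-- The constant in the `L^q` bound for Calderón–Zygmund convolution operators. -/
def czConst (A B : ℝ≥0) (q : ℝ) : ℝ≥0 :=
  if q < 2 then interpolationConst A B q
  else if q = 2 then A else interpolationConst A B (q / (q - 1)) ^ (q - 1)

/-- `L^q` boundedness of Calderón–Zygmund convolution operators. -/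
theorem IsCZKernel.convLpBound {K : ℝ → E →L[ℂ] F} {A B : ℝ≥0} (hK : IsCZKernel K B)
    (hA : ConvLpBound K 2 A) {q : ℝ} (hq : 1 < q) : ConvLpBound K q (czConst A B q) := by
  rw [czConst]
  split_ifs with h1 h2
  · exact hK.convLpBound_of_lt_two hA hq h1
  · rwa [h2]
  · have h3 : 2 < q := lt_of_le_of_ne (not_lt.1 h1) (Ne.symm h2)
    -- At the self-dual exponent the constant passes to the adjoint unchanged, since `A ^ (2 - 1) =
    -- A`.
    have hA' : ConvLpBound (CurvedBHT.adjKernel K) 2 A := by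
      have := ConvLpBound.of_adjKernel (q := 2) (q' := 2) (C := A) hK.adjKernel le_rfl
        ⟨by norm_num, by norm_num, by norm_num⟩ (by rwa [adjKernel_adjKernel])
      norm_num at this
      exact this
    have hqq : q.HolderConjugate (q / (q - 1)) := Real.HolderConjugate.conjExponent hq
    refine ConvLpBound.of_adjKernel hK h3.le hqq
      (hK.adjKernel.convLpBound_of_lt_two hA' hqq.symm.lt ?_)
    rw [div_lt_iff₀ (by linarith)]
    linarith

end Duality

/-! ### Sums over scales of bounded multiplicity. -/

section LacunarySums

/-- The moduli `|b j|` meet each interval `[α, 2α]` at most `N` times. -/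
def BoundedMultiplicity (b : ℕ → ℝ) (N : ℕ) : Prop :=
  ∀ α : ℝ, 0 < α → {j : ℕ | |b j| ∈ Icc α (2 * α)}.encard ≤ N

lemma BoundedMultiplicity.div_const {b : ℕ → ℝ} {N : ℕ} (hb : BoundedMultiplicity b N) {c : ℝ}
    (hc : 0 < c) : BoundedMultiplicity (fun j => b j / c) N := by
  intro α hα
  refine le_trans (Set.encard_le_encard fun j hj => ?_) (hb (α * c) (by positivity))
  simp only [mem_ofPred_eq, abs_div, abs_of_pos hc, mem_Icc, le_div_iff₀ hc, div_le_iff₀ hc] at hj ⊢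
  exact ⟨hj.1, by linarith [hj.2]⟩

lemma sum_half_pow_natAbs_le (T : Finset ℤ) : ∑ k ∈ T, (1 / 2 : ℝ) ^ k.natAbs ≤ 4 := by
  have h1 : HasSum (fun n : ℕ => (1 / 2 : ℝ) ^ (n : ℤ).natAbs) 2 := by
    simpa using hasSum_geometric_two
  have h2 : HasSum (fun n : ℕ => (1 / 2 : ℝ) ^ (-((n : ℤ) + 1)).natAbs) 1 := by
    have h3 := hasSum_geometric_two.mul_left (1 / 2 : ℝ)
    rw [show (1 / 2 : ℝ) * 2 = 1 by norm_num] at h3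
    have h4 : (fun n : ℕ => (1 / 2 : ℝ) ^ (-((n : ℤ) + 1)).natAbs) =
        fun n : ℕ => (1 / 2 : ℝ) * (1 / 2) ^ n := by
      funext n
      rw [Int.natAbs_neg, show (n : ℤ) + 1 = ((n + 1 : ℕ) : ℤ) by push_cast; rfl,
        Int.natAbs_natCast, pow_succ, mul_comm]
    rwa [h4]
  have h5 : HasSum (fun k : ℤ => (1 / 2 : ℝ) ^ k.natAbs) (2 + 1) :=
    HasSum.of_nat_of_neg_add_one (f := fun k : ℤ => (1 / 2 : ℝ) ^ k.natAbs) h1 h2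
  have h6 := sum_le_hasSum T (fun k _ => pow_nonneg (by norm_num) _) h5
  linarith

lemma min_inv_le_two_mul_pow {t : ℝ} (ht : 0 < t) :
    min t t⁻¹ ≤ 2 * (1 / 2 : ℝ) ^ (Int.log 2 t).natAbs := by
  have h1 : (2 : ℝ) ^ Int.log 2 t ≤ t := by simpa using Int.zpow_log_le_self (b := 2) one_lt_two ht
  have h2 : t < (2 : ℝ) ^ (Int.log 2 t + 1) := by
    simpa using Int.lt_zpow_succ_log_self (b := 2) one_lt_two t
  generalize Int.log 2 t = n at h1 h2
  rcases le_or_gt 0 n with hn | hn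
  · lift n to ℕ using hn
    rw [Int.natAbs_natCast, one_div, inv_pow]
    rw [zpow_natCast] at h1
    have h3 : t⁻¹ ≤ ((2 : ℝ) ^ n)⁻¹ := inv_anti₀ (by positivity) h1
    have h4 : (0 : ℝ) < ((2 : ℝ) ^ n)⁻¹ := by positivity
    linarith [min_le_right t t⁻¹]
  · have h3 : (2 : ℝ) ^ (n + 1) = 2 * (1 / 2 : ℝ) ^ n.natAbs := by
      obtain ⟨k, hk⟩ := Int.eq_ofNat_of_zero_le (show 0 ≤ -n by lia)
      obtain rfl : n = -(k : ℤ) := by rw [← hk, neg_neg]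
      rw [zpow_add₀ two_ne_zero, Int.natAbs_neg, Int.natAbs_natCast, zpow_neg, zpow_natCast, one_div,
        inv_pow, zpow_one, mul_comm]
    rw [← h3]
    exact (min_le_left _ _).trans h2.le

/-- Sorted by the integer part `k` of the binary logarithm of `s * |b j|`, each class has at most
`N` members, each contributing at most `2 * 2^{-|k|}`. The bound is uniform in `s` and `J`, which is
all that lacunarity is used for. -/
lemma BoundedMultiplicity.sum_min_le {b : ℕ → ℝ} {N : ℕ} (hb : BoundedMultiplicity b N)
    {J : Finset ℕ} (hJ : ∀ j ∈ J, b j ≠ 0) {s : ℝ} (hs : 0 < s) :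
    ∑ j ∈ J, min (s * |b j|) (s * |b j|)⁻¹ ≤ 8 * N := by
  classical
  set n : ℕ → ℤ := fun j => Int.log 2 (s * |b j|) with hn
  have hpos : ∀ j ∈ J, 0 < s * |b j| := fun j hj => mul_pos hs (abs_pos.2 (hJ j hj))
  calc ∑ j ∈ J, min (s * |b j|) (s * |b j|)⁻¹
      ≤ ∑ j ∈ J, 2 * (1 / 2 : ℝ) ^ (n j).natAbs :=
        Finset.sum_le_sum fun j hj => min_inv_le_two_mul_pow (hpos j hj)
    _ = ∑ k ∈ J.image n, ∑ j ∈ J with n j = k, 2 * (1 / 2 : ℝ) ^ (n j).natAbs :=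
        (Finset.sum_fiberwise_of_maps_to (fun j hj => Finset.mem_image_of_mem n hj) _).symm
    _ ≤ ∑ k ∈ J.image n, 2 * N * (1 / 2 : ℝ) ^ k.natAbs := by
        refine Finset.sum_le_sum fun k _ => ?_
        have h1 : ∑ j ∈ J with n j = k, 2 * (1 / 2 : ℝ) ^ (n j).natAbs =
            ∑ j ∈ J with n j = k, 2 * (1 / 2 : ℝ) ^ k.natAbs :=
          Finset.sum_congr rfl fun j hj => by rw [(Finset.mem_filter.1 hj).2]
        have h2 : ({j ∈ J | n j = k}.card : ℝ) ≤ N := by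
          have h3 : ((({j ∈ J | n j = k} : Finset ℕ) : Set ℕ)).encard ≤ N := by
            refine le_trans (Set.encard_le_encard fun j hj => ?_)
              (hb ((2 : ℝ) ^ k / s) (by positivity))
            simp only [Finset.coe_filter, mem_ofPred_eq] at hj
            have hp := hpos j hj.1
            have e1 := Int.zpow_log_le_self (b := 2) one_lt_two hp
            have e2 := Int.lt_zpow_succ_log_self (b := 2) one_lt_two (s * |b j|)
            have e3 : Int.log 2 (s * |b j|) = k := hj.2
            rw [e3] at e1 e2
            rw [zpow_add_one₀ (by norm_num)] at e2
            push_cast at e1 e2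
            simp only [mem_ofPred_eq, mem_Icc]
            rw [div_le_iff₀ hs, ← mul_div_assoc, le_div_iff₀ hs]
            constructor <;> nlinarith
          rw [Set.encard_coe_eq_coe_finsetCard] at h3
          exact_mod_cast h3
        rw [h1, Finset.sum_const, nsmul_eq_mul]
        calc _ ≤ (N : ℝ) * (2 * (1 / 2 : ℝ) ^ k.natAbs) := by gcongr
          _ = _ := by ring
    _ ≤ 8 * N := by
        rw [← Finset.mul_sum]
        have := sum_half_pow_natAbs_le (J.image n)
        have h0 : (0 : ℝ) ≤ N := by positivity
        nlinarith

end LacunarySums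

/-! ### Inverse Fourier transforms of bumps and their dilates. -/

section InverseFourier

/-- The factor `2 * Real.pi` converts between `invFourier`, with phase `e^{ixξ}`, and `𝓕`, whose
phase is `e^{-2πixξ}`. -/
lemma exists_schwartz_invFourier {χ : ℝ → ℂ} (hχ : ContDiff ℝ ∞ χ) (hc : HasCompactSupport χ) :
    ∃ S : 𝓢(ℝ, ℂ), (∀ x, S x = invFourier χ x) ∧ ∀ ξ, 𝓕 S ξ = χ (2 * Real.pi * ξ) := by
  have hpi : (2 * Real.pi) ≠ 0 := by positivity
  have h1 : HasCompactSupport fun ξ => χ (2 * Real.pi * ξ) :=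
    hc.comp_homeomorph (Homeomorph.mulLeft₀ (2 * Real.pi) hpi)
  have h2 : ContDiff ℝ ∞ fun ξ => χ (2 * Real.pi * ξ) := hχ.comp (by fun_prop)
  refine ⟨𝓕⁻ (h1.toSchwartzMap h2), fun x => ?_, fun ξ => ?_⟩
  · rw [SchwartzMap.fourierInv_coe, Real.fourierInv_eq', invFourier]
    have h3 := Measure.integral_comp_mul_left
      (fun w : ℝ => χ w * Complex.exp (Complex.I * x * w)) (2 * Real.pi)
    rw [abs_of_pos (by positivity), Complex.real_smul] at h3
    push_cast at h3 ⊢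
    rw [← h3]
    refine integral_congr_ae (Filter.Eventually.of_forall fun v => ?_)
    simp only [smul_eq_mul, HasCompactSupport.toSchwartzMap_toFun, RCLike.inner_apply,
      conj_trivial]
    push_cast
    rw [mul_comm]
    congr 2
    ring
  · simp

lemma invFourier_comp_mul (χ : ℝ → ℂ) {b : ℝ} (hb : b ≠ 0) (x : ℝ) :
    invFourier (fun ξ => χ (b * ξ)) x = (|b|⁻¹ : ℝ) * invFourier χ (x / b) := by
  have h3 := Measure.integral_comp_mul_left
      (fun w : ℝ => χ w * Complex.exp (Complex.I * ((x / b : ℝ) : ℂ) * w)) b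
  rw [Complex.real_smul, abs_inv] at h3
  rw [invFourier, invFourier, mul_left_comm, ← h3]
  congr 2
  funext ξ
  congr 2
  have : (b : ℂ) ≠ 0 := by exact_mod_cast hb
  push_cast
  field_simp

lemma schwartzMap_exists_deriv_bound (S : 𝓢(ℝ, ℂ)) :
    ∃ D : ℝ, 0 ≤ D ∧ ∀ z, ‖deriv S z‖ ≤ D ∧ |z| ^ 3 * ‖deriv S z‖ ≤ D := by
  obtain ⟨C0, hC0, h0⟩ := (SchwartzMap.derivCLM ℂ ℂ S).decay 0 0
  obtain ⟨C3, hC3, h3⟩ := (SchwartzMap.derivCLM ℂ ℂ S).decay 3 0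
  refine ⟨max C0 C3, by positivity, fun z => ⟨?_, ?_⟩⟩
  · have := h0 z
    rw [norm_iteratedFDeriv_zero, SchwartzMap.derivCLM_apply, pow_zero, one_mul] at this
    exact this.trans (le_max_left _ _)
  · have := h3 z
    rw [norm_iteratedFDeriv_zero, SchwartzMap.derivCLM_apply, Real.norm_eq_abs] at this
    exact this.trans (le_max_right _ _)

lemma schwartzMap_exists_bound_inv_one_add_sq (S : 𝓢(ℝ, ℂ)) :
    ∃ D : ℝ, 0 ≤ D ∧ ∀ z, ‖S z‖ ≤ D * (1 + z ^ 2)⁻¹ := by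
  obtain ⟨C0, hC0, h0⟩ := S.decay 0 0
  obtain ⟨C2, hC2, h2⟩ := S.decay 2 0
  refine ⟨C0 + C2, by positivity, fun z => ?_⟩
  have e0 := h0 z
  have e2 := h2 z
  rw [norm_iteratedFDeriv_zero] at e0 e2
  rw [Real.norm_eq_abs, sq_abs] at e2
  rw [← div_eq_mul_inv, le_div_iff₀ (by positivity)]
  linarith

/-- The mean value inequality on the ball of radius `|u| / 2` about `u = x / b`. Boundedness of the
derivative gives decay for large `|b| / |x|`, and its cubic decay gives decay for small `|b| / |x|`;
the factor `min` then sums over lacunary scales. -/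
lemma norm_rescaled_sub_le {S : ℝ → ℂ} (hS : Differentiable ℝ S) {D : ℝ}
    (hD : ∀ z, ‖deriv S z‖ ≤ D ∧ |z| ^ 3 * ‖deriv S z‖ ≤ D) {b x y : ℝ} (hb : b ≠ 0) (hx : x ≠ 0)
    (hxy : 2 * |y| ≤ |x|) :
    |b|⁻¹ * ‖S ((x - y) / b) - S (x / b)‖ ≤
      8 * D * (|y| / x ^ 2) * min (|x|⁻¹ * |b|) (|x|⁻¹ * |b|)⁻¹ := by
  have hD0 : 0 ≤ D := (norm_nonneg _).trans (hD 0).1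
  set u := x / b with hu
  have hbp : 0 < |b| := abs_pos.2 hb
  have hxp : 0 < |x| := abs_pos.2 hx
  have hup : 0 < |u| := abs_pos.2 (div_ne_zero hx hb)
  have hut : (|x|⁻¹ * |b|) = |u|⁻¹ := by
    rw [hu, abs_div]
    field_simp
  set t := |u| with ht
  -- On this ball `|z| ≥ t / 2`, and `8` is the cube of the lost factor `2`.
  have hball : ∀ z ∈ Metric.closedBall u (t / 2), ‖deriv S z‖ ≤ 8 * D * min 1 (t ^ 3)⁻¹ := by
    intro z hz
    rw [Metric.mem_closedBall, Real.dist_eq] at hz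
    have hz2 : t / 2 ≤ |z| := by
      have := abs_sub_abs_le_abs_sub u z
      rw [abs_sub_comm] at this
      linarith
    obtain ⟨h1, h2⟩ := hD z
    have h3 : (t / 2) ^ 3 * ‖deriv S z‖ ≤ D :=
      le_trans (by gcongr) h2
    rw [mul_min_of_nonneg _ _ (by positivity), mul_one]
    refine le_min (by linarith) ?_
    rw [← div_eq_mul_inv, le_div_iff₀ (by positivity)]
    nlinarith
  have hv : (x - y) / b ∈ Metric.closedBall u (t / 2) := by
    rw [Metric.mem_closedBall, Real.dist_eq, hu, ← sub_div, ht, hu, abs_div, abs_div, sub_sub_cancel_left,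
      abs_neg, div_div, mul_comm |b| 2, ← div_div]
    gcongr
    linarith
  have hmv := Convex.norm_image_sub_le_of_norm_deriv_le (fun z _ => hS z) hball
    (convex_closedBall u (t / 2)) (Metric.mem_closedBall_self (by positivity)) hv
  have hdist : ‖(x - y) / b - u‖ = |y| / |b| := by
    rw [hu, ← sub_div, sub_sub_cancel_left, Real.norm_eq_abs, abs_div, abs_neg]
  rw [hdist] at hmv
  have hmin : t ^ 2 * min 1 (t ^ 3)⁻¹ ≤ min t⁻¹ t⁻¹⁻¹ := by
    rw [inv_inv]
    refine le_min ?_ ?_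
    · calc t ^ 2 * min 1 (t ^ 3)⁻¹ ≤ t ^ 2 * (t ^ 3)⁻¹ := by gcongr; exact min_le_right _ _
        _ = t⁻¹ := by field_simp
    · rcases le_total t 1 with h | h
      · calc t ^ 2 * min 1 (t ^ 3)⁻¹ ≤ t ^ 2 * 1 := by gcongr; exact min_le_left _ _
          _ ≤ t := by nlinarith
      · calc t ^ 2 * min 1 (t ^ 3)⁻¹ ≤ t ^ 2 * (t ^ 3)⁻¹ := by gcongr; exact min_le_right _ _
          _ = t⁻¹ := by field_simp
          _ ≤ t := (inv_le_one_of_one_le₀ h).trans h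
  rw [hut]
  calc |b|⁻¹ * ‖S ((x - y) / b) - S u‖
      ≤ |b|⁻¹ * (8 * D * min 1 (t ^ 3)⁻¹ * (|y| / |b|)) := by gcongr
    _ = 8 * D * (|y| / x ^ 2) * (t ^ 2 * min 1 (t ^ 3)⁻¹) := by
        have hut2 : t = |x| / |b| := by rw [ht, hu, abs_div]
        rw [← sq_abs x]
        generalize min 1 (t ^ 3)⁻¹ = M
        rw [hut2]
        field_simp
    _ ≤ _ := by gcongr

/-- Near the origin the bump is Lipschitz and vanishes at `0`; far away it decays. This is the only
use of `θ 0 = 0` at nonzero frequencies. -/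
lemma exists_bound_min_inv {θ : ℝ → ℂ} (hθ : ContDiff ℝ ∞ θ) (hc : HasCompactSupport θ)
    (h0 : θ 0 = 0) : ∃ D : ℝ, 0 ≤ D ∧ ∀ ξ, ‖θ ξ‖ ≤ D * min |ξ| |ξ|⁻¹ := by
  obtain ⟨C, hC⟩ := ContDiff.lipschitzWith_of_hasCompactSupport hc hθ (by simp)
  obtain ⟨C1, hC1, h1⟩ := (hc.toSchwartzMap hθ).decay 1 0
  refine ⟨max C C1, by positivity, fun ξ => ?_⟩
  rw [mul_min_of_nonneg _ _ (by positivity)]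
  refine le_min ?_ ?_
  · have := hC.norm_sub_le ξ 0
    rw [h0, sub_zero, sub_zero, Real.norm_eq_abs] at this
    exact this.trans (by gcongr; exact le_max_left _ _)
  · rcases eq_or_ne ξ 0 with rfl | hξ
    · simp [h0]
    · have := h1 ξ
      rw [norm_iteratedFDeriv_zero, pow_one, Real.norm_eq_abs] at this
      rw [← div_eq_mul_inv, le_div_iff₀ (abs_pos.2 hξ), mul_comm]
      exact this.trans (le_max_right _ _)

end InverseFourier

/-! ### Vector-valued kernels and their `L²` bound. -/

section VectorKernel

variable {ι : Type*} [Fintype ι]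

/-- The operator-valued kernel `z ↦ (k j x z)_j`. -/
def vectorKernel (k : ι → ℝ → ℂ) (x : ℝ) : ℂ →L[ℂ] EuclideanSpace ℂ ι :=
  ContinuousLinearMap.toSpanSingleton ℂ (WithLp.toLp 2 fun j => k j x)

lemma norm_toLp_le_sum (v : ι → ℂ) : ‖(WithLp.toLp 2 v : EuclideanSpace ℂ ι)‖ ≤ ∑ j, ‖v j‖ := by
  have h := EuclideanSpace.norm_sq_eq (WithLp.toLp 2 v : EuclideanSpace ℂ ι)
  simp only at h
  have h2 : ∑ j, ‖v j‖ ^ 2 ≤ (∑ j, ‖v j‖) ^ 2 :=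
    Finset.sum_sq_le_sq_sum_of_nonneg fun j _ => norm_nonneg _
  exact le_of_sq_le_sq (by rw [h]; exact h2) (Finset.sum_nonneg fun j _ => norm_nonneg _)

/-- The `ℓ²` norm is at most the `ℓ¹` norm, so summed scalar differences suffice. The decay
constants may depend on the family, since only `B` enters the bounds. -/
lemma isCZKernel_vectorKernel {k : ι → ℝ → ℂ} {B : ℝ≥0} (hk : ∀ j, Continuous (k j))
    (hd : ∀ j, ∃ c : ℝ, ∀ x, ‖k j x‖ ≤ c * (1 + x ^ 2)⁻¹)
    (hs : ∀ x y : ℝ, 2 * |y| ≤ |x| → x ≠ 0 → ∑ j, ‖k j (x - y) - k j x‖ ≤ B * |y| / x ^ 2) :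
    IsCZKernel (vectorKernel k) B where
  continuous := by
    have h1 : Continuous fun x => (WithLp.toLp 2 fun j => k j x : EuclideanSpace ℂ ι) :=
      (PiLp.continuous_toLp 2 _).comp (continuous_pi hk)
    exact (ContinuousLinearMap.toSpanSingletonLIE ℂ (EuclideanSpace ℂ ι)).continuous.comp h1
  decay := by
    choose c hc using hd
    refine ⟨∑ j, c j, fun x => ?_⟩
    rw [vectorKernel, ContinuousLinearMap.norm_toSpanSingleton, Finset.sum_mul]
    exact (norm_toLp_le_sum _).trans (Finset.sum_le_sum fun j _ => hc j x)
  smooth x y hxy hx := by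
    refine le_trans ?_ (hs x y hxy hx)
    have h : vectorKernel k (x - y) - vectorKernel k x = ContinuousLinearMap.toSpanSingleton ℂ
        (WithLp.toLp 2 fun j => k j (x - y) - k j x) := by
      ext1
      simp only [vectorKernel, _root_.sub_apply,
        ContinuousLinearMap.toSpanSingleton_apply, one_smul]
      rfl
    rw [h, ContinuousLinearMap.norm_toSpanSingleton]
    exact norm_toLp_le_sum _

lemma convOp_vectorKernel_apply {k : ι → ℝ → ℂ} {B : ℝ≥0} (hK : IsCZKernel (vectorKernel k) B)
    {f : ℝ → ℂ} (hf : Integrable f) (x : ℝ) (j : ι) :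
    convOp (vectorKernel k) f x j = ∫ y, f y * k j (x - y) := by
  have h := (EuclideanSpace.proj (𝕜 := ℂ) j).integral_comp_comm (hK.integrable_apply hf x)
  rw [convOp]
  refine h.symm.trans (integral_congr_ae (Filter.Eventually.of_forall fun y => ?_))
  simp [vectorKernel]

lemma enorm_rpow_two_euclidean (v : EuclideanSpace ℂ ι) : ‖v‖ₑ ^ (2 : ℝ) = ∑ j, ‖v j‖ₑ ^ 2 := by
  rw [ENNReal.rpow_two, ← ofReal_norm, ← ENNReal.ofReal_pow (norm_nonneg _),
    EuclideanSpace.norm_sq_eq, ENNReal.ofReal_sum_of_nonneg fun j _ => by positivity]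
  refine Finset.sum_congr rfl fun j _ => ?_
  rw [ENNReal.ofReal_pow (norm_nonneg _), ofReal_norm]

lemma lintegral_enorm_sq_fourier (f : 𝓢(ℝ, ℂ)) : ∫⁻ ξ, ‖𝓕 f ξ‖ₑ ^ 2 = ∫⁻ x, ‖f x‖ₑ ^ 2 := by
  have h : ∀ g : 𝓢(ℝ, ℂ), ∫⁻ x, ‖g x‖ₑ ^ 2 = ENNReal.ofReal (∫ x, ‖g x‖ ^ 2) := fun g => by
    rw [ofReal_integral_eq_lintegral_ofReal ((g.memLp 2 volume).integrable_norm_pow (by norm_num))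
      (Filter.Eventually.of_forall fun x => by positivity)]
    refine lintegral_congr fun x => ?_
    rw [ENNReal.ofReal_pow (norm_nonneg _), ofReal_norm]
  rw [h, h, SchwartzMap.integral_norm_sq_fourier]

/-- Plancherel in each component, then the pointwise bound on the summed squares of the multipliers.
-/
lemma lintegral_convOp_schwartz_le {S : ι → 𝓢(ℝ, ℂ)} {B A : ℝ≥0}
    (hK : IsCZKernel (vectorKernel fun j => S j) B) (hA : ∀ ξ, ∑ j, ‖𝓕 (S j) ξ‖ₑ ^ 2 ≤ A)
    (f : 𝓢(ℝ, ℂ)) :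
    ∫⁻ x, ‖convOp (vectorKernel fun j => S j) f x‖ₑ ^ (2 : ℝ) ≤ A * ∫⁻ x, ‖f x‖ₑ ^ 2 := by
  set c : ι → 𝓢(ℝ, ℂ) := fun j =>
    SchwartzMap.convolution (ContinuousLinearMap.mul ℂ ℂ) f (S j) with hc
  have h1 : ∀ x, ‖convOp (vectorKernel fun j => S j) f x‖ₑ ^ (2 : ℝ) = ∑ j, ‖c j x‖ₑ ^ 2 :=
    fun x => by
      rw [enorm_rpow_two_euclidean]
      refine Finset.sum_congr rfl fun j _ => ?_
      rw [convOp_vectorKernel_apply hK f.integrable, hc, SchwartzMap.convolution_apply]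
      rfl
  calc ∫⁻ x, ‖convOp (vectorKernel fun j => S j) f x‖ₑ ^ (2 : ℝ)
      = ∑ j, ∫⁻ x, ‖c j x‖ₑ ^ 2 := by
        rw [lintegral_congr h1, lintegral_finsetSum]
        exact fun j _ => (c j).continuous.enorm.measurable.pow_const 2
    _ = ∑ j, ∫⁻ ξ, ‖𝓕 f ξ‖ₑ ^ 2 * ‖𝓕 (S j) ξ‖ₑ ^ 2 := by
        refine Finset.sum_congr rfl fun j _ => ?_
        rw [← lintegral_enorm_sq_fourier]
        refine lintegral_congr fun ξ => ?_
        rw [hc, SchwartzMap.fourier_convolution, SchwartzMap.pairing_apply_apply,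
          ContinuousLinearMap.mul_apply', enorm_mul, mul_pow]
    _ = ∫⁻ ξ, ‖𝓕 f ξ‖ₑ ^ 2 * ∑ j, ‖𝓕 (S j) ξ‖ₑ ^ 2 := by
        rw [← lintegral_finsetSum]
        · simp_rw [Finset.mul_sum]
        · exact fun j _ => ((𝓕 f).continuous.enorm.measurable.pow_const 2).mul
            ((𝓕 (S j)).continuous.enorm.measurable.pow_const 2)
    _ ≤ ∫⁻ ξ, A * ‖𝓕 f ξ‖ₑ ^ 2 := by
        refine lintegral_mono fun ξ => ?_
        rw [mul_comm]
        gcongr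
        exact hA ξ
    _ = A * ∫⁻ x, ‖f x‖ₑ ^ 2 := by
        rw [lintegral_const_mul' _ _ ENNReal.coe_ne_top, lintegral_enorm_sq_fourier]

lemma IntegrableBounded.memLp {G : Type*} [NormedAddCommGroup G] {f : ℝ → G}
    (hf : IntegrableBounded f) {q : ℝ} (hq : 1 ≤ q) : MemLp f (ENNReal.ofReal q) volume := by
  refine ⟨hf.integrable.1, ?_⟩
  rw [eLpNorm_eq_lintegral_rpow_enorm_toReal (by simp; linarith) ENNReal.ofReal_ne_top,
    ENNReal.toReal_ofReal (by linarith)]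
  exact ENNReal.rpow_lt_top_of_nonneg (by positivity) (hf.lintegral_rpow_ne_top hq)

lemma eLpNorm_two_sq {G : Type*} [NormedAddCommGroup G] (f : ℝ → G) :
    eLpNorm f 2 volume ^ 2 = ∫⁻ x, ‖f x‖ₑ ^ 2 := by
  have h := eLpNorm_nnreal_pow_eq_lintegral (f := f) (μ := volume) (p := 2) (by norm_num)
  simpa using h

lemma exists_schwartz_tendsto {f : ℝ → ℂ} (hf : MemLp f 2 volume) :
    ∃ g : ℕ → 𝓢(ℝ, ℂ), Filter.Tendsto (fun n => eLpNorm (fun x => g n x - f x) 2 volume)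
      Filter.atTop (nhds 0) := by
  have hd := SchwartzMap.denseRange_toLpCLM (E := ℝ) (F := ℂ) (p := 2) (by norm_num)
    (μ := (volume : Measure ℝ))
  obtain ⟨u, hu, hlim⟩ := mem_closure_iff_seq_limit.1 (hd (hf.toLp f))
  choose g hg using hu
  refine ⟨g, ?_⟩
  rw [Lp.tendsto_Lp_iff_tendsto_eLpNorm'] at hlim
  refine hlim.congr fun n => eLpNorm_congr_ae ?_
  rw [← hg]
  filter_upwards [(g n).coeFn_toLp 2 volume, hf.coeFn_toLp] with x h1 h2
  simp only [SchwartzMap.toLpCLM_apply, Pi.sub_apply] at h1 ⊢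
  rw [h1, h2]

/-- Schwartz functions are dense in `L²`. Because `K (x - ·)` is square integrable, `L²`
approximation makes the convolutions converge at every point, and Fatou's lemma passes the bound to
the limit. -/
lemma convLpBound_two_vectorKernel {S : ι → 𝓢(ℝ, ℂ)} {B A : ℝ≥0}
    (hK : IsCZKernel (vectorKernel fun j => S j) B) (hA : ∀ ξ, ∑ j, ‖𝓕 (S j) ξ‖ₑ ^ 2 ≤ A) :
    ConvLpBound (vectorKernel fun j => S j) 2 A := by
  intro f hf
  have hf2 : MemLp f 2 volume := by simpa using hf.memLp (q := 2) (by norm_num)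
  obtain ⟨g, hg⟩ := exists_schwartz_tendsto hf2
  set K := vectorKernel fun j => (S j : ℝ → ℂ) with hKdef
  set e : ℕ → ℝ≥0∞ := fun n => eLpNorm (fun x => g n x - f x) 2 volume with he
  have hpt : ∀ x, Filter.Tendsto (fun n => convOp K (g n) x) Filter.atTop
      (nhds (convOp K f x)) := by
    intro x
    rw [tendsto_iff_edist_tendsto_0]
    have hKx : ∫⁻ y, ‖K (x - y)‖ₑ ^ (2 : ℝ) ≠ ⊤ := by
      obtain ⟨M, hM0, hM⟩ := hK.exists_bound
      have : IntegrableBounded K := ⟨hK.integrable, M, Filter.Eventually.of_forall hM⟩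
      have h := this.lintegral_rpow_ne_top (q := 2) (by norm_num)
      rwa [lintegral_sub_left_eq_self (fun y => ‖K y‖ₑ ^ (2 : ℝ)) x]
    have hbound : ∀ n, edist (convOp K (g n) x) (convOp K f x) ≤
        (∫⁻ y, ‖K (x - y)‖ₑ ^ (2 : ℝ)) ^ (1 / 2 : ℝ) * e n := fun n => by
      rw [edist_eq_enorm_sub, ← hK.convOp_sub (g n).integrable hf.integrable]
      calc ‖convOp K (fun y => g n y - f y) x‖ₑ
          ≤ ∫⁻ y, ‖K (x - y)‖ₑ * ‖g n y - f y‖ₑ :=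
            (enorm_integral_le_lintegral_enorm _).trans
              (lintegral_mono fun y => (K (x - y)).le_opENorm _)
        _ ≤ (∫⁻ y, ‖K (x - y)‖ₑ ^ (2 : ℝ)) ^ (1 / 2 : ℝ) *
              (∫⁻ y, ‖g n y - f y‖ₑ ^ (2 : ℝ)) ^ (1 / 2 : ℝ) :=
            ENNReal.lintegral_mul_le_Lp_mul_Lq volume Real.HolderConjugate.two_two
              (hK.continuous.comp (by fun_prop : Continuous fun y => x - y)).enorm.measurable.aemeasurable
              ((g n).continuous.aestronglyMeasurable.sub hf.integrable.1).enorm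
        _ = _ := by
            rw [he]
            simp only
            rw [eLpNorm_eq_lintegral_rpow_enorm_toReal (by norm_num) (by norm_num)]
            norm_num
    have hlim : Filter.Tendsto (fun n => (∫⁻ y, ‖K (x - y)‖ₑ ^ (2 : ℝ)) ^ (1 / 2 : ℝ) * e n)
        Filter.atTop (nhds 0) := by
      have := ENNReal.Tendsto.const_mul (a := (∫⁻ y, ‖K (x - y)‖ₑ ^ (2 : ℝ)) ^ (1 / 2 : ℝ)) hg
        (Or.inr (ENNReal.rpow_ne_top_of_nonneg (by norm_num) hKx))
      rwa [mul_zero] at this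
    exact tendsto_of_tendsto_of_tendsto_of_le_of_le tendsto_const_nhds hlim (fun _ => zero_le)
      hbound
  have hgn : ∀ n, ∫⁻ x, ‖g n x‖ₑ ^ 2 ≤ (e n + eLpNorm f 2 volume) ^ 2 := fun n => by
    rw [← eLpNorm_two_sq]
    gcongr
    have h := eLpNorm_add_le (μ := volume) (p := 2) (f := fun x => g n x - f x) (g := f)
      ((g n).continuous.aestronglyMeasurable.sub hf.integrable.1) hf.integrable.1 (by norm_num)
    convert! h using 2
    funext x
    simp
  have hlim2 : Filter.Tendsto (fun n => A * (e n + eLpNorm f 2 volume) ^ 2) Filter.atTop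
      (nhds (A * ∫⁻ x, ‖f x‖ₑ ^ (2 : ℝ))) := by
    refine ENNReal.Tendsto.const_mul ?_ (Or.inr ENNReal.coe_ne_top)
    have h := ENNReal.Tendsto.pow (n := 2) (hg.add_const (eLpNorm f 2 volume))
    rw [zero_add, eLpNorm_two_sq] at h
    simpa using h
  calc ∫⁻ x, ‖convOp K f x‖ₑ ^ (2 : ℝ)
      = ∫⁻ x, Filter.liminf (fun n => ‖convOp K (g n) x‖ₑ ^ (2 : ℝ)) Filter.atTop := by
        refine lintegral_congr fun x => ?_
        exact ((hpt x).enorm.ennrpow_const 2).liminf_eq.symm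
    _ ≤ Filter.liminf (fun n => ∫⁻ x, ‖convOp K (g n) x‖ₑ ^ (2 : ℝ)) Filter.atTop :=
        lintegral_liminf_le fun n =>
          ((hK.continuous_convOp (g n).integrable).enorm.measurable).pow_const _
    _ ≤ Filter.liminf (fun n => A * (e n + eLpNorm f 2 volume) ^ 2) Filter.atTop := by
        refine Filter.liminf_le_liminf (Filter.Eventually.of_forall fun n => ?_)
        exact (lintegral_convOp_schwartz_le hK hA (g n)).trans (mul_le_mul_right (hgn n) _)
    _ = A * ∫⁻ x, ‖f x‖ₑ ^ (2 : ℝ) := hlim2.liminf_eq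

end VectorKernel

/-! ### The Littlewood–Paley inequality for lacunary dilates. -/

section LittlewoodPaley

/-- The inverse Fourier transforms of the dilates `θ(b_j ·)`, `j ∈ J`, as a vector-valued kernel. -/
def dilateKernel (θ : ℝ → ℂ) (b : ℕ → ℝ) (J : Finset ℕ) : ℝ → ℂ →L[ℂ] EuclideanSpace ℂ J :=
  vectorKernel fun j => invFourier fun ξ => θ (b j * ξ)

/-- The Littlewood–Paley inequality for dilates of a smooth bump vanishing at the origin. -/
theorem exists_convLpBound_dilateKernel {θ : ℝ → ℂ} (hθ : ContDiff ℝ ∞ θ)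
    (hc : HasCompactSupport θ) (h0 : θ 0 = 0) (N : ℕ) {q : ℝ} (hq : 1 < q) :
    ∃ B C : ℝ≥0, ∀ b : ℕ → ℝ, BoundedMultiplicity b N → ∀ J : Finset ℕ, (∀ j ∈ J, b j ≠ 0) →
      IsCZKernel (dilateKernel θ b J) B ∧ ConvLpBound (dilateKernel θ b J) q C := by
  obtain ⟨S₀, hS₀, -⟩ := exists_schwartz_invFourier hθ hc
  obtain ⟨D, hD0, hD⟩ := schwartzMap_exists_deriv_bound S₀
  obtain ⟨D', hD'0, hD'⟩ := exists_bound_min_inv hθ hc h0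
  -- The sum `8 * N` over scales is used twice: in space with `s = |x|⁻¹` for the smoothness
  -- constant, and in frequency with `s = 2π|ξ|` for the multiplier. Neither constant depends on `b`
  -- or `J`.
  set B : ℝ≥0 := 8 * D.toNNReal * (8 * N) with hB
  set A : ℝ≥0 := D'.toNNReal ^ 2 * (8 * N) with hA
  refine ⟨B, czConst A B q, fun b hb J hJ => ?_⟩
  have hsm : ∀ j : J, ContDiff ℝ ∞ fun ξ => θ (b j * ξ) := fun j => hθ.comp (by fun_prop)
  have hcs : ∀ j : J, HasCompactSupport fun ξ => θ (b j * ξ) := fun j =>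
    hc.comp_homeomorph (Homeomorph.mulLeft₀ (b j) (hJ j j.2))
  choose S hS hSF using fun j : J => exists_schwartz_invFourier (hsm j) (hcs j)
  have hker : dilateKernel θ b J = vectorKernel fun j => S j := by
    simp only [dilateKernel]
    congr 1
    funext j x
    exact (hS j x).symm
  have hscale : ∀ (j : J) x, S j x = (|b j|⁻¹ : ℝ) * S₀ (x / b j) := fun j x => by
    rw [hS, hS₀, invFourier_comp_mul θ (hJ j j.2)]
  have hCZ : IsCZKernel (vectorKernel fun j => (S j : ℝ → ℂ)) B := by
    refine isCZKernel_vectorKernel (fun j => (S j).continuous) (fun j => ?_) fun x y hxy hx => ?_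
    · obtain ⟨c, -, h⟩ := schwartzMap_exists_bound_inv_one_add_sq (S j)
      exact ⟨c, h⟩
    · calc ∑ j : J, ‖S j (x - y) - S j x‖
          ≤ ∑ j : J, 8 * D * (|y| / x ^ 2) * min (|x|⁻¹ * |b j|) (|x|⁻¹ * |b j|)⁻¹ := by
            refine Finset.sum_le_sum fun j _ => ?_
            rw [hscale, hscale, ← mul_sub, norm_mul, Complex.norm_real,
              Real.norm_of_nonneg (by positivity)]
            exact norm_rescaled_sub_le S₀.differentiable hD (hJ j j.2) hx hxy
        _ = 8 * D * (|y| / x ^ 2) * ∑ j ∈ J, min (|x|⁻¹ * |b j|) (|x|⁻¹ * |b j|)⁻¹ := by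
            rw [← Finset.mul_sum, Finset.sum_coe_sort J
              (fun j => min (|x|⁻¹ * |b j|) (|x|⁻¹ * |b j|)⁻¹)]
        _ ≤ 8 * D * (|y| / x ^ 2) * (8 * N) := by
            gcongr
            exact hb.sum_min_le hJ (inv_pos.2 (abs_pos.2 hx))
        _ = B * |y| / x ^ 2 := by
            rw [hB]
            push_cast
            rw [Real.coe_toNNReal _ hD0]
            ring
  rw [hker]
  refine ⟨hCZ, hCZ.convLpBound (convLpBound_two_vectorKernel hCZ fun ξ => ?_) hq⟩
  have hreal : ∑ j : J, ‖𝓕 (S j) ξ‖ ^ 2 ≤ D' ^ 2 * (8 * N) := by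
    rcases eq_or_ne ξ 0 with rfl | hξ
    · have : ∀ j : J, ‖𝓕 (S j) 0‖ ^ 2 = 0 := fun j => by rw [hSF]; simp [h0]
      rw [Finset.sum_congr rfl fun j _ => this j, Finset.sum_const_zero]
      positivity
    · have hs : 0 < 2 * Real.pi * |ξ| := by positivity
      calc ∑ j : J, ‖𝓕 (S j) ξ‖ ^ 2
          ≤ ∑ j : J, D' ^ 2 * min (2 * Real.pi * |ξ| * |b j|) (2 * Real.pi * |ξ| * |b j|)⁻¹ := by
            refine Finset.sum_le_sum fun j _ => ?_
            have h1 := hD' (b j * (2 * Real.pi * ξ))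
            have h2 : |b j * (2 * Real.pi * ξ)| = 2 * Real.pi * |ξ| * |b j| := by
              rw [abs_mul, abs_mul, abs_of_pos (by positivity : 0 < 2 * Real.pi)]
              ring
            rw [h2] at h1
            rw [hSF]
            set t := 2 * Real.pi * |ξ| * |b j| with ht
            have htp : 0 < t := mul_pos hs (abs_pos.2 (hJ j j.2))
            have hm0 : 0 ≤ min t t⁻¹ := by positivity
            have hm1 : min t t⁻¹ ≤ 1 := by
              rcases le_total t 1 with h | h
              · exact (min_le_left _ _).trans h
              · exact (min_le_right _ _).trans (inv_le_one_of_one_le₀ h)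
            calc ‖θ (b j * (2 * Real.pi * ξ))‖ ^ 2 ≤ (D' * min t t⁻¹) ^ 2 := by gcongr
              _ = D' ^ 2 * (min t t⁻¹ * min t t⁻¹) := by ring
              _ ≤ D' ^ 2 * min t t⁻¹ := by
                  gcongr
                  exact mul_le_of_le_one_left hm0 hm1
        _ = D' ^ 2 * ∑ j ∈ J, min (2 * Real.pi * |ξ| * |b j|) (2 * Real.pi * |ξ| * |b j|)⁻¹ := by
            rw [← Finset.mul_sum, Finset.sum_coe_sort J
              (fun j => min (2 * Real.pi * |ξ| * |b j|) (2 * Real.pi * |ξ| * |b j|)⁻¹)]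
        _ ≤ D' ^ 2 * (8 * N) := by
            gcongr
            exact hb.sum_min_le hJ hs
  calc ∑ j, ‖𝓕 (S j) ξ‖ₑ ^ 2 = ENNReal.ofReal (∑ j : J, ‖𝓕 (S j) ξ‖ ^ 2) := by
        rw [ENNReal.ofReal_sum_of_nonneg fun j _ => by positivity]
        refine Finset.sum_congr rfl fun j _ => ?_
        rw [ENNReal.ofReal_pow (norm_nonneg _), ofReal_norm]
    _ ≤ ENNReal.ofReal (D' ^ 2 * (8 * N)) := ENNReal.ofReal_le_ofReal hreal
    _ = A := by
        rw [← ENNReal.ofReal_coe_nnreal, hA]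
        push_cast
        rw [Real.coe_toNNReal _ hD'0]

end LittlewoodPaley

/-! ### Poisson bumps and Young's inequality. -/

section PoissonKernel

/-- A multiple of the Poisson kernel at scale `|a|`, with integral `π`. -/
def poissonBump (a x : ℝ) : ℝ := |a|⁻¹ * (1 + (x / a) ^ 2)⁻¹

lemma poissonBump_nonneg (a x : ℝ) : 0 ≤ poissonBump a x := by
  unfold poissonBump
  positivity

lemma poissonBump_eq {a : ℝ} (ha : a ≠ 0) (x : ℝ) : poissonBump a x = |a| / (a ^ 2 + x ^ 2) := by
  have h : 0 < |a| := abs_pos.2 ha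
  have h2 : a ^ 2 + x ^ 2 ≠ 0 := by positivity
  have h3 : (1 + (x / a) ^ 2) = (a ^ 2 + x ^ 2) / a ^ 2 := by field_simp
  rw [poissonBump, h3, inv_div, ← sq_abs a]
  rw [← sq_abs a] at h2
  field_simp

lemma continuous_poissonBump (a : ℝ) : Continuous (poissonBump a) := by
  unfold poissonBump
  exact continuous_const.mul (Continuous.inv₀ (by fun_prop) fun x => by positivity)

lemma lintegral_poissonBump {a : ℝ} (ha : a ≠ 0) :
    ∫⁻ x, ENNReal.ofReal (poissonBump a x) = ENNReal.ofReal Real.pi := by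
  have hi : Integrable (poissonBump a) := by
    unfold poissonBump
    exact (integrable_inv_one_add_sq.comp_div ha).const_mul _
  rw [← ofReal_integral_eq_lintegral_ofReal hi
    (Filter.Eventually.of_forall fun x => poissonBump_nonneg a x)]
  congr 1
  unfold poissonBump
  rw [integral_const_mul, Measure.integral_comp_div (fun x : ℝ => (1 + x ^ 2)⁻¹) a,
    integral_univ_inv_one_add_sq, smul_eq_mul, inv_mul_cancel_left₀ (abs_pos.2 ha).ne']

lemma poissonBump_le {a : ℝ} (ha : a ≠ 0) (x : ℝ) :
    poissonBump a x ≤ (|a| + |a|⁻¹) * (1 + x ^ 2)⁻¹ := by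
  have h : 0 < |a| := abs_pos.2 ha
  rw [poissonBump_eq ha, ← div_eq_mul_inv, div_le_div_iff₀ (by positivity) (by positivity),
    ← sq_abs a]
  have : (|a| + |a|⁻¹) * (|a| ^ 2 + x ^ 2) =
      |a| * (1 + x ^ 2) + |a| ^ 3 + |a|⁻¹ * x ^ 2 := by
    field_simp
    ring
  rw [this]
  have : 0 ≤ |a|⁻¹ * x ^ 2 := by positivity
  have : 0 ≤ |a| ^ 3 := by positivity
  linarith

/-- The scale drops out because `|a| |v| / (a ^ 2 + v ^ 2) ≤ 1 / 2` for every `v`. With `|x| ≤ 2 *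
|x - y|` the two terms of the difference give the constant `5 / 2`, rounded up to `3`. -/
lemma abs_poissonBump_sub_le {a x y : ℝ} (ha : a ≠ 0) (hxy : 2 * |y| ≤ |x|) (hx : x ≠ 0) :
    |poissonBump a (x - y) - poissonBump a x| ≤ 3 * |y| / x ^ 2 := by
  have hap : 0 < |a| := abs_pos.2 ha
  have hxp : 0 < |x| := abs_pos.2 hx
  set u := x - y with hu
  have hux : |x| ≤ 2 * |u| := by
    have := abs_sub_abs_le_abs_sub x y
    rw [hu]
    linarith
  have hP : 0 < a ^ 2 + u ^ 2 := by positivity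
  have hQ : 0 < a ^ 2 + x ^ 2 := by positivity
  have e : poissonBump a u - poissonBump a x =
      y * (|a| * u / (a ^ 2 + u ^ 2) * (1 / (a ^ 2 + x ^ 2)) +
        |a| * x / (a ^ 2 + x ^ 2) * (1 / (a ^ 2 + u ^ 2))) := by
    rw [poissonBump_eq ha, poissonBump_eq ha]
    field_simp
    rw [hu]
    ring
  have hhalf : ∀ v : ℝ, |(|a| * v / (a ^ 2 + v ^ 2))| ≤ 1 / 2 := fun v => by
    have hv : 0 < a ^ 2 + v ^ 2 := by positivity
    rw [abs_div, abs_of_pos hv, div_le_div_iff₀ hv (by norm_num), abs_mul, abs_abs, ← sq_abs a,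
      ← sq_abs v]
    nlinarith [sq_nonneg (|a| - |v|)]
  have hx2 : 1 / (a ^ 2 + x ^ 2) ≤ 1 / x ^ 2 := by
    gcongr
    nlinarith [sq_nonneg a]
  have hu2 : 1 / (a ^ 2 + u ^ 2) ≤ 4 / x ^ 2 := by
    rw [div_le_div_iff₀ hP (by positivity), ← sq_abs x, ← sq_abs u]
    nlinarith [sq_nonneg a, abs_nonneg u]
  rw [e, abs_mul]
  calc |y| * |(|a| * u / (a ^ 2 + u ^ 2) * (1 / (a ^ 2 + x ^ 2)) +
        |a| * x / (a ^ 2 + x ^ 2) * (1 / (a ^ 2 + u ^ 2)))|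
      ≤ |y| * (1 / 2 * (1 / x ^ 2) + 1 / 2 * (4 / x ^ 2)) := by
        gcongr
        refine (abs_add_le _ _).trans ?_
        rw [abs_mul, abs_mul, abs_of_pos (one_div_pos.2 hQ), abs_of_pos (one_div_pos.2 hP)]
        gcongr
        · exact hhalf u
        · exact hhalf x
    _ ≤ 3 * |y| / x ^ 2 := by
        have : 0 ≤ |y| / x ^ 2 := by positivity
        have e2 : |y| * (1 / 2 * (1 / x ^ 2) + 1 / 2 * (4 / x ^ 2)) = 5 / 2 * (|y| / x ^ 2) := by
          ring
        rw [e2, mul_div_assoc]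
        linarith

/-- The Cauchy–Schwarz inequality with a weight. -/
lemma lintegral_mul_sq_le {k F : ℝ → ℝ≥0∞} (hk : AEMeasurable k volume)
    (hF : AEMeasurable F volume) :
    (∫⁻ y, k y * F y) ^ 2 ≤ (∫⁻ y, k y) * ∫⁻ y, k y * F y ^ 2 := by
  have hsplit : ∀ z : ℝ≥0∞, z ^ (1 / 2 : ℝ) * z ^ (1 / 2 : ℝ) = z := fun z => by
    rw [← ENNReal.rpow_add_of_nonneg _ _ (by norm_num) (by norm_num)]
    norm_num
  have hsq : ∀ z : ℝ≥0∞, (z ^ (1 / 2 : ℝ)) ^ 2 = z := fun z => by rw [sq, hsplit]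
  have h := ENNReal.lintegral_mul_le_Lp_mul_Lq volume Real.HolderConjugate.two_two
    (f := fun y => k y ^ (1 / 2 : ℝ)) (g := fun y => k y ^ (1 / 2 : ℝ) * F y)
    (hk.pow_const _) ((hk.pow_const _).mul hF)
  simp only [Pi.mul_apply, ENNReal.rpow_two, mul_pow, hsq, ← mul_assoc, hsplit] at h
  calc (∫⁻ y, k y * F y) ^ 2
      ≤ ((∫⁻ y, k y) ^ (1 / 2 : ℝ) * (∫⁻ y, k y * F y ^ 2) ^ (1 / 2 : ℝ)) ^ 2 := by gcongr
    _ = (∫⁻ y, k y) * ∫⁻ y, k y * F y ^ 2 := by rw [mul_pow, hsq, hsq]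

/-- Young's inequality `L¹ * L² ⊆ L²`. -/
lemma lintegral_lconvolution_sq_le {k F : ℝ → ℝ≥0∞} (hk : Measurable k)
    (hF : AEMeasurable F volume) :
    ∫⁻ x, (∫⁻ y, k (x - y) * F y) ^ 2 ≤ (∫⁻ y, k y) ^ 2 * ∫⁻ y, F y ^ 2 := by
  have hpt : ∀ x, (∫⁻ y, k (x - y) * F y) ^ 2 ≤ (∫⁻ y, k y) * ∫⁻ y, k (x - y) * F y ^ 2 := by
    intro x
    have hkx : Measurable fun y => k (x - y) := hk.comp (by fun_prop)
    have h := lintegral_mul_sq_le hkx.aemeasurable hF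
    rwa [lintegral_sub_left_eq_self k x] at h
  have hm : AEMeasurable (Function.uncurry fun x y => k (x - y) * F y ^ 2)
      (volume.prod volume) := by
    refine AEMeasurable.mul (f := fun z : ℝ × ℝ => k (z.1 - z.2)) (g := fun z : ℝ × ℝ => F z.2 ^ 2)
      (hk.comp (by fun_prop)).aemeasurable ?_
    exact (hF.pow_const 2).comp_snd
  calc ∫⁻ x, (∫⁻ y, k (x - y) * F y) ^ 2
      ≤ ∫⁻ x, (∫⁻ y, k y) * ∫⁻ y, k (x - y) * F y ^ 2 := lintegral_mono hpt
    _ = (∫⁻ y, k y) * ∫⁻ x, ∫⁻ y, k (x - y) * F y ^ 2 :=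
        lintegral_const_mul'' _ hm.lintegral_prod_right'
    _ = (∫⁻ y, k y) * ∫⁻ y, (∫⁻ x, k x) * F y ^ 2 := by
        rw [lintegral_lintegral_swap hm]
        congr 1
        refine lintegral_congr fun y => ?_
        have hky : Measurable fun x => k (x - y) := hk.comp (by fun_prop)
        rw [lintegral_mul_const _ hky, lintegral_sub_right_eq_self k y]
    _ = (∫⁻ y, k y) ^ 2 * ∫⁻ y, F y ^ 2 := by
        rw [lintegral_const_mul'' _ (hF.pow_const 2), ← mul_assoc, sq]

end PoissonKernel

/-! ### The vector-valued inequality for Poisson averages. -/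

section DiagonalKernel

variable {ι : Type*} [Fintype ι]

/-- The diagonal operator with entries `d j`. -/
def diagCLM : (ι → ℂ) →ₗ[ℂ] EuclideanSpace ℂ ι →L[ℂ] EuclideanSpace ℂ ι where
  toFun d := LinearMap.toContinuousLinearMap
    { toFun := fun z => WithLp.toLp 2 fun j => d j * z j
      map_add' := fun z w => by ext j; simp [mul_add]
      map_smul' := fun c z => by ext j; simp [mul_left_comm] }
  map_add' d d' := by ext z j; simp [add_mul]
  map_smul' c d := by ext z j; simp [mul_assoc]

lemma diagCLM_apply (d : ι → ℂ) (z : EuclideanSpace ℂ ι) (j : ι) : diagCLM d z j = d j * z j := rfl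

lemma norm_diagCLM_le {d : ι → ℂ} {M : ℝ} (hM0 : 0 ≤ M) (hM : ∀ j, ‖d j‖ ≤ M) :
    ‖diagCLM d‖ ≤ M := by
  refine ContinuousLinearMap.opNorm_le_bound _ hM0 fun z => ?_
  refine le_of_sq_le_sq ?_ (by positivity)
  rw [mul_pow, EuclideanSpace.norm_sq_eq, EuclideanSpace.norm_sq_eq, Finset.mul_sum]
  refine Finset.sum_le_sum fun j _ => ?_
  rw [diagCLM_apply, norm_mul, mul_pow]
  gcongr
  exact hM j

/-- The diagonal kernel whose entries are Poisson bumps at scales `a j`. -/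
def poissonKernel (a : ι → ℝ) (x : ℝ) : EuclideanSpace ℂ ι →L[ℂ] EuclideanSpace ℂ ι :=
  diagCLM fun j => (poissonBump (a j) x : ℂ)

/-- A diagonal operator is bounded by its largest entry, so the smoothness constant depends neither
on the number of scales nor on their sizes. -/
lemma isCZKernel_poissonKernel {a : ι → ℝ} (ha : ∀ j, a j ≠ 0) :
    IsCZKernel (poissonKernel a) 3 where
  continuous := by
    have h1 : Continuous fun x => fun j => (poissonBump (a j) x : ℂ) :=
      continuous_pi fun j => Complex.continuous_ofReal.comp (continuous_poissonBump (a j))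
    exact (LinearMap.continuous_of_finiteDimensional _).comp h1
  decay := by
    refine ⟨∑ j, (|a j| + |a j|⁻¹), fun x => norm_diagCLM_le (by positivity) fun j => ?_⟩
    rw [Complex.norm_real, Real.norm_of_nonneg (poissonBump_nonneg _ _)]
    refine (poissonBump_le (ha j) x).trans ?_
    gcongr
    exact Finset.single_le_sum (f := fun j => |a j| + |a j|⁻¹) (fun j _ => by positivity)
      (Finset.mem_univ j)
  smooth x y hxy hx := by
    rw [poissonKernel, poissonKernel, ← map_sub]
    refine norm_diagCLM_le (by positivity) fun j => ?_
    rw [Pi.sub_apply, ← Complex.ofReal_sub, Complex.norm_real]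
    exact_mod_cast abs_poissonBump_sub_le (ha j) hxy hx

lemma convOp_poissonKernel_apply {a : ι → ℝ} (ha : ∀ j, a j ≠ 0) {f : ℝ → EuclideanSpace ℂ ι}
    (hf : Integrable f) (x : ℝ) (j : ι) :
    convOp (poissonKernel a) f x j = ∫ y, (poissonBump (a j) (x - y) : ℂ) * f y j :=
  ((EuclideanSpace.proj (𝕜 := ℂ) j).integral_comp_comm
    ((isCZKernel_poissonKernel ha).integrable_apply hf x)).symm

/-- In `L²` the components separate, and each is a convolution with a kernel of mass `π`. -/
lemma convLpBound_two_poissonKernel {a : ι → ℝ} (ha : ∀ j, a j ≠ 0) :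
    ConvLpBound (poissonKernel a) 2 (Real.pi.toNNReal ^ 2) := by
  intro f hf
  have hfj : ∀ j, AEStronglyMeasurable (fun x => f x j) volume := fun j =>
    (EuclideanSpace.proj (𝕜 := ℂ) j).continuous.comp_aestronglyMeasurable hf.integrable.1
  have hj : ∀ j, ∫⁻ x, ‖convOp (poissonKernel a) f x j‖ₑ ^ 2 ≤
      ENNReal.ofReal Real.pi ^ 2 * ∫⁻ x, ‖f x j‖ₑ ^ 2 := fun j => by
    rw [← lintegral_poissonBump (ha j)]
    refine le_trans (lintegral_mono fun x => ?_) (lintegral_lconvolution_sq_le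
      (continuous_poissonBump (a j)).measurable.ennreal_ofReal (hfj j).enorm)
    gcongr
    rw [convOp_poissonKernel_apply ha hf.integrable]
    refine (enorm_integral_le_lintegral_enorm _).trans (le_of_eq (lintegral_congr fun y => ?_))
    rw [enorm_mul, ← ofReal_norm (poissonBump (a j) (x - y) : ℂ), Complex.norm_real,
      Real.norm_of_nonneg (poissonBump_nonneg _ _)]
  have hm : ∀ j, AEMeasurable (fun x => ‖f x j‖ₑ ^ 2) volume := fun j => (hfj j).enorm.pow_const 2
  have hc := (isCZKernel_poissonKernel ha).continuous_convOp hf.integrable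
  calc ∫⁻ x, ‖convOp (poissonKernel a) f x‖ₑ ^ (2 : ℝ)
      = ∑ j, ∫⁻ x, ‖convOp (poissonKernel a) f x j‖ₑ ^ 2 := by
        simp_rw [enorm_rpow_two_euclidean]
        refine lintegral_finsetSum _ fun j _ => ?_
        exact (((EuclideanSpace.proj (𝕜 := ℂ) j).continuous.comp hc).enorm.measurable).pow_const 2
    _ ≤ ∑ j, ENNReal.ofReal Real.pi ^ 2 * ∫⁻ x, ‖f x j‖ₑ ^ 2 := Finset.sum_le_sum fun j _ => hj j
    _ = _ := by
        rw [← Finset.mul_sum, ← lintegral_finsetSum' _ fun j _ => hm j]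
        simp_rw [enorm_rpow_two_euclidean]
        push_cast
        rfl

/-- The vector-valued inequality for convolutions with Poisson bumps. -/
theorem convLpBound_poissonKernel {a : ι → ℝ} (ha : ∀ j, a j ≠ 0) {q : ℝ} (hq : 1 < q) :
    ConvLpBound (poissonKernel a) q (czConst (Real.pi.toNNReal ^ 2) 3 q) :=
  (isCZKernel_poissonKernel ha).convLpBound (convLpBound_two_poissonKernel ha) hq

end DiagonalKernel

/-! ### A Bessel inequality for integer frequencies on the line. -/

section TrigonometricPolynomials

lemma integral_exp_int_mul (k : ℤ) : ∫ u in (0 : ℝ)..2 * Real.pi, Complex.exp (Complex.I * k * u) =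
    if k = 0 then (2 * Real.pi : ℂ) else 0 := by
  split_ifs with h
  · simp [h]
  · have hc : Complex.I * k ≠ 0 := mul_ne_zero Complex.I_ne_zero (by exact_mod_cast h)
    rw [integral_exp_mul_complex hc]
    have : Complex.exp (Complex.I * k * ((2 * Real.pi : ℝ) : ℂ)) = 1 := by
      rw [Complex.exp_eq_one_iff]
      exact ⟨k, by push_cast; ring⟩
    rw [this]
    simp

/-- The trigonometric polynomial `∑_{p ∈ s} c_p e^{ipu}`. -/
def trigPoly (s : Finset ℕ) (c : ℕ → ℂ) (u : ℝ) : ℂ :=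
  ∑ p ∈ s, c p * Complex.exp (Complex.I * p * u)

lemma continuous_trigPoly (s : Finset ℕ) (c : ℕ → ℂ) : Continuous (trigPoly s c) := by
  unfold trigPoly
  fun_prop

lemma trigPoly_periodic (s : Finset ℕ) (c : ℕ → ℂ) :
    Function.Periodic (trigPoly s c) (2 * Real.pi) := by
  intro u
  refine Finset.sum_congr rfl fun p _ => ?_
  congr 1
  rw [Complex.exp_eq_exp_iff_exists_int]
  exact ⟨p, by push_cast; ring⟩

lemma integral_norm_sq_trigPoly (s : Finset ℕ) (c : ℕ → ℂ) :
    ∫ u in (0 : ℝ)..2 * Real.pi, ‖trigPoly s c u‖ ^ 2 = 2 * Real.pi * ∑ p ∈ s, ‖c p‖ ^ 2 := by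
  have hpt : ∀ u : ℝ, ((‖trigPoly s c u‖ ^ 2 : ℝ) : ℂ) = ∑ p ∈ s, ∑ r ∈ s,
      c p * (starRingEnd ℂ) (c r) * Complex.exp (Complex.I * ((p : ℤ) - (r : ℤ) : ℤ) * u) := by
    intro u
    rw [Complex.ofReal_pow, ← Complex.mul_conj', trigPoly, map_sum, Finset.sum_mul_sum]
    refine Finset.sum_congr rfl fun p _ => Finset.sum_congr rfl fun r _ => ?_
    rw [map_mul, ← Complex.exp_conj]
    simp only [map_mul, Complex.conj_I, Complex.conj_ofReal, map_natCast]
    rw [mul_mul_mul_comm, ← Complex.exp_add]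
    congr 2
    push_cast
    ring
  have h : ((∫ u in (0 : ℝ)..2 * Real.pi, ‖trigPoly s c u‖ ^ 2 : ℝ) : ℂ) =
      ((2 * Real.pi * ∑ p ∈ s, ‖c p‖ ^ 2 : ℝ) : ℂ) := by
    rw [← intervalIntegral.integral_ofReal]
    simp_rw [hpt]
    rw [intervalIntegral.integral_finsetSum fun p _ =>
      Continuous.intervalIntegrable (by fun_prop) _ _]
    rw [Complex.ofReal_mul, Complex.ofReal_sum, Finset.mul_sum]
    refine Finset.sum_congr rfl fun p hp => ?_
    rw [intervalIntegral.integral_finsetSum fun r _ =>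
      Continuous.intervalIntegrable (by fun_prop) _ _, Finset.sum_eq_single p]
    · rw [intervalIntegral.integral_const_mul, integral_exp_int_mul, if_pos (sub_self _),
        Complex.mul_conj']
      push_cast
      ring
    · intro r _ hr
      rw [intervalIntegral.integral_const_mul, integral_exp_int_mul, if_neg, mul_zero]
      rw [sub_eq_zero, Nat.cast_inj]
      exact fun h => hr h.symm
    · exact fun h => absurd hp h
  exact_mod_cast h

lemma inv_one_add_sq_le_of_mem_Ioc {n : ℤ} {u : ℝ}
    (hu : u ∈ Ioc (n • (2 * Real.pi)) ((n + 1) • (2 * Real.pi))) :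
    (1 + u ^ 2)⁻¹ ≤ 4 * (1 + (n : ℝ) ^ 2)⁻¹ := by
  obtain ⟨h1, h2⟩ := hu
  rw [zsmul_eq_mul] at h1 h2
  push_cast at h2
  have hpi : 3 < Real.pi := Real.pi_gt_three
  rw [← div_eq_mul_inv, inv_eq_one_div, div_le_div_iff₀ (by positivity) (by positivity)]
  rcases le_or_gt 0 n with hn | hn
  · have hn' : (0 : ℝ) ≤ n := by exact_mod_cast hn
    have : (n : ℝ) ≤ u := by nlinarith
    nlinarith
  · have hn' : (n : ℝ) ≤ -1 := by exact_mod_cast (show n ≤ -1 by lia)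
    have : 6 * (-(n : ℝ) - 1) ≤ -u := by nlinarith
    nlinarith [sq_nonneg ((n : ℝ) + 2), sq_nonneg ((n : ℝ) + 1)]

lemma tsum_inv_one_add_sq_ne_top :
    ∑' n : ℤ, ENNReal.ofReal (4 * (1 + (n : ℝ) ^ 2)⁻¹) ≠ ⊤ := by
  have h1 : Summable fun n : ℤ => 4 * (1 + (n : ℝ) ^ 2)⁻¹ := by
    refine Summable.mul_left 4 ?_
    have h2 : Summable fun n : ℤ => 1 / (n : ℝ) ^ 2 := Real.summable_one_div_int_pow.2 one_lt_two
    refine Summable.of_norm_bounded_eventually h2 ?_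
    filter_upwards [(Set.finite_singleton (0 : ℤ)).compl_mem_cofinite] with n hn
    have hn0 : (n : ℝ) ≠ 0 := by exact_mod_cast hn
    rw [Real.norm_of_nonneg (by positivity), inv_eq_one_div]
    gcongr
    linarith
  rw [← ENNReal.ofReal_tsum_of_nonneg (fun n => by positivity) h1]
  exact ENNReal.ofReal_ne_top

/-- The line is cut into periods: Parseval gives the same value on each, and the weight on the
`n`-th is at most `4 / (1 + n²)`, which is summable. -/
lemma lintegral_weight_trigPoly_le (s : Finset ℕ) (c : ℕ → ℂ) :
    ∫⁻ u, ENNReal.ofReal (1 + u ^ 2)⁻¹ * ‖trigPoly s c u‖ₑ ^ 2 ≤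
      (∑' n : ℤ, ENNReal.ofReal (4 * (1 + (n : ℝ) ^ 2)⁻¹)) *
        ENNReal.ofReal (2 * Real.pi * ∑ p ∈ s, ‖c p‖ ^ 2) := by
  have h2pi : 0 < 2 * Real.pi := by positivity
  have hm : Measurable fun u => ‖trigPoly s c u‖ₑ ^ 2 :=
    (continuous_trigPoly s c).enorm.measurable.pow_const 2
  have hper : ∀ n : ℤ, ∫⁻ u in Ioc (n • (2 * Real.pi)) ((n + 1) • (2 * Real.pi)),
      ‖trigPoly s c u‖ₑ ^ 2 = ENNReal.ofReal (2 * Real.pi * ∑ p ∈ s, ‖c p‖ ^ 2) := by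
    intro n
    have hpre : (fun u => u + n • (2 * Real.pi)) ⁻¹'
        Ioc (n • (2 * Real.pi)) ((n + 1) • (2 * Real.pi)) = Ioc 0 (2 * Real.pi) := by
      rw [preimage_add_const_Ioc, sub_self, add_smul, one_smul, add_sub_cancel_left]
    rw [← (measurePreserving_add_right volume (n • (2 * Real.pi))).setLIntegral_comp_preimage
      measurableSet_Ioc hm, hpre, ← integral_norm_sq_trigPoly,
      intervalIntegral.integral_of_le h2pi.le, ofReal_integral_eq_lintegral_ofReal]
    · refine lintegral_congr fun u => ?_
      rw [(trigPoly_periodic s c).zsmul n u, ENNReal.ofReal_pow (norm_nonneg _), ofReal_norm]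
    · exact (((continuous_trigPoly s c).norm.pow 2).integrableOn_Icc).mono_set Ioc_subset_Icc_self
    · exact Filter.Eventually.of_forall fun u => by positivity
  rw [← setLIntegral_univ, ← iUnion_Ioc_zsmul h2pi, lintegral_iUnion (fun n => measurableSet_Ioc)
    (pairwise_disjoint_Ioc_zsmul (2 * Real.pi)), ← ENNReal.tsum_mul_right]
  refine ENNReal.tsum_le_tsum fun n => ?_
  rw [← hper n, ← lintegral_const_mul' _ _ ENNReal.ofReal_ne_top]
  refine setLIntegral_mono' measurableSet_Ioc fun u hu => ?_
  gcongr
  exact inv_one_add_sq_le_of_mem_Ioc hu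

/-- A Bessel inequality for integer frequencies on the line. -/
theorem exists_sum_norm_sq_integral_exp_le :
    ∃ C : ℝ, 0 ≤ C ∧ ∀ (G : ℝ → ℂ) (M : ℝ), 0 ≤ M → AEStronglyMeasurable G volume →
      (∀ᵐ u, ‖G u‖ ≤ M * (1 + u ^ 2)⁻¹) → ∀ s : Finset ℕ,
      ∑ p ∈ s, ‖∫ u, G u * Complex.exp (Complex.I * p * u)‖ ^ 2 ≤ C * M ^ 2 := by
  set T := ∑' n : ℤ, ENNReal.ofReal (4 * (1 + (n : ℝ) ^ 2)⁻¹) with hT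
  have hTt : T ≠ ⊤ := tsum_inv_one_add_sq_ne_top
  refine ⟨Real.pi * T.toReal * (2 * Real.pi), by positivity, fun G M hM0 hGm hG s => ?_⟩
  have hGi : Integrable G := (integrable_inv_one_add_sq.const_mul M).mono' hGm hG
  have hGe : ∀ p : ℕ, Integrable fun u => G u * Complex.exp (Complex.I * p * u) := fun p => by
    refine hGi.norm.mono' (hGm.mul (by fun_prop)) (Filter.Eventually.of_forall fun u => ?_)
    rw [norm_mul, mul_assoc, mul_comm Complex.I]
    have : Complex.exp (p * u * Complex.I) = Complex.exp (((p * u : ℝ) : ℂ) * Complex.I) := by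
      push_cast
      rfl
    rw [this, Complex.norm_exp_ofReal_mul_I, mul_one]
  set c : ℕ → ℂ := fun p => ∫ u, G u * Complex.exp (Complex.I * p * u) with hc
  set S : ℝ := ∑ p ∈ s, ‖c p‖ ^ 2 with hS
  have hS0 : 0 ≤ S := by positivity
  -- Duality: pairing `G` with this polynomial gives exactly `S`, while weighted Cauchy–Schwarz
  -- bounds the square of the pairing by a multiple of `M ^ 2 * S`. One factor `S` then cancels.
  set P := trigPoly s fun p => (starRingEnd ℂ) (c p) with hP
  have hSP : (S : ℂ) = ∫ u, G u * P u := by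
    have h1 : ∀ u, G u * P u =
        ∑ p ∈ s, (starRingEnd ℂ) (c p) * (G u * Complex.exp (Complex.I * p * u)) := fun u => by
      rw [hP, trigPoly, Finset.mul_sum]
      exact Finset.sum_congr rfl fun p _ => by ring
    simp_rw [h1]
    rw [integral_finsetSum _ fun p _ => (hGe p).const_mul _, hS]
    push_cast
    refine Finset.sum_congr rfl fun p _ => ?_
    rw [integral_const_mul, ← Complex.conj_mul']
  have hSw : ENNReal.ofReal S ≤
      ENNReal.ofReal M * ∫⁻ u, ENNReal.ofReal (1 + u ^ 2)⁻¹ * ‖P u‖ₑ := by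
    calc ENNReal.ofReal S = ‖∫ u, G u * P u‖ₑ := by
          rw [← hSP, ← ofReal_norm, Complex.norm_real, Real.norm_of_nonneg hS0]
      _ ≤ ∫⁻ u, ENNReal.ofReal M * (ENNReal.ofReal (1 + u ^ 2)⁻¹ * ‖P u‖ₑ) := by
          refine (enorm_integral_le_lintegral_enorm _).trans (lintegral_mono_ae ?_)
          filter_upwards [hG] with u hu
          rw [enorm_mul, ← mul_assoc, ← ENNReal.ofReal_mul hM0]
          gcongr
          rw [← ofReal_norm]
          exact ENNReal.ofReal_le_ofReal hu
      _ = _ := lintegral_const_mul' _ _ ENNReal.ofReal_ne_top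
  have hw : ∫⁻ u : ℝ, ENNReal.ofReal (1 + u ^ 2)⁻¹ = ENNReal.ofReal Real.pi := by
    rw [← ofReal_integral_eq_lintegral_ofReal integrable_inv_one_add_sq
      (Filter.Eventually.of_forall fun u => by positivity), integral_univ_inv_one_add_sq]
  have hcs := lintegral_mul_sq_le (k := fun u : ℝ => ENNReal.ofReal (1 + u ^ 2)⁻¹)
    (F := fun u => ‖P u‖ₑ) (by fun_prop)
    (continuous_trigPoly s _).enorm.measurable.aemeasurable
  have hweight := lintegral_weight_trigPoly_le s fun p => (starRingEnd ℂ) (c p)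
  simp only [RCLike.norm_conj] at hweight
  have hfin : ENNReal.ofReal S ^ 2 ≤ ENNReal.ofReal M ^ 2 * (ENNReal.ofReal Real.pi *
      (T * ENNReal.ofReal (2 * Real.pi * S))) := by
    calc ENNReal.ofReal S ^ 2
        ≤ (ENNReal.ofReal M * ∫⁻ u, ENNReal.ofReal (1 + u ^ 2)⁻¹ * ‖P u‖ₑ) ^ 2 := by gcongr
      _ ≤ _ := by
          rw [mul_pow]
          refine mul_le_mul_right (hcs.trans ?_) _
          rw [hw]
          exact mul_le_mul_right hweight _
  rw [← ENNReal.ofReal_toReal hTt, ← ENNReal.ofReal_pow hS0, ← ENNReal.ofReal_pow hM0,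
    ← ENNReal.ofReal_mul (by positivity), ← ENNReal.ofReal_mul (by positivity),
    ← ENNReal.ofReal_mul (by positivity), ENNReal.ofReal_le_ofReal_iff (by positivity)] at hfin
  rcases hS0.eq_or_lt with h | h
  · rw [← h]
    positivity
  · refine le_of_mul_le_mul_right ?_ h
    calc S * S = S ^ 2 := (sq S).symm
      _ ≤ _ := hfin
      _ = _ := by ring

end TrigonometricPolynomials

/-! ### Inserting a frequency cutoff. -/

section Reproducing

/-- If `𝓕 ψ = 1` wherever `𝓕 k ≠ 0`, then convolving with `ψ` first does not change `f * k`. -/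
lemma integral_mul_eq_of_fourier_mul_eq {f : ℝ → ℂ} (hf : Integrable f) (ψ k : 𝓢(ℝ, ℂ))
    (h : ∀ ξ, 𝓕 ψ ξ * 𝓕 k ξ = 𝓕 k ξ) (x : ℝ) :
    ∫ t, f t * k (x - t) = ∫ y, (∫ t, f t * ψ (y - t)) * k (x - y) := by
  -- On the Fourier side this is the hypothesis; the conclusion is then associativity of
  -- convolution.
  have hψk : ((ψ : ℝ → ℂ) ⋆[ContinuousLinearMap.mul ℂ ℂ, volume] (k : ℝ → ℂ)) = k := by
    have h1 : SchwartzMap.convolution (ContinuousLinearMap.mul ℂ ℂ) ψ k = k := by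
      rw [← FourierTransform.fourierInv_fourier_eq (F := 𝓢(ℝ, ℂ))
        (SchwartzMap.convolution (ContinuousLinearMap.mul ℂ ℂ) ψ k),
        SchwartzMap.fourier_convolution]
      have h2 : SchwartzMap.pairing (ContinuousLinearMap.mul ℂ ℂ) (𝓕 ψ) (𝓕 k) = 𝓕 k := by
        ext ξ
        rw [SchwartzMap.pairing_apply_apply, ContinuousLinearMap.mul_apply', h]
      rw [h2, FourierTransform.fourierInv_fourier_eq]
    funext z
    rw [← SchwartzMap.convolution_apply, h1]
  obtain ⟨M, hM0, hM⟩ := schwartzMap_exists_bound_inv_one_add_sq k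
  have hkM : ∀ z, ‖k z‖ ≤ M := fun z => (hM z).trans
    (mul_le_of_le_one_right hM0 (inv_le_one_of_one_le₀ (by nlinarith [sq_nonneg z])))
  have hnc : Continuous ((fun z => ‖ψ z‖) ⋆[ContinuousLinearMap.mul ℝ ℝ, volume] fun z => ‖k z‖) :=
    BddAbove.continuous_convolution_right_of_integrable _
      ⟨M, by rintro _ ⟨z, rfl⟩; simpa using hkM z⟩ ψ.integrable.norm k.continuous.norm
  have hassoc := convolution_assoc (𝕜 := ℂ) (μ := (volume : Measure ℝ)) (ν := (volume : Measure ℝ))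
    (f := f) (g := ψ) (k := k) (ContinuousLinearMap.mul ℂ ℂ) (ContinuousLinearMap.mul ℂ ℂ)
    (ContinuousLinearMap.mul ℂ ℂ) (ContinuousLinearMap.mul ℂ ℂ)
    (fun x y z => by simp [mul_assoc]) (x₀ := x) hf.1 ψ.continuous.aestronglyMeasurable
    k.continuous.aestronglyMeasurable (hf.ae_convolution_exists _ ψ.integrable)
    (ψ.integrable.norm.ae_convolution_exists _ k.integrable.norm) (by
      refine hf.norm.mul_bdd (c := M * ∫ y, ‖ψ y‖)
        (hnc.comp (by fun_prop)).aestronglyMeasurable (Filter.Eventually.of_forall fun t => ?_)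
      refine (norm_integral_le_integral_norm _).trans ?_
      rw [← integral_const_mul]
      refine integral_mono_of_nonneg (Filter.Eventually.of_forall fun y => norm_nonneg _)
        (ψ.integrable.norm.const_mul M) (Filter.Eventually.of_forall fun y => ?_)
      simp only [ContinuousLinearMap.mul_apply', norm_mul, norm_norm]
      rw [mul_comm]
      gcongr
      exact hkM _)
  rw [hψk] at hassoc
  exact hassoc.symm

end Reproducing

/-! ### Rescaling and modulation of the pieces. -/

section Pieces

variable {γ : ℝ → ℝ} {φ : ℝ → ℂ}

/-- The scale `2^{-j} γ'(2^{-j})`. -/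
def scale (γ : ℝ → ℝ) (j : ℕ) : ℝ := deriv γ ((2 : ℝ) ^ (-(j : ℤ))) / 2 ^ j

lemma AdmissibleNearOrigin.exists_boundedMultiplicity (hγ : AdmissibleNearOrigin γ) :
    ∃ N, BoundedMultiplicity (scale γ) N := by
  obtain ⟨N, hN⟩ := hγ.variation
  refine ⟨N, fun α hα => ?_⟩
  convert! hN α hα using 5 with j
  rw [scale, zpow_neg, zpow_natCast, div_eq_inv_mul]

lemma phiPiece_eq (γ : ℝ → ℝ) (φ : ℝ → ℂ) (j p : ℕ) :
    phiPiece γ φ j p = fun η => (fun ξ => φ (ξ - p)) (scale γ j * η) := by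
  funext η
  rw [phiPiece, scale, div_mul_eq_mul_div]

lemma localize_apply (γ : ℝ → ℝ) (φ : ℝ → ℂ) (j p : ℕ) (f : ℝ → ℂ) (x : ℝ) :
    localize γ φ j p f x = ∫ t, f t * invFourier (phiPiece γ φ j p) (x - t) := rfl

/-- At scale zero the multiplier is the constant `φ(-p)`, so the assumption that no piece sees the
zero frequency removes these scales. -/
lemma localize_of_scale_eq_zero {j p : ℕ} (hj : scale γ j = 0) (hp : φ (-(p : ℝ)) = 0)
    (f : ℝ → ℂ) (x : ℝ) : localize γ φ j p f x = 0 := by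
  have h : phiPiece γ φ j p = fun _ => 0 := by
    rw [phiPiece_eq, hj]
    funext η
    simp [hp]
  simp [localize_apply, h, invFourier]

lemma invFourier_translate (φ : ℝ → ℂ) (p : ℝ) (x : ℝ) :
    invFourier (fun ξ => φ (ξ - p)) x = invFourier φ x * Complex.exp (Complex.I * p * x) := by
  have h := integral_sub_right_eq_self (μ := volume)
    (fun ξ : ℝ => φ ξ * Complex.exp (Complex.I * x * ((ξ + p : ℝ) : ℂ))) p
  simp only [sub_add_cancel] at h
  rw [invFourier, invFourier, h, mul_assoc, ← integral_mul_const]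
  congr 2
  funext ξ
  rw [mul_assoc (φ ξ), ← Complex.exp_add]
  congr 2
  push_cast
  ring

lemma invFourier_phiPiece {j : ℕ} (hj : scale γ j ≠ 0) (p : ℕ) (x : ℝ) :
    invFourier (phiPiece γ φ j p) x = (|scale γ j|⁻¹ : ℝ) * (invFourier φ (x / scale γ j) *
      Complex.exp (Complex.I * p * ((x / scale γ j : ℝ) : ℂ))) := by
  rw [phiPiece_eq, invFourier_comp_mul (fun ξ => φ (ξ - p)) hj]
  exact congrArg _ (invFourier_translate φ p _)

lemma localize_congr_ae {j p : ℕ} {f g : ℝ → ℂ} (h : f =ᵐ[volume] g) (x : ℝ) :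
    localize γ φ j p f x = localize γ φ j p g x := by
  rw [localize_apply, localize_apply]
  refine integral_congr_ae ?_
  filter_upwards [h] with t ht
  rw [ht]

/-- After the substitution `t = x - scale γ j * u`, the index `p` survives only as an integer
frequency, as the Bessel inequality requires. -/
lemma localize_eq_integral_rescaled {j : ℕ} (hj : scale γ j ≠ 0) (p : ℕ) (g : ℝ → ℂ) (x : ℝ) :
    localize γ φ j p g x = ∫ u, g (x - scale γ j * u) * invFourier φ u *
      Complex.exp (Complex.I * p * u) := by
  set a := scale γ j with ha
  set H : ℝ → ℂ := fun u => g (x - a * u) * invFourier φ u * Complex.exp (Complex.I * p * u) with hH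
  have h1 : ∀ t, g t * invFourier (phiPiece γ φ j p) (x - t) = (|a|⁻¹ : ℝ) * H ((x - t) / a) := by
    intro t
    rw [invFourier_phiPiece hj, hH]
    simp only
    rw [mul_div_cancel₀ _ hj, sub_sub_cancel]
    ring
  rw [localize_apply]
  simp_rw [h1]
  rw [integral_const_mul, integral_sub_left_eq_self (fun v => H (v / a)) volume x,
    Measure.integral_comp_div H a, Complex.real_smul, ← mul_assoc, ← Complex.ofReal_mul,
    inv_mul_cancel₀ (abs_pos.2 hj).ne', Complex.ofReal_one, one_mul]

lemma exists_invFourier_bound (hφ : ContDiff ℝ ∞ φ) (hφc : HasCompactSupport φ) :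
    ∃ D : ℝ, 0 ≤ D ∧ ∀ z, ‖invFourier φ z‖ ≤ D * (1 + z ^ 2)⁻¹ := by
  obtain ⟨S, hS, -⟩ := exists_schwartz_invFourier hφ hφc
  obtain ⟨D, hD0, hD⟩ := schwartzMap_exists_bound_inv_one_add_sq S
  exact ⟨D, hD0, fun z => by rw [← hS]; exact hD z⟩

end Pieces

/-! ### The pointwise bound for `g`, low blocks, and the cutoff for high blocks. -/

section SquareFunctions

variable {γ : ℝ → ℝ} {φ : ℝ → ℂ}

theorem exists_sum_norm_sq_localize_le (hφ : ContDiff ℝ ∞ φ) (hφc : HasCompactSupport φ) :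
    ∃ C : ℝ, 0 ≤ C ∧ ∀ (γ : ℝ → ℝ) (g : ℝ → ℂ) (M : ℝ), 0 ≤ M → AEStronglyMeasurable g volume →
      (∀ᵐ t, ‖g t‖ ≤ M) → ∀ j, scale γ j ≠ 0 → ∀ (x : ℝ) (s : Finset ℕ),
      ∑ p ∈ s, ‖localize γ φ j p g x‖ ^ 2 ≤ C * M ^ 2 := by
  obtain ⟨S, hS, -⟩ := exists_schwartz_invFourier hφ hφc
  obtain ⟨D, hD0, hD⟩ := exists_invFourier_bound hφ hφc
  obtain ⟨C, hC0, hC⟩ := exists_sum_norm_sq_integral_exp_le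
  refine ⟨C * D ^ 2, by positivity, fun γ g M hM0 hgm hg j hj x s => ?_⟩
  obtain ⟨g₁, hg₁, hgg₁⟩ := hgm
  -- Truncation gives a representative bounded everywhere, so that no null set has to be carried
  -- through the change of variables.
  set B : Set ℝ := {t | ‖g₁ t‖ ≤ M} with hB
  have hBm : MeasurableSet B := measurableSet_le hg₁.norm.measurable measurable_const
  set g₂ := B.indicator g₁ with hg₂
  have hgg₂ : g =ᵐ[volume] g₂ := by
    filter_upwards [hgg₁, hg] with t h1 h2
    rw [hg₂, indicator_of_mem (show t ∈ B by rw [hB, mem_ofPred_eq, ← h1]; exact h2), h1]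
  have hbd : ∀ t, ‖g₂ t‖ ≤ M := fun t => by
    by_cases ht : t ∈ B
    · rw [hg₂, indicator_of_mem ht]
      exact ht
    · rwa [hg₂, indicator_of_notMem ht, norm_zero]
  have hmeas : StronglyMeasurable g₂ := hg₁.indicator hBm
  have hφm : Continuous (invFourier φ) := by
    have : invFourier φ = S := funext fun z => (hS z).symm
    rw [this]
    exact S.continuous
  have key := hC (fun u => g₂ (x - scale γ j * u) * invFourier φ u) (M * D) (by positivity)
    ((hmeas.comp_measurable (by fun_prop)).aestronglyMeasurable.mul hφm.aestronglyMeasurable)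
    (Filter.Eventually.of_forall fun u => by
      rw [norm_mul, mul_assoc]
      exact mul_le_mul (hbd _) (hD u) (norm_nonneg _) hM0) s
  calc ∑ p ∈ s, ‖localize γ φ j p g x‖ ^ 2
      = ∑ p ∈ s, ‖∫ u, g₂ (x - scale γ j * u) * invFourier φ u *
          Complex.exp (Complex.I * p * u)‖ ^ 2 :=
        Finset.sum_congr rfl fun p _ => by
          rw [localize_congr_ae hgg₂, localize_eq_integral_rescaled hj]
    _ ≤ C * (M * D) ^ 2 := key
    _ = C * D ^ 2 * M ^ 2 := by ring

/-- The maximal localisation `sup_{2^m ≤ p ≤ 2^{m+1}} |h * φ̌_{j,p}|`. -/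
def supLocalize (γ : ℝ → ℝ) (φ : ℝ → ℂ) (m j : ℕ) (h : ℝ → ℂ) (x : ℝ) : ℝ≥0∞ :=
  (Finset.Icc (2 ^ m) (2 ^ (m + 1))).sup fun p => ‖localize γ φ j p h x‖ₑ

/-- The `L^q` bound with constant `C` for the square functions of `supLocalize γ φ m`, for
integrable bounded functions. -/
def SupSquareBound (γ : ℝ → ℝ) (φ : ℝ → ℂ) (m : ℕ) (q : ℝ) (C : ℝ≥0) : Prop :=
  ∀ J : Finset ℕ, (∀ j ∈ J, scale γ j ≠ 0) → ∀ h : ℝ → ℂ, IntegrableBounded h →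
    ∫⁻ x, (∑ j ∈ J, supLocalize γ φ m j h x ^ 2) ^ (q / 2) ≤ C * ∫⁻ x, ‖h x‖ₑ ^ q

lemma enorm_rpow_euclidean {ι : Type*} [Fintype ι] (v : EuclideanSpace ℂ ι) (q : ℝ) :
    ‖v‖ₑ ^ q = (∑ j, ‖v j‖ₑ ^ 2) ^ (q / 2) := by
  rw [← enorm_rpow_two_euclidean, ← ENNReal.rpow_mul, mul_div_cancel₀ _ two_ne_zero]

/-- Each `φ(· - p)` vanishes at the origin, so for fixed `p` the pieces form a Littlewood–Paley
family. The supremum over `p` is replaced by a sum, at a cost that grows with the block; only small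
`m` is treated this way. -/
lemma exists_supSquareBound_of_vanishing (hφ : ContDiff ℝ ∞ φ) (hφc : HasCompactSupport φ) {N : ℕ}
    (hN : BoundedMultiplicity (scale γ) N) {q : ℝ} (hq : 1 < q) (m : ℕ)
    (hm : ∀ p : ℕ, 2 ^ m ≤ p → p ≤ 2 ^ (m + 1) → φ (-(p : ℝ)) = 0) :
    ∃ C, SupSquareBound γ φ m q C := by
  classical
  set s := Finset.Icc (2 ^ m) (2 ^ (m + 1)) with hs
  have hp : ∀ p : ℕ, p ∈ s → ∃ B C : ℝ≥0, ∀ J : Finset ℕ, (∀ j ∈ J, scale γ j ≠ 0) →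
      IsCZKernel (dilateKernel (fun ξ => φ (ξ - p)) (scale γ) J) B ∧
        ConvLpBound (dilateKernel (fun ξ => φ (ξ - p)) (scale γ) J) q C := fun p hps => by
    obtain ⟨B, C, h⟩ := exists_convLpBound_dilateKernel (θ := fun ξ => φ (ξ - p))
      (hφ.comp (by fun_prop)) (hφc.comp_homeomorph (Homeomorph.subRight (p : ℝ)))
      (by rw [zero_sub]; exact hm p (Finset.mem_Icc.1 hps).1 (Finset.mem_Icc.1 hps).2) N hq
    exact ⟨B, C, h _ hN⟩
  choose! B C hBC using hp
  have hq2 : 0 < q / 2 := by linarith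
  refine ⟨(s.card : ℝ≥0) ^ (q / 2) * ∑ p ∈ s, C p, fun J hJ h hh => ?_⟩
  set X : ℕ → ℝ → ℝ≥0∞ := fun p x => ∑ j ∈ J, ‖localize γ φ j p h x‖ₑ ^ 2 with hX
  have hXe : ∀ p ∈ s, ∀ x, X p x ^ (q / 2) =
      ‖convOp (dilateKernel (fun ξ => φ (ξ - p)) (scale γ) J) h x‖ₑ ^ q := fun p hps x => by
    rw [enorm_rpow_euclidean]
    congr 1
    rw [hX]
    simp only
    rw [← Finset.sum_coe_sort J fun j => ‖localize γ φ j p h x‖ₑ ^ 2]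
    refine Finset.sum_congr rfl fun j _ => ?_
    rw [dilateKernel, convOp_vectorKernel_apply (hBC p hps J hJ).1 hh.integrable, localize_apply,
      phiPiece_eq]
  have hpt : ∀ x, (∑ j ∈ J, supLocalize γ φ m j h x ^ 2) ^ (q / 2) ≤
      (s.card : ℝ≥0∞) ^ (q / 2) * ∑ p ∈ s, X p x ^ (q / 2) := fun x => by
    have hne : s.Nonempty := ⟨2 ^ m, Finset.mem_Icc.2 ⟨le_rfl, Nat.pow_le_pow_right two_pos
      (Nat.le_succ m)⟩⟩
    obtain ⟨p₀, hp₀, hmax⟩ := s.exists_max_image (fun p => X p x) hne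
    have h1 : ∑ j ∈ J, supLocalize γ φ m j h x ^ 2 ≤ s.card * X p₀ x := by
      calc ∑ j ∈ J, supLocalize γ φ m j h x ^ 2
          ≤ ∑ j ∈ J, ∑ p ∈ s, ‖localize γ φ j p h x‖ₑ ^ 2 := by
            refine Finset.sum_le_sum fun j _ => ?_
            obtain ⟨p, hps, hpe⟩ := Finset.exists_mem_eq_sup s hne
              fun p => ‖localize γ φ j p h x‖ₑ
            rw [supLocalize, hpe]
            exact Finset.single_le_sum (f := fun p => ‖localize γ φ j p h x‖ₑ ^ 2)
              (fun p _ => zero_le) hps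
        _ = ∑ p ∈ s, X p x := Finset.sum_comm
        _ ≤ ∑ p ∈ s, X p₀ x := Finset.sum_le_sum hmax
        _ = s.card * X p₀ x := by rw [Finset.sum_const, nsmul_eq_mul]
    calc (∑ j ∈ J, supLocalize γ φ m j h x ^ 2) ^ (q / 2)
        ≤ (s.card * X p₀ x) ^ (q / 2) := ENNReal.rpow_le_rpow h1 hq2.le
      _ = (s.card : ℝ≥0∞) ^ (q / 2) * X p₀ x ^ (q / 2) := ENNReal.mul_rpow_of_nonneg _ _ hq2.le
      _ ≤ _ := by
          gcongr
          exact Finset.single_le_sum (f := fun p => X p x ^ (q / 2)) (fun p _ => zero_le) hp₀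
  calc ∫⁻ x, (∑ j ∈ J, supLocalize γ φ m j h x ^ 2) ^ (q / 2)
      ≤ ∫⁻ x, (s.card : ℝ≥0∞) ^ (q / 2) * ∑ p ∈ s, X p x ^ (q / 2) := lintegral_mono hpt
    _ = (s.card : ℝ≥0∞) ^ (q / 2) * ∑ p ∈ s, ∫⁻ x, X p x ^ (q / 2) := by
        rw [lintegral_const_mul' _ _ (ENNReal.rpow_ne_top_of_nonneg hq2.le (by simp)),
          lintegral_finsetSum']
        intro p hps
        simp_rw [hXe p hps]
        exact ((hBC p hps J hJ).1.continuous_convOp hh.integrable).enorm.measurable.aemeasurable.pow_const q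
    _ ≤ (s.card : ℝ≥0∞) ^ (q / 2) * ∑ p ∈ s, C p * ∫⁻ x, ‖h x‖ₑ ^ q := by
        gcongr with p hps
        simp_rw [hXe p hps]
        exact (hBC p hps J hJ).2 h hh
    _ = _ := by
        rw [← Finset.sum_mul, ← mul_assoc]
        push_cast
        rw [ENNReal.coe_rpow_of_nonneg _ hq2.le]
        rfl

/-- The interval is `[1 - 10/16, 2 + 10/16]`. It is the closed ball of radius `9 / 8` about `3 / 2`,
and the outer radius `5 / 4` still keeps the support away from `0`. -/
lemma exists_frequency_cutoff : ∃ Ψ : ℝ → ℂ, ContDiff ℝ ∞ Ψ ∧ HasCompactSupport Ψ ∧ Ψ 0 = 0 ∧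
    ∀ ξ ∈ Icc (3 / 8 : ℝ) (21 / 8), Ψ ξ = 1 := by
  let b : ContDiffBump (3 / 2 : ℝ) := ⟨9 / 8, 5 / 4, by norm_num, by norm_num⟩
  refine ⟨fun ξ => ((b ξ : ℝ) : ℂ), Complex.ofRealCLM.contDiff.comp b.contDiff,
    b.hasCompactSupport.comp_left (g := fun r : ℝ => (r : ℂ)) Complex.ofReal_zero, ?_,
    fun ξ hξ => ?_⟩
  · simp only
    rw [b.zero_of_le_dist, Complex.ofReal_zero]
    rw [Real.dist_eq]
    norm_num [b]
  · simp only
    rw [b.one_of_mem_closedBall, Complex.ofReal_one]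
    rw [Metric.mem_closedBall, Real.dist_eq, abs_le]
    obtain ⟨h1, h2⟩ := hξ
    have : b.rIn = 9 / 8 := rfl
    rw [this]
    constructor <;> linarith

/-- Where `φ (t - p)` is nonzero, `t` is within `10` of `p`, and `m ≥ 4` makes this at most `10/16`
in units of `2 ^ m`. -/
lemma cutoff_mul_piece_eq (hφs : tsupport φ ⊆ {x : ℝ | 1 / 10 < |x| ∧ |x| < 10}) {Ψ : ℝ → ℂ}
    (hΨ : ∀ ξ ∈ Icc (3 / 8 : ℝ) (21 / 8), Ψ ξ = 1) {m p : ℕ} (hm : 4 ≤ m) (h1 : 2 ^ m ≤ p)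
    (h2 : p ≤ 2 ^ (m + 1)) (t : ℝ) : Ψ (t / 2 ^ m) * φ (t - p) = φ (t - p) := by
  by_cases h0 : φ (t - p) = 0
  · rw [h0, mul_zero]
  · have hs := (hφs (subset_tsupport _ h0)).2
    rw [abs_lt] at hs
    have e1 : (2 : ℝ) ^ m ≤ p := by exact_mod_cast h1
    have e2 : (p : ℝ) ≤ 2 * 2 ^ m := by
      rw [← pow_succ']
      exact_mod_cast h2
    have e3 : (16 : ℝ) ≤ 2 ^ m := by
      have : (2 : ℝ) ^ 4 ≤ 2 ^ m := pow_le_pow_right₀ (by norm_num) hm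
      linarith
    have hpos : (0 : ℝ) < 2 ^ m := by positivity
    rw [hΨ, one_mul]
    rw [mem_Icc, le_div_iff₀ hpos, div_le_iff₀ hpos]
    constructor <;> linarith [hs.1, hs.2]

end SquareFunctions

/-! ### The maximal square function of `h`, uniformly in `m`. -/

section Assembly

variable {γ : ℝ → ℝ} {φ : ℝ → ℂ}

/-- The pointwise domination of all pieces at scale `j` by one convolution with a Poisson bump. -/
lemma enorm_localize_le_lintegral {D : ℝ} (hD : ∀ z, ‖invFourier φ z‖ ≤ D * (1 + z ^ 2)⁻¹)
    (hD0 : 0 ≤ D) (hφ : ContDiff ℝ ∞ φ) (hφc : HasCompactSupport φ)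
    (hφs : tsupport φ ⊆ {x : ℝ | 1 / 10 < |x| ∧ |x| < 10}) {Ψ : ℝ → ℂ} (hΨs : ContDiff ℝ ∞ Ψ)
    (hΨc : HasCompactSupport Ψ) (hΨ : ∀ ξ ∈ Icc (3 / 8 : ℝ) (21 / 8), Ψ ξ = 1) {m j p : ℕ}
    (hm : 4 ≤ m) (h1 : 2 ^ m ≤ p) (h2 : p ≤ 2 ^ (m + 1)) (hj : scale γ j ≠ 0) {h : ℝ → ℂ}
    (hh : Integrable h) (x : ℝ) :
    ‖localize γ φ j p h x‖ₑ ≤ ENNReal.ofReal D *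
      ∫⁻ y, ENNReal.ofReal (poissonBump (scale γ j) (x - y)) *
        ‖∫ t, h t * invFourier (fun ξ => Ψ (scale γ j / 2 ^ m * ξ)) (y - t)‖ₑ := by
  have hjm : scale γ j / 2 ^ m ≠ 0 := div_ne_zero hj (by positivity)
  obtain ⟨ψ, hψ, hψF⟩ := exists_schwartz_invFourier
    (χ := fun ξ => Ψ (scale γ j / 2 ^ m * ξ)) (hΨs.comp (by fun_prop))
    (hΨc.comp_homeomorph (Homeomorph.mulLeft₀ _ hjm))
  have hpc : HasCompactSupport (phiPiece γ φ j p) := by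
    rw [phiPiece_eq]
    exact (hφc.comp_homeomorph (Homeomorph.subRight (p : ℝ))).comp_homeomorph
      (Homeomorph.mulLeft₀ _ hj)
  have hps : ContDiff ℝ ∞ (phiPiece γ φ j p) := by
    rw [phiPiece_eq]
    exact hφ.comp (by fun_prop)
  obtain ⟨k, hk, hkF⟩ := exists_schwartz_invFourier hps hpc
  have hmul : ∀ ξ, 𝓕 ψ ξ * 𝓕 k ξ = 𝓕 k ξ := fun ξ => by
    rw [hψF, hkF, phiPiece_eq, div_mul_eq_mul_div]
    exact cutoff_mul_piece_eq hφs hΨ hm h1 h2 _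
  have hrep := integral_mul_eq_of_fourier_mul_eq hh ψ k hmul x
  simp_rw [hψ, hk] at hrep
  rw [localize_apply, hrep, ← lintegral_const_mul' _ _ ENNReal.ofReal_ne_top]
  refine (enorm_integral_le_lintegral_enorm _).trans (lintegral_mono fun y => ?_)
  rw [enorm_mul, mul_comm, ← mul_assoc, ← ENNReal.ofReal_mul hD0]
  gcongr
  rw [← ofReal_norm]
  refine ENNReal.ofReal_le_ofReal ?_
  rw [invFourier_phiPiece hj, norm_mul, norm_mul, Complex.norm_real,
    Real.norm_of_nonneg (by positivity), poissonBump]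
  -- The modulation is the only place where `p` enters the kernel, so the bound holds for the
  -- supremum over `p`.
  have hexp : ‖Complex.exp (Complex.I * p * (((x - y) / scale γ j : ℝ) : ℂ))‖ = 1 := by
    rw [mul_assoc, mul_comm Complex.I]
    have := Complex.norm_exp_ofReal_mul_I (p * ((x - y) / scale γ j))
    rwa [Complex.ofReal_mul, Complex.ofReal_natCast] at this
  rw [hexp, mul_one, mul_left_comm]
  gcongr
  exact hD _

lemma exists_supSquareBound_of_four_le (hφ : ContDiff ℝ ∞ φ) (hφc : HasCompactSupport φ)
    (hφs : tsupport φ ⊆ {x : ℝ | 1 / 10 < |x| ∧ |x| < 10}) {N : ℕ}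
    (hN : BoundedMultiplicity (scale γ) N) {q : ℝ} (hq : 1 < q) :
    ∃ C, ∀ m, 4 ≤ m → SupSquareBound γ φ m q C := by
  obtain ⟨Ψ, hΨs, hΨc, hΨ0, hΨ⟩ := exists_frequency_cutoff
  obtain ⟨D, hD0, hD⟩ := exists_invFourier_bound hφ hφc
  obtain ⟨B, C, hBC⟩ := exists_convLpBound_dilateKernel hΨs hΨc hΨ0 N hq
  set C' := czConst (Real.pi.toNNReal ^ 2) 3 q
  refine ⟨D.toNNReal ^ q * (C' * C), fun m hm J hJ h hh => ?_⟩
  -- Dividing all scales by `2 ^ m` preserves the multiplicity bound; this is why `C` does not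
  -- depend on `m`.
  obtain ⟨hK, hKC⟩ := hBC (fun j => scale γ j / 2 ^ m) (hN.div_const (by positivity)) J
    fun j hj => div_ne_zero (hJ j hj) (by positivity)
  set u := convOp (dilateKernel Ψ (fun j => scale γ j / 2 ^ m) J) h with hu
  have huc : Continuous u := hK.continuous_convOp hh.integrable
  have hub : IntegrableBounded u := hK.integrableBounded_convOp hh.integrable
  -- Componentwise absolute values keep the `ℓ²` norm and turn the Poisson convolution into the
  -- positive majorant of the pieces.
  set w : ℝ → EuclideanSpace ℂ J := fun x => WithLp.toLp 2 fun j => ((‖u x j‖ : ℝ) : ℂ) with hw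
  have hwn : ∀ x, ‖w x‖ = ‖u x‖ := fun x => by
    rw [EuclideanSpace.norm_eq, EuclideanSpace.norm_eq]
    simp [hw]
  have hwc : Continuous w := by
    refine (PiLp.continuous_toLp 2 _).comp (continuous_pi fun j => ?_)
    exact Complex.continuous_ofReal.comp
      ((EuclideanSpace.proj (𝕜 := ℂ) j).continuous.comp huc).norm
  have hwb : IntegrableBounded w := by
    refine ⟨hub.integrable.congr' hwc.aestronglyMeasurable
      (Filter.Eventually.of_forall fun x => (hwn x).symm), ?_⟩
    obtain ⟨M, hM⟩ := hub.bounded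
    exact ⟨M, by simpa only [hwn] using hM⟩
  have ha : ∀ j : J, scale γ j ≠ 0 := fun j => hJ j j.2
  set v := convOp (poissonKernel fun j : J => scale γ j) w with hv
  have hvj : ∀ x (j : J), ‖v x j‖ₑ = ∫⁻ y, ENNReal.ofReal (poissonBump (scale γ j) (x - y)) *
      ‖u y j‖ₑ := fun x j => by
    have hi : Integrable fun y => poissonBump (scale γ j) (x - y) * ‖u y j‖ := by
      have h1 := ((isCZKernel_poissonKernel ha).integrable_apply hwb.integrable x)
      have h2 := ((EuclideanSpace.proj (𝕜 := ℂ) j).integrable_comp h1).norm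
      refine h2.congr (Filter.Eventually.of_forall fun y => ?_)
      change ‖(poissonBump (scale γ j) (x - y) : ℂ) * ((‖u y j‖ : ℝ) : ℂ)‖ = _
      rw [norm_mul, Complex.norm_real, Complex.norm_real, norm_norm,
        Real.norm_of_nonneg (poissonBump_nonneg _ _)]
    have h0 : ∀ y, 0 ≤ poissonBump (scale γ j) (x - y) * ‖u y j‖ := fun y =>
      mul_nonneg (poissonBump_nonneg _ _) (norm_nonneg _)
    have h3 : v x j = ((∫ y, poissonBump (scale γ j) (x - y) * ‖u y j‖ : ℝ) : ℂ) := by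
      rw [hv, convOp_poissonKernel_apply ha hwb.integrable, ← integral_complex_ofReal]
      refine integral_congr_ae (Filter.Eventually.of_forall fun y => ?_)
      simp only [hw]
      push_cast
      rfl
    rw [h3, ← ofReal_norm, Complex.norm_real, Real.norm_of_nonneg (integral_nonneg h0),
      ofReal_integral_eq_lintegral_ofReal hi (Filter.Eventually.of_forall h0)]
    refine lintegral_congr fun y => ?_
    rw [ENNReal.ofReal_mul (poissonBump_nonneg _ _), ofReal_norm]
  have hsup : ∀ x (j : J), supLocalize γ φ m j h x ≤ ENNReal.ofReal D * ‖v x j‖ₑ := fun x j => by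
    refine Finset.sup_le fun p hp => ?_
    rw [Finset.mem_Icc] at hp
    rw [hvj]
    refine (enorm_localize_le_lintegral hD hD0 hφ hφc hφs hΨs hΨc hΨ hm hp.1 hp.2 (ha j)
      hh.integrable x).trans (le_of_eq ?_)
    congr 1
    refine lintegral_congr fun y => ?_
    rw [hu, dilateKernel, convOp_vectorKernel_apply hK hh.integrable]
  have hpt : ∀ x, (∑ j ∈ J, supLocalize γ φ m j h x ^ 2) ^ (q / 2) ≤
      ENNReal.ofReal D ^ q * ‖v x‖ₑ ^ q := fun x => by
    calc (∑ j ∈ J, supLocalize γ φ m j h x ^ 2) ^ (q / 2)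
        ≤ (ENNReal.ofReal D ^ 2 * ∑ j, ‖v x j‖ₑ ^ 2) ^ (q / 2) := by
          refine ENNReal.rpow_le_rpow ?_ (by linarith)
          rw [← Finset.sum_coe_sort J fun j => supLocalize γ φ m j h x ^ 2, Finset.mul_sum]
          refine Finset.sum_le_sum fun j _ => ?_
          rw [← mul_pow]
          gcongr
          exact hsup x j
      _ = ENNReal.ofReal D ^ q * ‖v x‖ₑ ^ q := by
          rw [ENNReal.mul_rpow_of_nonneg _ _ (by linarith), enorm_rpow_euclidean,
            ← ENNReal.rpow_natCast, ← ENNReal.rpow_mul]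
          congr 2
          push_cast
          ring
  calc ∫⁻ x, (∑ j ∈ J, supLocalize γ φ m j h x ^ 2) ^ (q / 2)
      ≤ ∫⁻ x, ENNReal.ofReal D ^ q * ‖v x‖ₑ ^ q := lintegral_mono hpt
    _ = ENNReal.ofReal D ^ q * ∫⁻ x, ‖v x‖ₑ ^ q :=
        lintegral_const_mul' _ _ (ENNReal.rpow_ne_top_of_nonneg (by linarith) ENNReal.ofReal_ne_top)
    _ ≤ ENNReal.ofReal D ^ q * (C' * ∫⁻ x, ‖w x‖ₑ ^ q) := by
        gcongr
        exact convLpBound_poissonKernel ha hq w hwb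
    _ = ENNReal.ofReal D ^ q * (C' * ∫⁻ x, ‖u x‖ₑ ^ q) := by
        congr 2
        refine lintegral_congr fun x => ?_
        rw [← ofReal_norm, hwn, ofReal_norm]
    _ ≤ ENNReal.ofReal D ^ q * (C' * (C * ∫⁻ x, ‖h x‖ₑ ^ q)) := by
        gcongr
        exact hKC h hh
    _ = _ := by
        rw [ENNReal.coe_mul, ENNReal.coe_mul, ENNReal.coe_rpow_of_nonneg _ (by linarith)]
        simp only [ENNReal.ofReal]
        ring

/-- One constant serves all `m ≥ 4`, and the four remaining blocks add one constant each. -/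
lemma exists_supSquareBound (hφ : ContDiff ℝ ∞ φ) (hφc : HasCompactSupport φ)
    (hφs : tsupport φ ⊆ {x : ℝ | 1 / 10 < |x| ∧ |x| < 10}) {N : ℕ}
    (hN : BoundedMultiplicity (scale γ) N) {q : ℝ} (hq : 1 < q) :
    ∃ C, ∀ m : ℕ, (∀ p : ℕ, 2 ^ m ≤ p → p ≤ 2 ^ (m + 1) → φ (-(p : ℝ)) = 0) →
      SupSquareBound γ φ m q C := by
  obtain ⟨C₀, hC₀⟩ := exists_supSquareBound_of_four_le hφ hφc hφs hN hq
  have hlow : ∀ m : ℕ, ∃ C, (∀ p : ℕ, 2 ^ m ≤ p → p ≤ 2 ^ (m + 1) → φ (-(p : ℝ)) = 0) →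
      SupSquareBound γ φ m q C := fun m => by
    by_cases hm : ∀ p : ℕ, 2 ^ m ≤ p → p ≤ 2 ^ (m + 1) → φ (-(p : ℝ)) = 0
    · obtain ⟨C, hC⟩ := exists_supSquareBound_of_vanishing hφ hφc hN hq m hm
      exact ⟨C, fun _ => hC⟩
    · exact ⟨0, fun h => absurd h hm⟩
  choose C₁ hC₁ using hlow
  have hmono : ∀ {m : ℕ} {C C' : ℝ≥0}, C ≤ C' → SupSquareBound γ φ m q C →
      SupSquareBound γ φ m q C' := fun {m C C'} hCC' hC J hJ h hh => by
    refine (hC J hJ h hh).trans ?_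
    gcongr
  refine ⟨C₀ + ∑ m ∈ Finset.range 4, C₁ m, fun m hm => ?_⟩
  rcases le_or_gt 4 m with h4 | h4
  · exact hmono le_self_add (hC₀ m h4)
  · refine hmono ?_ (hC₁ m hm)
    exact (Finset.single_le_sum (f := C₁) (fun _ _ => zero_le) (Finset.mem_range.2 h4)).trans
      le_add_self

end Assembly

/-! ### Passage to general `h` and to all scales. -/

section Conclusion

variable {γ : ℝ → ℝ} {φ : ℝ → ℂ}

lemma exists_schwartz_kernel (hφ : ContDiff ℝ ∞ φ) (hφc : HasCompactSupport φ) {j : ℕ} (p : ℕ)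
    (hj : scale γ j ≠ 0) : ∃ S : SchwartzMap ℝ ℂ, ∀ x, S x = invFourier (phiPiece γ φ j p) x := by
  have hpc : HasCompactSupport (phiPiece γ φ j p) := by
    rw [phiPiece_eq]
    exact (hφc.comp_homeomorph (Homeomorph.subRight (p : ℝ))).comp_homeomorph
      (Homeomorph.mulLeft₀ _ hj)
  have hps : ContDiff ℝ ∞ (phiPiece γ φ j p) := by
    rw [phiPiece_eq]
    exact hφ.comp (by fun_prop)
  obtain ⟨S, hS, -⟩ := exists_schwartz_invFourier hps hpc
  exact ⟨S, hS⟩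

lemma continuous_localize (hφ : ContDiff ℝ ∞ φ) (hφc : HasCompactSupport φ) {j : ℕ} (p : ℕ)
    (hj : scale γ j ≠ 0) {h : ℝ → ℂ} (hh : Integrable h) : Continuous (localize γ φ j p h) := by
  obtain ⟨S, hS⟩ := exists_schwartz_kernel hφ hφc p hj
  obtain ⟨D, hD0, hD⟩ := schwartzMap_exists_bound_inv_one_add_sq S
  have hSe : invFourier (phiPiece γ φ j p) = S := funext fun x => (hS x).symm
  rw [localize, hSe]
  refine BddAbove.continuous_convolution_right_of_integrable _ ⟨D, ?_⟩ hh S.continuous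
  rintro _ ⟨z, rfl⟩
  exact (hD z).trans
    (mul_le_of_le_one_right hD0 (inv_le_one_of_one_le₀ (by nlinarith [sq_nonneg z])))

/-- Functions in `L^q` are limits of integrable bounded truncations, along which all pieces
converge pointwise. -/
lemma exists_truncations (hφ : ContDiff ℝ ∞ φ) (hφc : HasCompactSupport φ) {q q' : ℝ}
    (hqq : q.HolderConjugate q') {h : ℝ → ℂ} (hh : MemLp h (ENNReal.ofReal q) volume) :
    ∃ H : ℕ → ℝ → ℂ, (∀ n, IntegrableBounded (H n)) ∧
      (∀ n, ∫⁻ x, ‖H n x‖ₑ ^ q ≤ ∫⁻ x, ‖h x‖ₑ ^ q) ∧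
      ∀ j p, scale γ j ≠ 0 → ∀ x, Filter.Tendsto (fun n => localize γ φ j p (H n) x) Filter.atTop
        (nhds (localize γ φ j p h x)) := by
  obtain ⟨f, hfm, hhf⟩ := hh.1
  have hf : MemLp f (ENNReal.ofReal q) volume := hh.ae_eq hhf
  set s : ℕ → Set ℝ := fun n => Icc (-(n : ℝ)) n ∩ {t | ‖f t‖ ≤ n} with hs
  have hsm : ∀ n, MeasurableSet (s n) := fun n =>
    measurableSet_Icc.inter (measurableSet_le hfm.norm.measurable measurable_const)
  have hle : ∀ n t, ‖(s n).indicator f t‖ ≤ ‖f t‖ := fun n t => norm_indicator_le_norm_self f t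
  have hbd : ∀ n t, ‖(s n).indicator f t‖ ≤ (Icc (-(n : ℝ)) n).indicator (fun _ => (n : ℝ)) t :=
    fun n t => by
      by_cases ht : t ∈ s n
      · rw [indicator_of_mem ht, indicator_of_mem ht.1]
        exact ht.2
      · rw [indicator_of_notMem ht, norm_zero]
        exact indicator_nonneg (fun _ _ => Nat.cast_nonneg n) t
  refine ⟨fun n => (s n).indicator f, fun n => ⟨?_, n, Filter.Eventually.of_forall fun t =>
    (hbd n t).trans ?_⟩, fun n => ?_, fun j p hj x => ?_⟩
  · have h1 : Integrable ((Icc (-(n : ℝ)) n).indicator fun _ : ℝ => (n : ℝ)) :=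
      (integrable_indicator_iff measurableSet_Icc).2 (integrableOn_const (by simp))
    exact h1.mono' (hfm.indicator (hsm n)).aestronglyMeasurable
      (Filter.Eventually.of_forall (hbd n))
  · exact indicator_le_self' (fun _ _ => Nat.cast_nonneg n) t
  · refine lintegral_mono_ae ?_
    filter_upwards [hhf] with t ht
    rw [ht]
    refine ENNReal.rpow_le_rpow ?_ hqq.nonneg
    rw [← ofReal_norm, ← ofReal_norm]
    exact ENNReal.ofReal_le_ofReal (hle n t)
  · rw [localize_congr_ae hhf]
    obtain ⟨S, hS⟩ := exists_schwartz_kernel hφ hφc p hj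
    simp only [localize_apply, ← hS]
    have hSx : Continuous fun t => S (x - t) := S.continuous.comp (by fun_prop)
    -- Hölder: the kernel is Schwartz, hence in the dual `L^{q'}`, which supplies the dominating
    -- function for every `x`.
    have hint : Integrable (fun t => ‖f t * S (x - t)‖) := by
      have h1 : MemLp (fun t => S (x - t)) (ENNReal.ofReal q') volume :=
        (S.memLp (ENNReal.ofReal q') volume).comp_measurePreserving
          (Measure.measurePreserving_sub_left volume x)
      have : (ENNReal.ofReal q).HolderConjugate (ENNReal.ofReal q') := hqq.ennrealOfReal
      exact (hf.integrable_mul h1).norm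
    refine tendsto_integral_of_dominated_convergence _ (fun n => ?_) hint (fun n => ?_) ?_
    · exact (hfm.indicator (hsm n)).aestronglyMeasurable.mul hSx.aestronglyMeasurable
    · refine Filter.Eventually.of_forall fun t => ?_
      rw [norm_mul, norm_mul]
      gcongr
      exact hle n t
    · refine Filter.Eventually.of_forall fun t => ?_
      refine tendsto_const_nhds.congr' ?_
      obtain ⟨n₀, hn₀⟩ := exists_nat_ge (max |t| ‖f t‖)
      filter_upwards [Filter.eventually_ge_atTop n₀] with n hn
      have hnn : max |t| ‖f t‖ ≤ n := hn₀.trans (by exact_mod_cast hn)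
      rw [indicator_of_mem]
      exact ⟨abs_le.1 ((le_max_left _ _).trans hnn), (le_max_right _ _).trans hnn⟩

/-- Fatou along the truncations of `h`. Measurability also comes from the limit, as the truncated
suprema are continuous. -/
lemma supLocalize_bound_of_memLp (hφ : ContDiff ℝ ∞ φ) (hφc : HasCompactSupport φ) {q q' : ℝ}
    (hqq : q.HolderConjugate q') {m : ℕ} {C : ℝ≥0} (hC : SupSquareBound γ φ m q C) {h : ℝ → ℂ}
    (hh : MemLp h (ENNReal.ofReal q) volume) :
    (∀ j, scale γ j ≠ 0 → Measurable (supLocalize γ φ m j h)) ∧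
    ∀ J : Finset ℕ, (∀ j ∈ J, scale γ j ≠ 0) →
      ∫⁻ x, (∑ j ∈ J, supLocalize γ φ m j h x ^ 2) ^ (q / 2) ≤ C * ∫⁻ x, ‖h x‖ₑ ^ q := by
  obtain ⟨H, hHb, hHle, hHlim⟩ := exists_truncations (γ := γ) hφ hφc hqq hh
  have hlim : ∀ j, scale γ j ≠ 0 → ∀ x, Filter.Tendsto (fun n => supLocalize γ φ m j (H n) x)
      Filter.atTop (nhds (supLocalize γ φ m j h x)) := fun j hj x =>
    Filter.Tendsto.finset_sup_nhds_apply fun p _ => (hHlim j p hj x).enorm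
  have hmeas : ∀ n j, scale γ j ≠ 0 → Measurable (supLocalize γ φ m j (H n)) := fun n j hj =>
    (Continuous.finset_sup_apply fun p _ =>
      (continuous_localize hφ hφc p hj (hHb n).integrable).enorm).measurable
  refine ⟨fun j hj => measurable_of_tendsto_metrizable (fun n => hmeas n j hj)
    (tendsto_pi_nhds.2 (hlim j hj)), fun J hJ => ?_⟩
  have hsum : ∀ x, Filter.Tendsto
      (fun n => (∑ j ∈ J, supLocalize γ φ m j (H n) x ^ 2) ^ (q / 2)) Filter.atTop
      (nhds ((∑ j ∈ J, supLocalize γ φ m j h x ^ 2) ^ (q / 2))) := fun x =>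
    (tendsto_finsetSum J fun j hj => ENNReal.Tendsto.pow (hlim j (hJ j hj) x)).ennrpow_const _
  calc ∫⁻ x, (∑ j ∈ J, supLocalize γ φ m j h x ^ 2) ^ (q / 2)
      = ∫⁻ x, Filter.liminf (fun n => (∑ j ∈ J, supLocalize γ φ m j (H n) x ^ 2) ^ (q / 2))
          Filter.atTop := lintegral_congr fun x => (hsum x).liminf_eq.symm
    _ ≤ Filter.liminf (fun n => ∫⁻ x, (∑ j ∈ J, supLocalize γ φ m j (H n) x ^ 2) ^ (q / 2))
          Filter.atTop := lintegral_liminf_le fun n =>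
        (Finset.measurable_fun_sum J fun j hj => (hmeas n j (hJ j hj)).pow_const 2).pow_const _
    _ ≤ Filter.liminf (fun _ : ℕ => C * ∫⁻ x, ‖h x‖ₑ ^ q) Filter.atTop :=
        Filter.liminf_le_liminf (Filter.Eventually.of_forall fun n =>
          (hC J hJ (H n) (hHb n)).trans (mul_le_mul_right (hHle n) _))
    _ = C * ∫⁻ x, ‖h x‖ₑ ^ q := Filter.liminf_const _

/-- The maximal localisation at scales where `γ'` does not vanish, and `0` at the others. -/
def supLocalizeNe (γ : ℝ → ℝ) (φ : ℝ → ℂ) (m : ℕ) (h : ℝ → ℂ) (j : ℕ) (x : ℝ) : ℝ≥0∞ :=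
  open Classical in if scale γ j = 0 then 0 else supLocalize γ φ m j h x

lemma lintegral_tsum_supLocalizeNe_le (hφ : ContDiff ℝ ∞ φ) (hφc : HasCompactSupport φ) {q q' : ℝ}
    (hqq : q.HolderConjugate q') {m : ℕ} {C : ℝ≥0} (hC : SupSquareBound γ φ m q C) {h : ℝ → ℂ}
    (hh : MemLp h (ENNReal.ofReal q) volume) :
    ∫⁻ x, (∑' j, supLocalizeNe γ φ m h j x ^ 2) ^ (q / 2) ≤ C * ∫⁻ x, ‖h x‖ₑ ^ q := by
  classical
  obtain ⟨hm, hb⟩ := supLocalize_bound_of_memLp hφ hφc hqq hC hh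
  have hm' : ∀ j, Measurable (supLocalizeNe γ φ m h j) := fun j => by
    by_cases hj : scale γ j = 0
    · have : supLocalizeNe γ φ m h j = fun _ => 0 := funext fun x => if_pos hj
      rw [this]
      exact measurable_const
    · have : supLocalizeNe γ φ m h j = supLocalize γ φ m j h := funext fun x => if_neg hj
      rw [this]
      exact hm j hj
  have hsum : ∀ n x, ∑ j ∈ Finset.range n, supLocalizeNe γ φ m h j x ^ 2 =
      ∑ j ∈ Finset.range n with scale γ j ≠ 0, supLocalize γ φ m j h x ^ 2 := fun n x => by
    rw [Finset.sum_filter]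
    refine Finset.sum_congr rfl fun j _ => ?_
    by_cases hj : scale γ j = 0 <;> simp [supLocalizeNe, hj]
  have hlim : ∀ x, Filter.Tendsto
      (fun n => (∑ j ∈ Finset.range n, supLocalizeNe γ φ m h j x ^ 2) ^ (q / 2)) Filter.atTop
      (nhds ((∑' j, supLocalizeNe γ φ m h j x ^ 2) ^ (q / 2))) := fun x =>
    (ENNReal.tendsto_nat_tsum _).ennrpow_const _
  calc ∫⁻ x, (∑' j, supLocalizeNe γ φ m h j x ^ 2) ^ (q / 2)
      = ∫⁻ x, Filter.liminf (fun n =>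
          (∑ j ∈ Finset.range n, supLocalizeNe γ φ m h j x ^ 2) ^ (q / 2)) Filter.atTop :=
        lintegral_congr fun x => (hlim x).liminf_eq.symm
    _ ≤ Filter.liminf (fun n => ∫⁻ x,
          (∑ j ∈ Finset.range n, supLocalizeNe γ φ m h j x ^ 2) ^ (q / 2)) Filter.atTop :=
        lintegral_liminf_le fun n =>
          (Finset.measurable_fun_sum _ fun j _ => (hm' j).pow_const 2).pow_const _
    _ ≤ Filter.liminf (fun _ : ℕ => C * ∫⁻ x, ‖h x‖ₑ ^ q) Filter.atTop := by
        refine Filter.liminf_le_liminf (Filter.Eventually.of_forall fun n => ?_)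
        simp_rw [hsum]
        exact hb _ fun j hj => (Finset.mem_filter.1 hj).2
    _ = C * ∫⁻ x, ‖h x‖ₑ ^ q := Filter.liminf_const _

/-- The decoupling of the two factors: `h` is replaced by its supremum over `p`, after which the sum
over `p` falls on `g` alone. -/
lemma squareFunction_le {Cg M : ℝ} {m : ℕ} {g h : ℝ → ℂ} {x : ℝ}
    (hm : ∀ p : ℕ, 2 ^ m ≤ p → p ≤ 2 ^ (m + 1) → φ (-(p : ℝ)) = 0)
    (hg : ∀ j, scale γ j ≠ 0 → ∀ s : Finset ℕ,
      ∑ p ∈ s, ‖localize γ φ j p g x‖ ^ 2 ≤ Cg * M ^ 2) :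
    squareFunction γ φ m g h x ≤
      (ENNReal.ofReal (Cg * M ^ 2) * ∑' j, supLocalizeNe γ φ m h j x ^ 2) ^ (1 / 2 : ℝ) := by
  classical
  rw [squareFunction, ← ENNReal.tsum_mul_left]
  refine ENNReal.rpow_le_rpow (ENNReal.tsum_le_tsum fun j => ?_) (by norm_num)
  by_cases hj : scale γ j = 0
  · rw [Finset.sum_eq_zero]
    · exact zero_le
    · intro p hp
      rw [Finset.mem_Icc] at hp
      rw [localize_of_scale_eq_zero hj (hm p hp.1 hp.2), zero_mul, enorm_zero]
      norm_num
  · rw [supLocalizeNe, if_neg hj]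
    calc ∑ p ∈ Finset.Icc (2 ^ m) (2 ^ (m + 1)),
          ‖localize γ φ j p g x * localize γ φ j p h x‖ₑ ^ 2
        ≤ ∑ p ∈ Finset.Icc (2 ^ m) (2 ^ (m + 1)),
            ENNReal.ofReal (‖localize γ φ j p g x‖ ^ 2) * supLocalize γ φ m j h x ^ 2 := by
          refine Finset.sum_le_sum fun p hp => ?_
          rw [enorm_mul, mul_pow, ENNReal.ofReal_pow (norm_nonneg _), ofReal_norm]
          gcongr
          exact Finset.le_sup (f := fun p => ‖localize γ φ j p h x‖ₑ) hp
      _ = ENNReal.ofReal (∑ p ∈ Finset.Icc (2 ^ m) (2 ^ (m + 1)), ‖localize γ φ j p g x‖ ^ 2) *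
            supLocalize γ φ m j h x ^ 2 := by
          rw [← Finset.sum_mul, ENNReal.ofReal_sum_of_nonneg fun p _ => by positivity]
      _ ≤ _ := by
          gcongr
          exact hg j hj _

end Conclusion

end CurvedBHT

end

theorem mainTheorem9 (γ : ℝ → ℝ) (hγ : CurvedBHT.AdmissibleNearOrigin γ)
    (φ : ℝ → ℂ) (hφ : ContDiff ℝ ∞ φ) (hφc : HasCompactSupport φ)
    (hφs : tsupport φ ⊆ {x : ℝ | 1 / 10 < |x| ∧ |x| < 10})
    (p p' : ℝ) (hp : 1 < p) (hpp' : 1 / p + 1 / p' = 1) :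
    ∃ C : ℝ≥0, ∀ m : ℕ,
      (∀ p₀ : ℕ, 2 ^ m ≤ p₀ → p₀ ≤ 2 ^ (m + 1) → φ (-(p₀ : ℝ)) = 0) →
      ∀ g h : ℝ → ℂ, MemLp g ∞ volume → MemLp h (ENNReal.ofReal p') volume →
        eLpNorm (CurvedBHT.squareFunction γ φ m g h) (ENNReal.ofReal p') volume
          ≤ C * eLpNorm g ∞ volume * eLpNorm h (ENNReal.ofReal p') volume := by
  have hconj : p.HolderConjugate p' :=
    Real.holderConjugate_iff.2 ⟨hp, by simpa only [one_div] using hpp'⟩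
  -- The `L^q` results are applied with `q = p'`, whose conjugate exponent is `p`.
  have hq : 1 < p' := hconj.symm.lt
  have hq0 : 0 < p' := hconj.symm.pos
  obtain ⟨N, hN⟩ := hγ.exists_boundedMultiplicity
  obtain ⟨Cs, hCs⟩ := CurvedBHT.exists_supSquareBound hφ hφc hφs hN hq
  obtain ⟨Cg, hCg0, hCg⟩ := CurvedBHT.exists_sum_norm_sq_localize_le hφ hφc
  refine ⟨Cg.toNNReal ^ (1 / 2 : ℝ) * Cs ^ (1 / p'), fun m hm g h hg hh => ?_⟩
  set M := (eLpNorm g ∞ volume).toReal with hM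
  have hMe : ENNReal.ofReal M = eLpNorm g ∞ volume := ENNReal.ofReal_toReal hg.2.ne
  have hgM : ∀ᵐ t, ‖g t‖ ≤ M := by
    have h1 := ae_le_eLpNormEssSup (f := g) (μ := volume)
    rw [← eLpNorm_exponent_top] at h1
    filter_upwards [h1] with t ht
    rw [← hMe, ← ofReal_norm] at ht
    exact (ENNReal.ofReal_le_ofReal_iff ENNReal.toReal_nonneg).1 ht
  have hpt : ∀ x, CurvedBHT.squareFunction γ φ m g h x ≤ (ENNReal.ofReal (Cg * M ^ 2) *
      ∑' j, CurvedBHT.supLocalizeNe γ φ m h j x ^ 2) ^ (1 / 2 : ℝ) := fun x =>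
    CurvedBHT.squareFunction_le hm fun j hj s =>
      hCg γ g M ENNReal.toReal_nonneg hg.1 hgM j hj x s
  have hint : ∫⁻ x, ‖CurvedBHT.squareFunction γ φ m g h x‖ₑ ^ p' ≤
      ENNReal.ofReal (Cg * M ^ 2) ^ (p' / 2) * (Cs * ∫⁻ x, ‖h x‖ₑ ^ p') := by
    calc ∫⁻ x, ‖CurvedBHT.squareFunction γ φ m g h x‖ₑ ^ p'
        ≤ ∫⁻ x, ENNReal.ofReal (Cg * M ^ 2) ^ (p' / 2) *
            (∑' j, CurvedBHT.supLocalizeNe γ φ m h j x ^ 2) ^ (p' / 2) := by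
          refine lintegral_mono fun x => ?_
          rw [enorm_eq_self, ← ENNReal.mul_rpow_of_nonneg _ _ (by positivity)]
          refine (ENNReal.rpow_le_rpow (hpt x) hq0.le).trans (le_of_eq ?_)
          rw [← ENNReal.rpow_mul]
          congr 1
          ring
      _ = ENNReal.ofReal (Cg * M ^ 2) ^ (p' / 2) *
            ∫⁻ x, (∑' j, CurvedBHT.supLocalizeNe γ φ m h j x ^ 2) ^ (p' / 2) :=
          lintegral_const_mul' _ _
            (ENNReal.rpow_ne_top_of_nonneg (by positivity) ENNReal.ofReal_ne_top)
      _ ≤ _ := by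
          gcongr
          exact CurvedBHT.lintegral_tsum_supLocalizeNe_le hφ hφc hconj.symm (hCs m hm) hh
  have hp0 : ENNReal.ofReal p' ≠ 0 := by simpa using hq0
  rw [eLpNorm_eq_lintegral_rpow_enorm_toReal hp0 ENNReal.ofReal_ne_top,
    eLpNorm_eq_lintegral_rpow_enorm_toReal hp0 ENNReal.ofReal_ne_top,
    ENNReal.toReal_ofReal hq0.le, ← hMe]
  calc (∫⁻ x, ‖CurvedBHT.squareFunction γ φ m g h x‖ₑ ^ p') ^ (1 / p')
      ≤ (ENNReal.ofReal (Cg * M ^ 2) ^ (p' / 2) * (Cs * ∫⁻ x, ‖h x‖ₑ ^ p')) ^ (1 / p') :=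
        ENNReal.rpow_le_rpow hint (by positivity)
    _ = ENNReal.ofReal (Cg * M ^ 2) ^ (1 / 2 : ℝ) *
          ((Cs : ℝ≥0∞) ^ (1 / p') * (∫⁻ x, ‖h x‖ₑ ^ p') ^ (1 / p')) := by
        rw [ENNReal.mul_rpow_of_nonneg _ _ (by positivity),
          ENNReal.mul_rpow_of_nonneg _ _ (by positivity), ← ENNReal.rpow_mul]
        congr 2
        field_simp
    _ = _ := by
        have hsqrt : ENNReal.ofReal (Cg * M ^ 2) ^ (1 / 2 : ℝ) =
            ENNReal.ofReal Cg ^ (1 / 2 : ℝ) * ENNReal.ofReal M := by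
          rw [ENNReal.ofReal_mul hCg0, ENNReal.mul_rpow_of_nonneg _ _ (by norm_num),
            ENNReal.ofReal_pow ENNReal.toReal_nonneg, ← ENNReal.rpow_natCast, ← ENNReal.rpow_mul,
            show ((2 : ℕ) : ℝ) * (1 / 2) = 1 by norm_num, ENNReal.rpow_one]
        rw [hsqrt, ENNReal.coe_mul, ENNReal.coe_rpow_of_nonneg _ (by norm_num),
          ENNReal.coe_rpow_of_nonneg _ (by positivity)]
        simp only [ENNReal.ofReal]
        ring
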